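/- Let $Q$ be a smooth ($C^\infty$, Hausdorff, second countable, boundaryless) manifold of dimension $n$, $\pi:T^*Q\to Q$ its cotangent bundle, $\vartheta=p_i\,dx^i$ the tautological $1$-form and $\omega=-d\vartheta$ the canonical symplectic form. For $H\in C^\infty(T^*Q)$ the Hamiltonian vector field $X_H$ is defined by $i_{X_H}\omega=dH$. *Hybrid systems.* Let $M$ be a manifold, $X$ a vector field on $M$, $S\subset M$ a guard and $\Delta:S\to M$ a smooth reset with $S\cap\Delta(S)=\emptyset$. A state follows $\dot x=X(x)$ until it meets $S$, is then reset by $\Delta$, and continues; at an impact time its value is the state just before the reset. The system is said to preserve a differential form $\alpha$ on $M$ if * (flow) whenever $t\ge 0$, $U\subset M$ is open with $U\cap S=\emptyset$, and the time-$t$ hybrid flow $\varphi_t$ is defined and smooth on $U$, one has $(\varphi_t^*\alpha)_x=\alpha_x$ for all $x\in U$ with $\varphi_t(x)\notin S$; * (specular condition) $\Delta^*\alpha=\iota^*\alpha$, and * (energy condition) $\Delta^*i_X\alpha=\iota^*i_X\alpha$, where $\iota:S\hookrightarrow M$ is the inclusion. *Time-independent impact systems.* Let $H\in C^\infty(T^*Q)$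 and let $h\in C^\infty(Q)$ have $0$ as a regular value. The guard is $S^*=\{(x,p)\in T^*Q: h(x)=0,\ (\pi^*dh)(X_H)>0\}$, and the reset is a smooth map $\Delta:S^*\to T^*Q$ with $S^*\cap\Delta(S^*)=\emptyset$ that satisfies the corner conditions $$x^+=x^-,\qquad p^+=p^-+\varepsilon\,dh,\qquad H^+=H^-$$ for some multiplier $\varepsilon\in\mathbb R$ depending on the point. Then the hybrid system $(T^*Q,S^*,X_H,\Delta)$ preserves $\omega$ and the volume form $\omega^n$. *Time-dependent impact systems.* Let $H\in C^\infty(\mathbb R\times T^*Q)$ and let $h\in C^\infty(\mathbb R\times Q)$ have $0$ as a regular value (the surface $h(t,\cdot)=0$ may move, or be fixed). On $\mathbb R\times T^*Q$ put $\bar X=\partial_t+X_{H(t,\cdot)}$, $\vartheta_H=p_i\,dx^i-H\,dt$ and $\omega_H=-d\vartheta_H$. The guard is $\bar S=\{(t,x,p): h(t,x)=0,\ dh(\bar X)>0\}$ (with $h$ pulled back to $\mathbb R\times T^*Q$), and the reset is a smooth map $\bar\Delta:\bar S\to\mathbb R\times T^*Q$ with $\bar S\cap\bar\Delta(\bar S)=\emptyset$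 that satisfies $$t^+=t^-,\qquad x^+=x^-,\qquad p^+-p^-=\varepsilon\,\frac{\partial h}{\partial x},\qquad -(H^+-H^-)=\varepsilon\,\frac{\partial h}{\partial t}$$ for some $\varepsilon\in\mathbb R$ depending on the point. Then the hybrid system $(\mathbb R\times T^*Q,\bar S,\bar X,\bar\Delta)$ preserves $\omega_H$ and the volume form $dt\wedge\omega_H^n$. -/

import Mathlib

open Set Filter Topology Bundle
open scoped Manifold ContDiff

noncomputable section

/-! ### Exterior algebra on a real vector space -/

section Algebra

variable {V : Type*} [AddCommGroup V] [Module ℝ V]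

/-- The wedge product of two real-valued alternating forms (sum over shuffles). -/
def wedge {k l : ℕ} (a : V [⋀^Fin k]→ₗ[ℝ] ℝ) (b : V [⋀^Fin l]→ₗ[ℝ] ℝ) :
    V [⋀^Fin (k + l)]→ₗ[ℝ] ℝ :=
  ((LinearMap.mul' ℝ ℝ).compAlternatingMap (a.domCoprod b)).domDomCongr finSumFinEquiv

/-- The `m`-fold wedge power of a 2-form; the 0-th power is the constant 0-form `1`. -/
def wedgePow (a : V [⋀^Fin 2]→ₗ[ℝ] ℝ) : (m : ℕ) → V [⋀^Fin (2 * m)]→ₗ[ℝ] ℝ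
  | 0 => AlternatingMap.constOfIsEmpty ℝ V (Fin 0) (1 : ℝ)
  | m + 1 => wedge (wedgePow a m) a

/-- Interior multiplication `i_x a = a(x, ·, …, ·)`; it is `0` on 0-forms. -/
def interiorMul (x : V) : {k : ℕ} → (V [⋀^Fin k]→ₗ[ℝ] ℝ) → V [⋀^Fin (k - 1)]→ₗ[ℝ] ℝ
  | 0, _ => 0
  | _ + 1, a => a.curryLeft x

end Algebra

/-! ### Differential forms and hybrid dynamics on a manifold -/

section Manifold

variable {E : Type*} [NormedAddCommGroup E] [NormedSpace ℝ E]
  {H : Type*} [TopologicalSpace H] (I : ModelWithCorners ℝ E H)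
  {M : Type*} [TopologicalSpace M] [ChartedSpace H M]

/-- The coordinate expression of a `k`-form in the preferred chart at `z`: the pullback of `α`
by the inverse of the chart. -/
def formInChart {k : ℕ} (α : (z : M) → TangentSpace I z [⋀^Fin k]→L[ℝ] ℝ) (z : M) (y : E) :
    E [⋀^Fin k]→L[ℝ] ℝ :=
  (α ((extChartAt I z).symm y)).compContinuousLinearMap
    (mfderivWithin 𝓘(ℝ, E) I (extChartAt I z).symm (range I) y)

/-- The exterior derivative of a `k`-form on a manifold, computed at `z` in the preferred chart at
`z` and pulled back by the chart. -/
def mextDeriv {k : ℕ} (α : (z : M) → TangentSpace I z [⋀^Fin k]→L[ℝ] ℝ) (z : M) :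
    TangentSpace I z [⋀^Fin (k + 1)]→L[ℝ] ℝ :=
  (extDerivWithin (formInChart I α z) (range I) (extChartAt I z z)).compContinuousLinearMap
    (mfderiv I 𝓘(ℝ, E) (extChartAt I z) z)

/-- `HybridReach I X S Δ t x y`: the hybrid system with vector field `X`, guard `S` and reset `Δ`
takes the state `x` to the state `y` in time `t ≥ 0`. The state follows `ẋ = X(x)` until it meets
`S`; if it is in `S` and time remains, it is reset by `Δ` and continues from there.
At an impact time the value is the state just before the reset. -/
inductive HybridReach (X : (z : M) → TangentSpace I z) (S : Set M) (Δ : M → M) :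
    ℝ → M → M → Prop
  | flow (t : ℝ) (γ : ℝ → M) (ht : 0 ≤ t) (hγ : IsMIntegralCurveOn (I := I) γ X (Icc 0 t))
      (hS : ∀ s ∈ Ico 0 t, γ s ∉ S) : HybridReach X S Δ t (γ 0) (γ t)
  | jump (s t : ℝ) (γ : ℝ → M) (y : M) (hs : 0 ≤ s)
      (hγ : IsMIntegralCurveOn (I := I) γ X (Icc 0 s))
      (hS : ∀ r ∈ Ico 0 s, γ r ∉ S) (hmem : γ s ∈ S) (ht : 0 < t)
      (hy : HybridReach X S Δ t (Δ (γ s)) y) : HybridReach X S Δ (s + t) (γ 0) y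

/-- The form `α` is preserved along the hybrid flow: whenever `F` is smooth on an open set `U`
disjoint from the guard and is the time-`t` hybrid flow there, `F^* α = α` at each point of `U`
whose image is not in the guard. -/
def PreservedByHybridFlow (X : (z : M) → TangentSpace I z) (S : Set M) (Δ : M → M) {k : ℕ}
    (α : (z : M) → TangentSpace I z [⋀^Fin k]→ₗ[ℝ] ℝ) : Prop :=
  ∀ (t : ℝ) (U : Set M) (F : M → M), IsOpen U → Disjoint U S → ContMDiffOn I I ∞ F U →
    (∀ x ∈ U, HybridReach I X S Δ t x (F x)) →
    ∀ x ∈ U, F x ∉ S → (α (F x)).compLinearMap (mfderiv I I F x).toLinearMap = α x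

/-- `v` is tangent at `z` to the embedded submanifold `S`: it is the velocity of a smooth curve
lying in `S`. -/
def IsTangentTo (S : Set M) (z : M) (v : TangentSpace I z) : Prop :=
  ∃ γ : ℝ → M, ContMDiffAt 𝓘(ℝ, ℝ) I ∞ γ 0 ∧ (∀ᶠ s in 𝓝 (0 : ℝ), γ s ∈ S) ∧
    (⟨γ 0, mfderiv 𝓘(ℝ, ℝ) I γ 0 (1 : ℝ)⟩ : TangentBundle I M) = ⟨z, v⟩

/-- `Δ^* α = ι^* α` on the guard `S`. On vectors tangent to `S` the derivative of `Δ` within `S` is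
the differential of `Δ : S → M`. -/
def ResetPullbackEq (S : Set M) (Δ : M → M) {k : ℕ}
    (α : (z : M) → TangentSpace I z [⋀^Fin k]→ₗ[ℝ] ℝ) : Prop :=
  ∀ z ∈ S, ∀ v : Fin k → TangentSpace I z, (∀ i, IsTangentTo I S z (v i)) →
    α (Δ z) (fun i => mfderivWithin I I Δ S z (v i)) = α z v

/-- A hybrid system preserves `α`: `α` is preserved along the hybrid flow, and it satisfies the
specular condition `Δ^* α = ι^* α` and the energy condition `Δ^* i_X α = ι^* i_X α`. -/
structure HybridPreserves (X : (z : M) → TangentSpace I z) (S : Set M) (Δ : M → M) {k : ℕ}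
    (α : (z : M) → TangentSpace I z [⋀^Fin k]→ₗ[ℝ] ℝ) : Prop where
  flow : PreservedByHybridFlow I X S Δ α
  specular : ResetPullbackEq I S Δ α
  energy : ResetPullbackEq I S Δ (fun z => interiorMul (X z) (α z))

/-- The differential of a real function, as a covector at each point. -/
def differential (g : M → ℝ) (z : M) : TangentSpace I z →L[ℝ] ℝ :=
  mfderiv I 𝓘(ℝ, ℝ) g z

/-- The part of the zero set of `g` at which `X` points towards increasing `g`. -/
def outwardGuard (X : (z : M) → TangentSpace I z) (g : M → ℝ) : Set M :=
  {z | g z = 0 ∧ 0 < differential I g z (X z)}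

end Manifold

/-! ### The cotangent bundle and its canonical forms -/

section Cotangent

variable (n : ℕ) (Q : Type*) [TopologicalSpace Q] [ChartedSpace (EuclideanSpace ℝ (Fin n)) Q]
  [IsManifold (𝓡 n) ∞ Q]

/-- The cotangent bundle of the `n`-dimensional manifold `Q`. -/
abbrev CotangentBundle : Type _ :=
  TotalSpace (EuclideanSpace ℝ (Fin n) →L[ℝ] ℝ)
    (fun x : Q => TangentSpace (𝓡 n) x →L[ℝ] Bundle.Trivial Q ℝ x)

/-- The model with corners of the cotangent bundle. -/
abbrev cotangentModel :
    ModelWithCorners ℝ (EuclideanSpace ℝ (Fin n) × (EuclideanSpace ℝ (Fin n) →L[ℝ] ℝ))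
      (ModelProd (EuclideanSpace ℝ (Fin n)) (EuclideanSpace ℝ (Fin n) →L[ℝ] ℝ)) :=
  (𝓡 n).prod 𝓘(ℝ, EuclideanSpace ℝ (Fin n) →L[ℝ] ℝ)

/-- The model with corners of the extended phase space `ℝ × T^*Q`. -/
abbrev extendedModel :
    ModelWithCorners ℝ (ℝ × (EuclideanSpace ℝ (Fin n) × (EuclideanSpace ℝ (Fin n) →L[ℝ] ℝ)))
      (ModelProd ℝ (ModelProd (EuclideanSpace ℝ (Fin n)) (EuclideanSpace ℝ (Fin n) →L[ℝ] ℝ))) :=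
  𝓘(ℝ, ℝ).prod (cotangentModel n)

variable {n Q}

/-- The tautological covector `p_i dx^i` at `z = (x, p)`: it is `p ∘ dπ`. -/
def tautologicalCovector (z : CotangentBundle n Q) :
    TangentSpace (cotangentModel n) z →L[ℝ] ℝ :=
  (show TangentSpace (𝓡 n) z.proj →L[ℝ] ℝ from z.snd).comp
    (mfderiv (cotangentModel n) (𝓡 n) (fun w : CotangentBundle n Q => w.proj) z)

/-- The tautological 1-form `ϑ = p_i dx^i` on `T^*Q`. -/
def tautologicalForm (z : CotangentBundle n Q) :
    TangentSpace (cotangentModel n) z [⋀^Fin 1]→L[ℝ] ℝ :=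
  ContinuousAlternatingMap.ofSubsingleton ℝ _ ℝ (0 : Fin 1) (tautologicalCovector z)

/-- The canonical symplectic form `ω = -dϑ` on `T^*Q`. -/
def symplecticForm (z : CotangentBundle n Q) :
    TangentSpace (cotangentModel n) z [⋀^Fin 2]→ₗ[ℝ] ℝ :=
  (-mextDeriv (cotangentModel n) tautologicalForm z).toAlternatingMap

/-- `X` is the Hamiltonian vector field of `H`: `i_X ω = dH`. -/
def IsHamiltonianVectorField (H : CotangentBundle n Q → ℝ)
    (X : (z : CotangentBundle n Q) → TangentSpace (cotangentModel n) z) : Prop :=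
  ∀ z v, symplecticForm z ![X z, v] = differential (cotangentModel n) H z v

/-- The covector `dt` at a point of `ℝ × T^*Q`. -/
def timeCovector (w : ℝ × CotangentBundle n Q) : TangentSpace (extendedModel n) w →L[ℝ] ℝ :=
  differential (extendedModel n) (fun w : ℝ × CotangentBundle n Q => w.1) w

/-- The 1-form `dt` on `ℝ × T^*Q`. -/
def timeForm (w : ℝ × CotangentBundle n Q) :
    TangentSpace (extendedModel n) w [⋀^Fin 1]→ₗ[ℝ] ℝ :=
  (ContinuousAlternatingMap.ofSubsingleton ℝ _ ℝ (0 : Fin 1) (timeCovector w)).toAlternatingMap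

/-- The action form `ϑ_H = p_i dx^i - H dt` on `ℝ × T^*Q`. -/
def actionForm (H : ℝ × CotangentBundle n Q → ℝ) (w : ℝ × CotangentBundle n Q) :
    TangentSpace (extendedModel n) w [⋀^Fin 1]→L[ℝ] ℝ :=
  ContinuousAlternatingMap.ofSubsingleton ℝ _ ℝ (0 : Fin 1)
    ((tautologicalCovector w.2).comp (mfderiv (extendedModel n) (cotangentModel n)
        (fun w : ℝ × CotangentBundle n Q => w.2) w)
      - H w • timeCovector w)

/-- The form `ω_H = -dϑ_H` on `ℝ × T^*Q`. -/
def extendedSymplecticForm (H : ℝ × CotangentBundle n Q → ℝ) (w : ℝ × CotangentBundle n Q) :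
    TangentSpace (extendedModel n) w [⋀^Fin 2]→ₗ[ℝ] ℝ :=
  (-mextDeriv (extendedModel n) (actionForm H) w).toAlternatingMap

/-- The vector field `∂_t + X_t` on `ℝ × T^*Q`. -/
def suspendedField (X : ℝ → (z : CotangentBundle n Q) → TangentSpace (cotangentModel n) z)
    (w : ℝ × CotangentBundle n Q) : TangentSpace (extendedModel n) w :=
  ((1 : ℝ), X w.1 w.2)

end Cotangent

/-! ### Impact systems -/

section Impact

variable (n : ℕ) (Q : Type*) [TopologicalSpace Q] [ChartedSpace (EuclideanSpace ℝ (Fin n)) Q]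
  [IsManifold (𝓡 n) ∞ Q]

/-- A (time-independent) impact system `(Q, H, h)`: a smooth Hamiltonian `H` on `T^*Q` and a smooth
function `h` on `Q` with regular value `0`; the impact surface is `S = h⁻¹(0)`. -/
structure ImpactSystem where
  ham : CotangentBundle n Q → ℝ
  ham_smooth : ContMDiff (cotangentModel n) 𝓘(ℝ, ℝ) ∞ ham
  surf : Q → ℝ
  surf_smooth : ContMDiff (𝓡 n) 𝓘(ℝ, ℝ) ∞ surf
  surf_regular : ∀ x, surf x = 0 → differential (𝓡 n) surf x ≠ 0

/-- A time-dependent impact system: a smooth Hamiltonian on `ℝ × T^*Q` and a smooth function `h`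
on `ℝ × Q` with regular value `0`; the (possibly moving) impact surface is `h(t, x) = 0`. -/
structure TimeDependentImpactSystem where
  ham : ℝ × CotangentBundle n Q → ℝ
  ham_smooth : ContMDiff (extendedModel n) 𝓘(ℝ, ℝ) ∞ ham
  surf : ℝ × Q → ℝ
  surf_smooth : ContMDiff (𝓘(ℝ, ℝ).prod (𝓡 n)) 𝓘(ℝ, ℝ) ∞ surf
  surf_regular : ∀ y, surf y = 0 → differential (𝓘(ℝ, ℝ).prod (𝓡 n)) surf y ≠ 0

variable {n Q}

/-- The guard `S^*`: outward pointing momenta over `S`, i.e. `(π^* dh)(X) > 0`. -/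
def ImpactSystem.guard (P : ImpactSystem n Q)
    (X : (z : CotangentBundle n Q) → TangentSpace (cotangentModel n) z) :
    Set (CotangentBundle n Q) :=
  outwardGuard (cotangentModel n) X (fun z => P.surf z.proj)

/-- `Δ` is a reset of the impact system: a smooth map on the guard, whose image is disjoint from
the guard, given by the corner conditions `x⁺ = x⁻`, `p⁺ = p⁻ + ε dh`, `H⁺ = H⁻`. -/
structure ImpactSystem.IsReset (P : ImpactSystem n Q)
    (X : (z : CotangentBundle n Q) → TangentSpace (cotangentModel n) z)
    (Δ : CotangentBundle n Q → CotangentBundle n Q) : Prop where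
  smooth : ContMDiffOn (cotangentModel n) (cotangentModel n) ∞ Δ (P.guard X)
  disjoint : Disjoint (P.guard X) (Δ '' P.guard X)
  momentum : ∀ z ∈ P.guard X, ∃ ε : ℝ,
    Δ z = ⟨z.proj, (show TangentSpace (𝓡 n) z.proj →L[ℝ] ℝ from z.snd) +
      ε • differential (𝓡 n) P.surf z.proj⟩
  energy : ∀ z ∈ P.guard X, P.ham (Δ z) = P.ham z

/-- The guard in `ℝ × T^*Q`: points over the impact surface at which `h` increases along the
dynamics `∂_t + X_t`. -/
def TimeDependentImpactSystem.guard (P : TimeDependentImpactSystem n Q)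
    (X : ℝ → (z : CotangentBundle n Q) → TangentSpace (cotangentModel n) z) :
    Set (ℝ × CotangentBundle n Q) :=
  outwardGuard (extendedModel n) (suspendedField X) (fun w => P.surf (w.1, w.2.proj))

/-- `Δ` is a reset of the time-dependent impact system: a smooth map on the guard, whose image is
disjoint from the guard, given by the corner conditions `t⁺ = t⁻`, `x⁺ = x⁻`,
`p⁺ - p⁻ = ε ∂h/∂x`, `-(H⁺ - H⁻) = ε ∂h/∂t`. -/
structure TimeDependentImpactSystem.IsReset (P : TimeDependentImpactSystem n Q)
    (X : ℝ → (z : CotangentBundle n Q) → TangentSpace (cotangentModel n) z)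
    (Δ : ℝ × CotangentBundle n Q → ℝ × CotangentBundle n Q) : Prop where
  smooth : ContMDiffOn (extendedModel n) (extendedModel n) ∞ Δ (P.guard X)
  disjoint : Disjoint (P.guard X) (Δ '' P.guard X)
  corner : ∀ w ∈ P.guard X, ∃ ε : ℝ,
    Δ w = (w.1, ⟨w.2.proj,
      (show TangentSpace (𝓡 n) w.2.proj →L[ℝ] ℝ from w.2.snd) +
        ε • differential (𝓡 n) (fun x => P.surf (w.1, x)) w.2.proj⟩) ∧
    -(P.ham (Δ w) - P.ham w) = ε * deriv (fun s => P.surf (s, w.2.proj)) w.1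

end Impact

end

/-! Both kinds of impact system are instances of one structure, `PresymplecticImpact`. It consists
of a two-form Ω that is locally dq ∧ dp, and a field X with i_X Ω = dK and dT(X) = c, where Ω and dT
have no common kernel. The reset keeps K, T and the level g = 0, and respects Ω on vectors tangent
to the guard. In the time-independent case Ω = ω, K = H and T = 0. In the time-dependent case Ω =
ω_H, T = t, c = 1 and K = 0, because the suspended field lies in the kernel of ω_H.

Specular and energy conditions: a reset fixes q and changes p by ε dk, where k is the surface
function, so p dq changes by ε dk, which restricts to zero on k = 0. The multiplier ε is not known
to be differentiable, so it is eliminated before differentiating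
(`hasDerivAt_apply_eq_of_eventually_smul`, `form_reset_eq_of_jump`). For a moving surface p is
replaced by the covector p dx - H dt over ℝ × Q, and the corner conditions are the components of a
single jump along dh. The energy condition for Ω then only says that K is kept.

Flow condition at regular trajectories: between impacts Ω is invariant because L_X Ω = d i_X Ω = ddK
= 0 (`pairing_derivative_eq_zero`). Near an impact, flowing to the guard for time τ, resetting, and
flowing back for the same time has derivative u ↦ D(u + τ'(u)X) - τ'(u)X'. This preserves Ω by
bilinear algebra (`jump_preserves`). Nondegeneracy makes the field transversal to g = 0 after a
reset (`transversal_of_reset`). It cannot point outwards, since the image of the reset misses the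
guard, so it points inwards and a nearby trajectory has exactly one impact within a short time.

Flow condition in general: the map F is smooth, but neighbouring trajectories may graze the surface
or have different numbers of resets, so F need not be a composition of such pieces near every point.
Baire category repairs this. For each number N of resets the bad starting points are meagre
(`PresymplecticImpact.isMeagre_irregularPoints`): grazing is excluded by a one-dimensional Sard
argument, and meagre sets are pulled back through regular maps, which are local homeomorphisms
because they preserve Ω and dT. At the remaining points F coincides locally with a regular map.
These points are dense in the domain, and the identity F^*Ω = Ω extends by continuity
(`PresymplecticSystem.pullsBackAt_of_frequently`).

Volume forms: the value of ω^n or dt ∧ ω_H^n on a tuple depends only on the pairwise values of the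
two-form and on the values of dT (`GramDetermined`), so their preservation follows from that of Ω
and dT. Smooth dependence of flows on initial values is obtained from the implicit function theorem
in the Banach space of curves. -/

noncomputable section

/-! ### Smoothness of composition operators on spaces of continuous maps -/

section CompositionOperator

universe u
variable {K : Type*} [TopologicalSpace K] [CompactSpace K]
  {E F G : Type u} [NormedAddCommGroup E] [NormedSpace ℝ E] [NormedAddCommGroup F] [NormedSpace ℝ F]
  [NormedAddCommGroup G] [NormedSpace ℝ G]

/-- A continuous bilinear map applied pointwise to two continuous maps. -/
def pointwiseApply (B : G →L[ℝ] E →L[ℝ] F) : C(K, G) →L[ℝ] C(K, E) →L[ℝ] C(K, F) :=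
  LinearMap.mkContinuous₂
    (LinearMap.mk₂ ℝ
      (fun (A : C(K, G)) (v : C(K, E)) => (⟨fun k => B (A k) (v k), by fun_prop⟩ : C(K, F)))
      (fun _ _ _ => by ext; simp) (fun _ _ _ => by ext; simp)
      (fun _ _ _ => by ext; simp) (fun _ _ _ => by ext; simp)) ‖B‖
    (fun A v => by
      rw [ContinuousMap.norm_le _ (by positivity)]
      intro k
      calc ‖B (A k) (v k)‖ ≤ ‖B‖ * ‖A k‖ * ‖v k‖ := B.le_opNorm₂ _ _
        _ ≤ ‖B‖ * ‖A‖ * ‖v‖ := by gcongr <;> exact ContinuousMap.norm_coe_le_norm _ k)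

/-- Postcomposition with `f'` is continuous for the uniform norm, so `f'` varies little along all
segments from `w k` to `v k` at once. The mean value inequality on each segment then gives an error
bound independent of `k`. -/
theorem hasFDerivAt_continuousMap_comp (B : G →L[ℝ] E →L[ℝ] F) (f : C(E, F)) (f' : C(E, G))
    (hf : ∀ x, HasFDerivAt f (B (f' x)) x) (w : C(K, E)) :
    HasFDerivAt (fun v : C(K, E) => f.comp v) (pointwiseApply B (f'.comp w)) w := by
  rw [hasFDerivAt_iff_isLittleO, Asymptotics.isLittleO_iff]
  intro ε hε
  have hc : Continuous (fun v : C(K, E) => f'.comp v) := ContinuousMap.continuous_postcomp f'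
  obtain ⟨δ, hδ, h⟩ := Metric.continuous_iff.1 hc w (ε / (‖B‖ + 1)) (by positivity)
  filter_upwards [Metric.ball_mem_nhds w hδ] with v hv
  rw [ContinuousMap.norm_le _ (by positivity)]
  intro k
  have hseg : ∀ x ∈ segment ℝ (w k) (v k), ‖B (f' x) - B (f' (w k))‖ ≤ ε := by
    intro x hx
    obtain ⟨θ, hθ, rfl⟩ := (segment_eq_image_lineMap ℝ (w k) (v k)).subset hx
    have hv' : dist (w + θ • (v - w)) w < δ := by
      rw [dist_eq_norm, add_sub_cancel_left, norm_smul, Real.norm_of_nonneg hθ.1, ← dist_eq_norm]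
      calc θ * dist v w ≤ 1 * dist v w := by gcongr; exact hθ.2
        _ < δ := by simpa using hv
    have := (ContinuousMap.dist_apply_le_dist (f := f'.comp (w + θ • (v - w)))
      (g := f'.comp w) k).trans (h _ hv').le
    rw [dist_eq_norm] at this
    have hx : (w + θ • (v - w)) k = AffineMap.lineMap (w k) (v k) θ := by
      simp [AffineMap.lineMap_apply, add_comm]
    rw [← hx, ← map_sub]
    calc ‖B (f' ((w + θ • (v - w)) k) - f' (w k))‖
        ≤ ‖B‖ * ‖f' ((w + θ • (v - w)) k) - f' (w k)‖ := B.le_opNorm _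
      _ ≤ (‖B‖ + 1) * (ε / (‖B‖ + 1)) := by
          gcongr
          · linarith
          · exact this
      _ = ε := by field_simp
  have hmv := (convex_segment (w k) (v k)).norm_image_sub_le_of_norm_hasFDerivWithin_le'
    (f := f) (f' := fun x => B (f' x)) (φ := B (f' (w k)))
    (fun x _ => (hf x).hasFDerivWithinAt) hseg
    (left_mem_segment ℝ _ _) (right_mem_segment ℝ _ _)
  change ‖f (v k) - f (w k) - B (f' (w k)) ((v - w) k)‖ ≤ _
  calc ‖f (v k) - f (w k) - B (f' (w k)) ((v - w) k)‖ ≤ ε * ‖v k - w k‖ := by simpa using hmv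
    _ ≤ ε * ‖v - w‖ := by gcongr; exact ContinuousMap.norm_coe_le_norm (v - w) k

/-- The derivative is postcomposition with `fderiv ℝ f` followed by a continuous linear map, hence
an operator of the same kind with values in `E →L[ℝ] F`. The induction on `n` therefore has to run
over all codomains. -/
theorem contDiff_continuousMap_comp (n : ℕ) : ∀ {F : Type u} [NormedAddCommGroup F]
    [NormedSpace ℝ F] (f : C(E, F)), ContDiff ℝ n f →
    ContDiff ℝ n (fun v : C(K, E) => f.comp v) := by
  induction n with
  | zero =>
    intro F _ _ f _
    exact contDiff_zero.2 (ContinuousMap.continuous_postcomp f)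
  | succ n ih =>
    intro F _ _ f hf
    have h1 : ContDiff ℝ n (fderiv ℝ f) := hf.fderiv_right (m := n) (by norm_cast)
    let f' : C(E, E →L[ℝ] F) := ⟨fderiv ℝ f, h1.continuous⟩
    have hd : ∀ x, HasFDerivAt f (ContinuousLinearMap.id ℝ (E →L[ℝ] F) (f' x)) x := fun x =>
      (hf.differentiable (by norm_cast) x).hasFDerivAt
    have h2 := hasFDerivAt_continuousMap_comp (K := K) _ f f' hd
    refine (contDiff_succ_iff_hasFDerivAt (n := n)).2 ⟨_, ?_, h2⟩
    exact ContDiff.comp (ContinuousLinearMap.contDiff _) (ih f' h1)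

theorem contDiff_infty_continuousMap_comp (f : C(E, F)) (hf : ContDiff ℝ ∞ f) :
    ContDiff ℝ ∞ (fun v : C(K, E) => f.comp v) :=
  contDiff_infty.2 fun n => contDiff_continuousMap_comp n f (contDiff_infty.1 hf n)

end CompositionOperator
end

noncomputable section

/-! ### Smooth local flows of vector fields on a Banach space -/

section LocalFlow

universe u
variable {E : Type u} [NormedAddCommGroup E] [NormedSpace ℝ E]

/-- The primitive of a continuous map on the unit interval. -/
def unitPrimitive : C(Icc (0 : ℝ) 1, E) →L[ℝ] C(Icc (0 : ℝ) 1, E) :=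
  LinearMap.mkContinuous
    { toFun := fun w => ⟨fun r => ∫ ρ in (0 : ℝ)..r, IccExtend zero_le_one w ρ, by
        have hw : Continuous (IccExtend zero_le_one w) := w.continuous.Icc_extend'
        exact (intervalIntegral.continuous_primitive
          (fun a b => hw.intervalIntegrable a b) 0).comp continuous_subtype_val⟩
      map_add' := fun v w => by
        ext r
        have hv : Continuous (IccExtend zero_le_one v) := v.continuous.Icc_extend'
        have hw : Continuous (IccExtend zero_le_one w) := w.continuous.Icc_extend'
        exact intervalIntegral.integral_add (hv.intervalIntegrable _ _) (hw.intervalIntegrable _ _)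
      map_smul' := fun c w => by
        ext r
        exact intervalIntegral.integral_smul c _ } 1
    (fun w => by
      rw [ContinuousMap.norm_le _ (by positivity)]
      intro r
      have h := intervalIntegral.norm_integral_le_of_norm_le_const (a := 0) (b := (r : ℝ))
        (f := IccExtend zero_le_one w) (C := ‖w‖)
        (fun ρ _ => ContinuousMap.norm_coe_le_norm w _)
      calc _ ≤ ‖w‖ * |(r : ℝ) - 0| := h
        _ ≤ ‖w‖ * 1 := by
          gcongr
          rw [sub_zero, abs_of_nonneg r.2.1]
          exact r.2.2
        _ = 1 * ‖w‖ := by ring)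

theorem unitPrimitive_apply (w : C(Icc (0 : ℝ) 1, E)) (r : Icc (0 : ℝ) 1) :
    unitPrimitive w r = ∫ ρ in (0 : ℝ)..r, IccExtend zero_le_one w ρ := rfl

/-- The equation whose zeros `((s, x), u)` are the curves with `u(0) = x` and `u' = s X(u)`. -/
def flowEquation (X : C(E, E)) (v : (ℝ × E) × C(Icc (0 : ℝ) 1, E)) : C(Icc (0 : ℝ) 1, E) :=
  v.2 - ContinuousLinearMap.const ℝ (Icc (0 : ℝ) 1) v.1.2 - v.1.1 • unitPrimitive (X.comp v.2)

theorem contDiff_flowEquation (X : C(E, E)) (hX : ContDiff ℝ ∞ X) :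
    ContDiff ℝ ∞ (flowEquation X) := by
  have h1 : ContDiff ℝ ∞ (fun v : (ℝ × E) × C(Icc (0 : ℝ) 1, E) => X.comp v.2) :=
    (contDiff_infty_continuousMap_comp X hX).comp contDiff_snd
  have h2 := (unitPrimitive (E := E)).contDiff.comp h1
  have h3 : ContDiff ℝ ∞ (fun v : (ℝ × E) × C(Icc (0 : ℝ) 1, E) =>
      ContinuousLinearMap.const ℝ (Icc (0 : ℝ) 1) v.1.2) :=
    (ContinuousLinearMap.contDiff _).comp (contDiff_snd.comp contDiff_fst)
  exact (contDiff_snd.sub h3).sub ((contDiff_fst.comp contDiff_fst).smul h2)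

theorem flowEquation_eq_zero_iff (X : C(E, E)) (s : ℝ) (x : E) (w : C(Icc (0 : ℝ) 1, E)) :
    flowEquation X ((s, x), w) = 0 ↔
      ∀ r : Icc (0 : ℝ) 1, w r = x + s • ∫ ρ in (0 : ℝ)..r, X (IccExtend zero_le_one w ρ) := by
  rw [ContinuousMap.ext_iff]
  refine forall_congr' fun r => ?_
  change w r - x - s • unitPrimitive (X.comp w) r = 0 ↔ _
  rw [unitPrimitive_apply, sub_sub, sub_eq_zero]
  rfl

/-- The reparametrization `r ↦ w(θ r)`. -/
def rescale (w : C(Icc (0 : ℝ) 1, E)) (θ : ℝ) : C(Icc (0 : ℝ) 1, E) :=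
  ⟨fun r => IccExtend zero_le_one w (θ * r),
    (w.continuous.Icc_extend').comp (continuous_const.mul continuous_subtype_val)⟩

/-- Substitution ρ ↦ θρ in the integral: the initial part of a solution over time `s` is a solution
over time `θ * s`. This relates the solutions for different times. -/
theorem flowEquation_rescale (X : C(E, E)) {s : ℝ} {x : E} {w : C(Icc (0 : ℝ) 1, E)}
    (h : flowEquation X ((s, x), w) = 0) {θ : ℝ} (hθ : θ ∈ Icc (0 : ℝ) 1) :
    flowEquation X ((θ * s, x), rescale w θ) = 0 := by
  rw [flowEquation_eq_zero_iff] at h ⊢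
  intro r
  have hr : θ * r ∈ Icc (0 : ℝ) 1 :=
    ⟨mul_nonneg hθ.1 r.2.1, mul_le_one₀ hθ.2 r.2.1 r.2.2⟩
  have h1 : rescale w θ r = w ⟨θ * r, hr⟩ := IccExtend_of_mem _ _ hr
  have h2 : ∫ ρ in (0 : ℝ)..r, X (IccExtend zero_le_one (rescale w θ) ρ) =
      ∫ ρ in (0 : ℝ)..r, X (IccExtend zero_le_one w (θ * ρ)) := by
    refine intervalIntegral.integral_congr fun ρ hρ => ?_
    rw [uIcc_of_le r.2.1] at hρ
    have hρ' : ρ ∈ Icc (0 : ℝ) 1 := ⟨hρ.1, hρ.2.trans r.2.2⟩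
    change X (IccExtend zero_le_one (rescale w θ) ρ) = _
    rw [IccExtend_of_mem _ _ hρ']
    rfl
  rw [h1, h, h2, mul_comm θ s, mul_smul,
    intervalIntegral.smul_integral_comp_mul_left (fun ρ => X (IccExtend zero_le_one w ρ)) θ]
  simp

/-- At time `0` the equation reads `w - w₀ = 0`, so its partial derivative in the curve is the
identity and the implicit function theorem gives a smooth family of curves ψ(s, x). The flow is the
endpoint ψ(s, x)(1). Local uniqueness of the implicit function identifies ψ(θs, x) with the rescaled
ψ(s, x), so θ ↦ φ(θs, x) runs along a single solution curve and the integral equation can be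
differentiated. -/
theorem exists_contDiffAt_localFlow_of_contDiff [CompleteSpace E] (X : E → E)
    (hX : ContDiff ℝ ∞ X) (x₀ : E) :
    ∃ φ : ℝ × E → E, ContDiffAt ℝ ∞ φ (0, x₀) ∧ ∃ δ > 0, ∀ x ∈ Metric.ball x₀ δ,
      φ (0, x) = x ∧ ∀ s ∈ Ioo (-δ) δ, HasDerivAt (fun s => φ (s, x)) (X (φ (s, x))) s := by
  let Y : C(E, E) := ⟨X, hX.continuous⟩
  let w₀ : C(Icc (0 : ℝ) 1, E) := ContinuousLinearMap.const ℝ (Icc (0 : ℝ) 1) x₀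
  let p : (ℝ × E) × C(Icc (0 : ℝ) 1, E) := ((0, x₀), w₀)
  have hp : flowEquation Y p = 0 := by simp [flowEquation, p, w₀]
  have hcd : ContDiffAt ℝ ∞ (flowEquation Y) p := (contDiff_flowEquation Y hX).contDiffAt
  have hn : (∞ : WithTop ℕ∞) ≠ 0 := by simp
  have hinv : (fderiv ℝ (flowEquation Y) p ∘L .inr ℝ (ℝ × E) C(Icc (0 : ℝ) 1, E)) =
      ContinuousLinearMap.id ℝ _ := by
    have h1 : HasFDerivAt (fun w => flowEquation Y ((0, x₀), w))
        (fderiv ℝ (flowEquation Y) p ∘L .inr ℝ (ℝ × E) C(Icc (0 : ℝ) 1, E)) w₀ :=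
      HasFDerivAt.comp w₀ (hcd.differentiableAt hn).hasFDerivAt
        (hasFDerivAt_prodMk_right (0, x₀) w₀)
    have h2 : (fun w => flowEquation Y ((0, x₀), w)) = fun w => w - w₀ := by
      ext w; simp [flowEquation, w₀]
    rw [h2] at h1
    exact h1.unique ((hasFDerivAt_id w₀).sub_const w₀)
  have hinv' : (fderiv ℝ (flowEquation Y) p ∘L
      .inr ℝ (ℝ × E) C(Icc (0 : ℝ) 1, E)).IsInvertible := by
    rw [hinv]; exact ⟨ContinuousLinearEquiv.refl ℝ _, rfl⟩
  let ψ := hcd.implicitFunction hn hinv'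
  have hψ : ContDiffAt ℝ ∞ ψ (0, x₀) := hcd.contDiffAt_implicitFunction hn hinv'
  have hψ₀ : ψ (0, x₀) = w₀ := hcd.implicitFunction_apply_self hn hinv'
  have hev : ∀ᶠ q in 𝓝 (0, x₀), flowEquation Y (q, ψ q) = 0 := by
    have := hcd.eventually_apply_implicitFunction hn hinv'
    simpa [hp] using this
  have huniq : ∀ᶠ v in 𝓝 p, flowEquation Y v = 0 ↔ ψ v.1 = v.2 := by
    have := hcd.eventually_apply_eq_iff_implicitFunction hn hinv'
    simpa [hp] using this
  obtain ⟨ρ, hρ, huniq⟩ := Metric.eventually_nhds_iff.1 huniq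
  have hclose : ∀ᶠ q in 𝓝 (0, x₀), dist (ψ q) w₀ < ρ := by
    have := hψ.continuousAt.eventually (Metric.ball_mem_nhds (ψ (0, x₀)) hρ)
    simpa [hψ₀] using this
  obtain ⟨δ₀, hδ₀, hgood⟩ := Metric.eventually_nhds_iff.1 (hev.and hclose)
  let one : Icc (0 : ℝ) 1 := ⟨1, by simp⟩
  refine ⟨fun q => ψ q one, ?_, min δ₀ ρ, lt_min hδ₀ hρ, fun x hx => ?_⟩
  · exact ((ContinuousMap.evalCLM ℝ one).contDiff.contDiffAt).comp (0, x₀) hψ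
  set δ := min δ₀ ρ
  have hdist : ∀ s : ℝ, |s| < δ → dist (s, x) ((0 : ℝ), x₀) < δ := fun s hs => by
    rw [Prod.dist_eq]
    exact max_lt (by simpa [Real.dist_eq] using hs) hx
  have hscale : ∀ s : ℝ, |s| < δ → ∀ θ ∈ Icc (0 : ℝ) 1,
      ψ (θ * s, x) = rescale (ψ (s, x)) θ := by
    intro s hs θ hθ
    have hg := hgood ((hdist s hs).trans_le (min_le_left _ _))
    have hθs : |θ * s| < δ := by
      rw [abs_mul, abs_of_nonneg hθ.1]
      exact (mul_le_of_le_one_left (abs_nonneg s) hθ.2).trans_lt hs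
    have hd : dist ((θ * s, x), rescale (ψ (s, x)) θ) p < ρ := by
      rw [Prod.dist_eq]
      refine max_lt ((hdist _ hθs).trans_le (min_le_right _ _)) (lt_of_le_of_lt ?_ hg.2)
      rw [ContinuousMap.dist_le dist_nonneg]
      exact fun r => ContinuousMap.dist_apply_le_dist (f := ψ (s, x)) (g := w₀) _
    exact (huniq hd).1 (flowEquation_rescale Y hg.1 hθ)
  have hone : ∀ s : ℝ, |s| < δ → ∀ θ ∈ Icc (0 : ℝ) 1,
      ψ (θ * s, x) one = x + s • ∫ ρ in (0 : ℝ)..θ, X (IccExtend zero_le_one (ψ (s, x)) ρ) := by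
    intro s hs θ hθ
    have hg := (hgood ((hdist s hs).trans_le (min_le_left _ _))).1
    rw [flowEquation_eq_zero_iff] at hg
    rw [hscale s hs θ hθ]
    refine Eq.trans ?_ (hg ⟨θ, hθ⟩)
    change IccExtend zero_le_one (ψ (s, x)) (θ * 1) = _
    rw [mul_one, IccExtend_of_mem _ _ hθ]
  have hderiv : ∀ s : ℝ, |s| < δ → s ≠ 0 → ∀ θ ∈ Icc (0 : ℝ) 1,
      HasDerivWithinAt (fun s => ψ (s, x) one) (X (ψ (θ * s, x) one))
        {τ | τ / s ∈ Icc (0 : ℝ) 1} (θ * s) := by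
    intro s hs hs0 θ hθ
    have hcont : Continuous fun ρ => X (IccExtend zero_le_one (ψ (s, x)) ρ) :=
      hX.continuous.comp (ψ (s, x)).continuous.Icc_extend'
    have hd : HasDerivAt (fun τ : ℝ => x + s • ∫ ρ in (0 : ℝ)..τ / s,
        X (IccExtend zero_le_one (ψ (s, x)) ρ))
        (X (IccExtend zero_le_one (ψ (s, x)) (θ * s / s))) (θ * s) := by
      have h1 := intervalIntegral.integral_hasDerivAt_right (hcont.intervalIntegrable 0 (θ * s / s))
        (hcont.stronglyMeasurableAtFilter _ _) hcont.continuousAt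
      have h2 := HasDerivAt.scomp (θ * s) h1 ((hasDerivAt_id (θ * s)).div_const s)
      have h3 := (h2.const_smul s).const_add x
      rw [smul_smul, mul_one_div_cancel hs0, one_smul] at h3
      exact h3
    have hval : ψ (θ * s, x) one = IccExtend zero_le_one (ψ (s, x)) (θ * s / s) := by
      rw [hscale s hs θ hθ, mul_div_assoc, div_self hs0]
      rfl
    rw [hval]
    refine hd.hasDerivWithinAt.congr_of_mem (fun τ hτ => ?_) ?_
    · have := hone s hs (τ / s) hτ
      rwa [div_mul_cancel₀ _ hs0] at this
    · rwa [mem_ofPred_eq, mul_div_assoc, div_self hs0, mul_one]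
  have hzero : ψ (0, x) one = x := by
    have := hone 0 (by rw [abs_zero]; exact lt_min hδ₀ hρ) 0 (by simp)
    simpa using this
  refine ⟨hzero, fun s hs => ?_⟩
  -- The curve for the midpoint σ between τ and δ covers a neighbourhood of τ in the half-line,
  -- including τ = 0. Two such one-sided statements are joined at `0` below.
  have hforward : ∀ τ ∈ Ico 0 δ, HasDerivWithinAt (fun s => ψ (s, x) one) (X (ψ (τ, x) one))
      (Ici 0) τ := by
    intro τ hτ
    let σ := (τ + δ) / 2
    have hσ : 0 < σ := by have := hτ.1; have := hτ.2; simp only [σ]; linarith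
    have hτσ : τ < σ := by have := hτ.2; simp only [σ]; linarith
    have hσδ : |σ| < δ := by rw [abs_of_pos hσ]; have := hτ.2; simp only [σ]; linarith
    have := hderiv σ hσδ hσ.ne' (τ / σ) ⟨div_nonneg hτ.1 hσ.le, (div_le_one hσ).2 hτσ.le⟩
    rw [div_mul_cancel₀ _ hσ.ne'] at this
    refine this.mono_of_mem_nhdsWithin ?_
    filter_upwards [self_mem_nhdsWithin, mem_nhdsWithin_of_mem_nhds (Iio_mem_nhds hτσ)] with r h1 h2
    exact ⟨div_nonneg h1 hσ.le, (div_le_one hσ).2 (le_of_lt h2)⟩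
  have hbackward : ∀ τ ∈ Ioc (-δ) 0, HasDerivWithinAt (fun s => ψ (s, x) one) (X (ψ (τ, x) one))
      (Iic 0) τ := by
    intro τ hτ
    let σ := (τ - δ) / 2
    have hσ : σ < 0 := by have := hτ.1; have := hτ.2; simp only [σ]; linarith
    have hτσ : σ < τ := by have := hτ.1; simp only [σ]; linarith
    have hσδ : |σ| < δ := by rw [abs_of_neg hσ]; have := hτ.1; simp only [σ]; linarith
    have := hderiv σ hσδ hσ.ne (τ / σ)
      ⟨div_nonneg_of_nonpos hτ.2 hσ.le, (div_le_one_of_neg hσ).2 hτσ.le⟩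
    rw [div_mul_cancel₀ _ hσ.ne] at this
    refine this.mono_of_mem_nhdsWithin ?_
    filter_upwards [self_mem_nhdsWithin, mem_nhdsWithin_of_mem_nhds (Ioi_mem_nhds hτσ)] with r h1 h2
    exact ⟨div_nonneg_of_nonpos h1 hσ.le, (div_le_one_of_neg hσ).2 (le_of_lt h2)⟩
  rcases lt_trichotomy s 0 with h | h | h
  · exact (hbackward s ⟨hs.1, h.le⟩).hasDerivAt (Iic_mem_nhds h)
  · subst h
    have := (hbackward 0 ⟨hs.1, le_rfl⟩).union (hforward 0 ⟨le_rfl, hs.2⟩)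
    rwa [Iic_union_Ici, hasDerivWithinAt_univ] at this
  · exact (hforward s ⟨h.le, hs.2⟩).hasDerivAt (Ici_mem_nhds h)

/-- A vector field that is smooth near `x₀` has a local flow that is smooth at `(0, x₀)`. -/
theorem exists_contDiffAt_localFlow [FiniteDimensional ℝ E] {X : E → E} {s : Set E} (hs : IsOpen s)
    (hX : ContDiffOn ℝ ∞ X s) {x₀ : E} (hx₀ : x₀ ∈ s) :
    ∃ φ : ℝ × E → E, ContDiffAt ℝ ∞ φ (0, x₀) ∧ ∃ δ > 0, ∀ x ∈ Metric.ball x₀ δ,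
      φ (0, x) = x ∧ ∀ s ∈ Ioo (-δ) δ, HasDerivAt (fun s => φ (s, x)) (X (φ (s, x))) s := by
  obtain ⟨r, hr, hrs⟩ := Metric.isOpen_iff.1 hs x₀ hx₀
  -- The cut-off field is smooth everywhere and agrees with `X` on the ball of radius `r / 3`, which
  -- the flow does not leave for short times.
  let b : ContDiffBump x₀ := ⟨r / 3, r / 2, by positivity, by linarith⟩
  have hb : ContDiff ℝ ∞ fun x => b x • X x := by
    rw [contDiff_iff_contDiffAt]
    intro x
    by_cases hx : x ∈ tsupport b
    · rw [b.tsupport_eq] at hx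
      have : x ∈ s := hrs (Metric.closedBall_subset_ball (by change r / 2 < r; linarith) hx)
      exact b.contDiff.contDiffAt.smul (hX.contDiffAt (hs.mem_nhds this))
    · have h0 : (fun x => b x • X x) =ᶠ[𝓝 x] fun _ => 0 := by
        filter_upwards [(isClosed_tsupport b).isOpen_compl.mem_nhds hx] with y hy
        rw [image_eq_zero_of_notMem_tsupport hy, zero_smul]
      exact contDiffAt_const.congr_of_eventuallyEq h0
  obtain ⟨φ, hφ, δ, hδ, h⟩ := exists_contDiffAt_localFlow_of_contDiff _ hb x₀
  have h00 : φ (0, x₀) = x₀ := (h x₀ (Metric.mem_ball_self hδ)).1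
  have hball : ∀ᶠ q in 𝓝 ((0 : ℝ), x₀), φ q ∈ Metric.ball x₀ (r / 3) := by
    have hc := hφ.continuousAt
    rw [ContinuousAt, h00] at hc
    exact hc (Metric.ball_mem_nhds _ (by positivity))
  obtain ⟨δ', hδ', hball⟩ := Metric.eventually_nhds_iff.1 hball
  refine ⟨φ, hφ, min δ δ', lt_min hδ hδ', fun x hx => ⟨(h x ?_).1, fun s hs => ?_⟩⟩
  · exact Metric.ball_subset_ball (min_le_left _ _) hx
  · have h1 := (h x (Metric.ball_subset_ball (min_le_left _ _) hx)).2 s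
      ⟨by linarith [hs.1, min_le_left δ δ'], by linarith [hs.2, min_le_left δ δ']⟩
    have h2 : φ (s, x) ∈ Metric.ball x₀ (r / 3) := by
      refine hball ?_
      rw [Prod.dist_eq]
      refine max_lt ?_ (Metric.ball_subset_ball (min_le_right _ _) hx)
      rw [Real.dist_eq, sub_zero, abs_lt]
      exact ⟨by linarith [hs.1, min_le_right δ δ'], by linarith [hs.2, min_le_right δ δ']⟩
    rwa [b.one_of_mem_closedBall (Metric.ball_subset_closedBall h2), one_smul] at h1

end LocalFlow
end

noncomputable section

set_option linter.unusedSectionVars false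

/-! ### Local flows and integral curves on a manifold -/

section ManifoldFlow

universe u
variable {E : Type u} [NormedAddCommGroup E] [NormedSpace ℝ E] [FiniteDimensional ℝ E]
  {H : Type*} [TopologicalSpace H] {I : ModelWithCorners ℝ E H} [I.Boundaryless]
  {M : Type*} [TopologicalSpace M] [ChartedSpace H M] [IsManifold I ∞ M]
  {X : (z : M) → TangentSpace I z}

/-- The vector field `X` is smooth. -/
def IsSmoothField (X : (z : M) → TangentSpace I z) : Prop :=
  ContMDiff I I.tangent ∞ (fun z => (⟨z, X z⟩ : TangentBundle I M))

theorem extChartAt_target_mem_nhds_of_boundaryless (z : M) {y : E}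
    (hy : y ∈ (extChartAt I z).target) : (extChartAt I z).target ∈ 𝓝 y :=
  (isOpen_extChartAt_target z).mem_nhds hy

theorem hasMFDerivAt_extChartAt_of_mem {z w : M} (hw : w ∈ (extChartAt I z).source) :
    HasMFDerivAt I 𝓘(ℝ, E) (extChartAt I z) w (mfderiv I 𝓘(ℝ, E) (extChartAt I z) w) :=
  (mdifferentiableAt_extChartAt (by rwa [extChartAt_source] at hw)).hasMFDerivAt

theorem hasMFDerivAt_extChartAt_symm {z : M} {y : E} (hy : y ∈ (extChartAt I z).target) :
    HasMFDerivAt 𝓘(ℝ, E) I (extChartAt I z).symm y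
      (mfderiv 𝓘(ℝ, E) I (extChartAt I z).symm y) := by
  have := mdifferentiableWithinAt_extChartAt_symm (I := I) hy
  rw [I.range_eq_univ, mdifferentiableWithinAt_univ] at this
  exact this.hasMFDerivAt

theorem mfderiv_extChartAt_symm_mfderiv_extChartAt {z w : M} (hw : w ∈ (extChartAt I z).source)
    (v : TangentSpace I w) :
    mfderiv 𝓘(ℝ, E) I (extChartAt I z).symm (extChartAt I z w)
      (mfderiv I 𝓘(ℝ, E) (extChartAt I z) w v) = v := by
  have := mfderivWithin_extChartAt_symm_comp_mfderiv_extChartAt' (I := I) hw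
  rw [I.range_eq_univ, mfderivWithin_univ] at this
  exact congrArg (fun L => L v) this

theorem mfderiv_extChartAt_mfderiv_extChartAt_symm {z : M} {y : E}
    (hy : y ∈ (extChartAt I z).target) (v : E) :
    mfderiv I 𝓘(ℝ, E) (extChartAt I z) ((extChartAt I z).symm y)
      (mfderiv 𝓘(ℝ, E) I (extChartAt I z).symm y v) = v := by
  have := mfderiv_extChartAt_comp_mfderivWithin_extChartAt_symm (I := I) hy
  rw [I.range_eq_univ, mfderivWithin_univ] at this
  exact congrArg (fun L => L v) this

/-- The coordinate expression of a vector field. -/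
def fieldInChart (X : (z : M) → TangentSpace I z) (z : M) (y : E) : E :=
  mfderiv I 𝓘(ℝ, E) (extChartAt I z) ((extChartAt I z).symm y) (X ((extChartAt I z).symm y))

theorem trivializationAt_tangent_snd {z w : M} (hw : w ∈ (chartAt H z).source)
    (v : TangentSpace I w) :
    (trivializationAt E (TangentSpace I : M → Type _) z ⟨w, v⟩).2 =
      mfderiv I 𝓘(ℝ, E) (extChartAt I z) w v := by
  refine Eq.trans ?_
    (congrArg (fun L => L v) (TangentBundle.continuousLinearMapAt_trivializationAt hw))
  have hw' : w ∈ (trivializationAt E (TangentSpace I : M → Type _) z).baseSet := by simpa using hw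
  change _ = Trivialization.continuousLinearMapAt ℝ _ w v
  rw [Trivialization.continuousLinearMapAt_apply, Trivialization.coe_linearMapAt_of_mem _ hw']

theorem IsSmoothField.contMDiffOn_chart (hX : IsSmoothField X) (z : M) :
    ContMDiffOn I 𝓘(ℝ, E) ∞ (fun w => mfderiv I 𝓘(ℝ, E) (extChartAt I z) w (X w))
      (chartAt H z).source := by
  have h := ((trivializationAt E (TangentSpace I : M → Type _) z).contMDiffOn_section_iff
    (IB := I) (n := ∞) (s := X) (chartAt H z).open_source (by simp)).1 hX.contMDiffOn
  exact h.congr fun w hw => (trivializationAt_tangent_snd hw (X w)).symm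

theorem isSmoothField_of_chart
    (h : ∀ z : M, ContMDiffAt I 𝓘(ℝ, E) ∞
      (fun w => mfderiv I 𝓘(ℝ, E) (extChartAt I z) w (X w)) z) : IsSmoothField X := by
  intro z
  refine ((trivializationAt E (TangentSpace I : M → Type _) z).contMDiffAt_section_iff
    (IB := I) (n := ∞) (s := X) (by simp)).2 ((h z).congr_of_eventuallyEq ?_)
  filter_upwards [(chartAt H z).open_source.mem_nhds (mem_chart_source H z)] with w hw
  exact trivializationAt_tangent_snd hw (X w)

theorem IsSmoothField.contDiffOn_fieldInChart (hX : IsSmoothField X) (z : M) :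
    ContDiffOn ℝ ∞ (fieldInChart X z) (extChartAt I z).target := by
  rw [← contMDiffOn_iff_contDiffOn]
  refine (hX.contMDiffOn_chart z).comp (contMDiffOn_extChartAt_symm z) fun y hy => ?_
  have := (extChartAt I z).map_target hy
  rwa [extChartAt_source] at this

theorem IsSmoothField.exists_localFlow (hX : IsSmoothField X) (z₀ : M) :
    ∃ Φ : ℝ × M → M, ContMDiffAt (𝓘(ℝ, ℝ).prod I) I ∞ Φ (0, z₀) ∧
      ∃ δ > 0, ∃ W ∈ 𝓝 z₀, ∀ z ∈ W, Φ (0, z) = z ∧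
        IsMIntegralCurveOn (I := I) (fun s => Φ (s, z)) X (Ioo (-δ) δ) := by
  set c := extChartAt I z₀
  have hz₀ : c z₀ ∈ c.target := mem_extChartAt_target z₀
  obtain ⟨φ, hφ, δ, hδ, h⟩ := exists_contDiffAt_localFlow (isOpen_extChartAt_target z₀)
    (hX.contDiffOn_fieldInChart z₀) hz₀
  have h00 : φ (0, c z₀) = c z₀ := (h _ (Metric.mem_ball_self hδ)).1
  have htarget : ∀ᶠ q in 𝓝 ((0 : ℝ), c z₀), φ q ∈ c.target := by
    have hc := hφ.continuousAt
    rw [ContinuousAt, h00] at hc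
    exact hc (extChartAt_target_mem_nhds_of_boundaryless z₀ hz₀)
  obtain ⟨δ', hδ', htarget⟩ := Metric.eventually_nhds_iff.1 htarget
  let ρ := min δ δ'
  have hρ : 0 < ρ := lt_min hδ hδ'
  refine ⟨fun q => c.symm (φ (q.1, c q.2)), ?_, ρ, hρ,
    c.source ∩ c ⁻¹' Metric.ball (c z₀) ρ, ?_, fun z hz => ?_⟩
  · have h1 : ContMDiffAt (𝓘(ℝ, ℝ).prod I) 𝓘(ℝ, ℝ × E) ∞
        (fun q : ℝ × M => (q.1, c q.2)) (0, z₀) :=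
      contMDiffAt_fst.prodMk_space
        ((contMDiffAt_extChartAt (x := z₀)).comp (0, z₀) contMDiffAt_snd)
    have h2 : ContMDiffAt 𝓘(ℝ, ℝ × E) 𝓘(ℝ, E) ∞ φ (0, c z₀) := hφ.contMDiffAt
    have h3 : ContMDiffAt 𝓘(ℝ, E) I ∞ c.symm (φ (0, c z₀)) := by
      rw [h00]
      exact (contMDiffOn_extChartAt_symm z₀).contMDiffAt
        (extChartAt_target_mem_nhds_of_boundaryless z₀ hz₀)
    exact h3.comp (0, z₀) (h2.comp (0, z₀) h1)
  · exact inter_mem (extChartAt_source_mem_nhds z₀)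
      ((continuousAt_extChartAt z₀).preimage_mem_nhds (Metric.ball_mem_nhds _ hρ))
  · have hcz := h (c z) (Metric.ball_subset_ball (min_le_left _ _) hz.2)
    refine ⟨?_, fun s hs => ?_⟩
    · change c.symm (φ (0, c z)) = z
      rw [hcz.1, c.left_inv hz.1]
    · have hs' : φ (s, c z) ∈ c.target := by
        refine htarget ?_
        rw [Prod.dist_eq]
        refine max_lt ?_ (Metric.ball_subset_ball (min_le_right _ _) hz.2)
        rw [Real.dist_eq, sub_zero, abs_lt]
        exact ⟨by linarith [hs.1, min_le_right δ δ'], by linarith [hs.2, min_le_right δ δ']⟩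
      have hd := hcz.2 s
        ⟨by linarith [hs.1, min_le_left δ δ'], by linarith [hs.2, min_le_left δ δ']⟩
      have hd' : HasMFDerivAt 𝓘(ℝ, ℝ) 𝓘(ℝ, E) (fun s => φ (s, c z)) s
          (ContinuousLinearMap.toSpanSingleton ℝ (fieldInChart X z₀ (φ (s, c z))) : ℝ →L[ℝ] E) :=
        hasMFDerivAt_iff_hasFDerivAt.2 hd.hasFDerivAt
      have := (hasMFDerivAt_extChartAt_symm hs').comp s hd'
      refine HasMFDerivAt.hasMFDerivWithinAt (this.congr_mfderiv ?_)
      have hsrc := c.map_target hs'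
      have h1 := mfderiv_extChartAt_symm_mfderiv_extChartAt hsrc (X (c.symm (φ (s, c z))))
      rw [c.right_inv hs'] at h1
      refine ContinuousLinearMap.ext fun (r : ℝ) => ?_
      change mfderiv 𝓘(ℝ, E) I c.symm (φ (s, c z)) (r • fieldInChart X z₀ (φ (s, c z))) =
        r • X (c.symm (φ (s, c z)))
      exact (map_smul _ _ _).trans (congrArg (fun v => r • v) h1)

/-- Concatenation of two curves at time `b`. -/
def concat (γ₁ γ₂ : ℝ → M) (b t : ℝ) : M := if t ≤ b then γ₁ t else γ₂ t

theorem concat_of_le {γ₁ γ₂ : ℝ → M} {b t : ℝ} (h : t ≤ b) : concat γ₁ γ₂ b t = γ₁ t := if_pos h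

theorem concat_of_ge {γ₁ γ₂ : ℝ → M} {b t : ℝ} (hb : γ₁ b = γ₂ b) (h : b ≤ t) :
    concat γ₁ γ₂ b t = γ₂ t := by
  rcases h.eq_or_lt with rfl | h
  · rw [concat_of_le le_rfl, hb]
  · exact if_neg h.not_ge

theorem isMIntegralCurveOn_concat {γ₁ γ₂ : ℝ → M} {s₁ s₂ : Set ℝ} {b : ℝ}
    (h₁ : IsMIntegralCurveOn (I := I) γ₁ X s₁) (h₂ : IsMIntegralCurveOn (I := I) γ₂ X s₂)
    (hs₁ : s₁ ⊆ Iic b) (hs₂ : s₂ ⊆ Ici b) (hb₁ : b ∈ s₁) (hb₂ : b ∈ s₂) (hb : γ₁ b = γ₂ b) :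
    IsMIntegralCurveOn (I := I) (concat γ₁ γ₂ b) X (s₁ ∪ s₂) := by
  have e₁ : ∀ t ∈ s₁, concat γ₁ γ₂ b t = γ₁ t := fun t ht => concat_of_le (hs₁ ht)
  have e₂ : ∀ t ∈ s₂, concat γ₁ γ₂ b t = γ₂ t := fun t ht => concat_of_ge hb (hs₂ ht)
  have k₁ : IsMIntegralCurveOn (I := I) (concat γ₁ γ₂ b) X s₁ := by
    intro t ht
    have := (h₁ t ht).congr_of_eventuallyEq (f₁ := concat γ₁ γ₂ b)
      (eventually_of_mem self_mem_nhdsWithin e₁) (e₁ t ht)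
    rw [e₁ t ht]
    exact this
  have k₂ : IsMIntegralCurveOn (I := I) (concat γ₁ γ₂ b) X s₂ := by
    intro t ht
    have := (h₂ t ht).congr_of_eventuallyEq (f₁ := concat γ₁ γ₂ b)
      (eventually_of_mem self_mem_nhdsWithin e₂) (e₂ t ht)
    rw [e₂ t ht]
    exact this
  intro t ht
  rcases lt_trichotomy t b with h | rfl | h
  · have ht₁ : t ∈ s₁ := ht.resolve_right fun h' => (hs₂ h').not_gt h
    refine (k₁ t ht₁).mono_of_mem_nhdsWithin ?_
    filter_upwards [self_mem_nhdsWithin, mem_nhdsWithin_of_mem_nhds (Iio_mem_nhds h)] with r h1 h2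
    exact h1.resolve_right fun h' => (mem_Ici.1 (hs₂ h')).not_gt (mem_Iio.1 h2)
  · exact (k₁ t hb₁).union (k₂ t hb₂)
  · have ht₂ : t ∈ s₂ := ht.resolve_left fun h' => (hs₁ h').not_gt h
    refine (k₂ t ht₂).mono_of_mem_nhdsWithin ?_
    filter_upwards [self_mem_nhdsWithin, mem_nhdsWithin_of_mem_nhds (Ioi_mem_nhds h)] with r h1 h2
    exact h1.resolve_left fun h' => (mem_Iic.1 (hs₁ h')).not_gt (mem_Ioi.1 h2)

theorem IsMIntegralCurveOn.shift {γ : ℝ → M} {s s' : Set ℝ}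
    (h : IsMIntegralCurveOn (I := I) γ X s) (d : ℝ) (hs : ∀ t ∈ s', t + d ∈ s) :
    IsMIntegralCurveOn (I := I) (fun t => γ (t + d)) X s' :=
  (h.comp_add d).mono hs

/-- Local flows through the two endpoints are glued to the curve. Hybrid arcs live on closed
intervals, whereas uniqueness of integral curves is used on open ones. -/
theorem IsSmoothField.exists_extension (hX : IsSmoothField X) {γ : ℝ → M} {a b : ℝ} (hab : a ≤ b)
    (hγ : IsMIntegralCurveOn (I := I) γ X (Icc a b)) :
    ∃ δ > 0, ∃ γ' : ℝ → M, EqOn γ' γ (Icc a b) ∧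
      IsMIntegralCurveOn (I := I) γ' X (Ioo (a - δ) (b + δ)) := by
  obtain ⟨Φ, -, δ₁, hδ₁, W₁, hW₁, h₁⟩ := hX.exists_localFlow (γ a)
  obtain ⟨Ψ, -, δ₂, hδ₂, W₂, hW₂, h₂⟩ := hX.exists_localFlow (γ b)
  obtain ⟨h₁0, h₁⟩ := h₁ _ (mem_of_mem_nhds hW₁)
  obtain ⟨h₂0, h₂⟩ := h₂ _ (mem_of_mem_nhds hW₂)
  have k₁ := h₁.shift (-a) (s' := Ioc (a - δ₁) a)
    fun t ht => ⟨by linarith [ht.1], by linarith [ht.2]⟩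
  have k₂ := h₂.shift (-b) (s' := Ico b (b + δ₂))
    fun t ht => ⟨by linarith [ht.1], by linarith [ht.2]⟩
  have l₁ := isMIntegralCurveOn_concat k₁ hγ (b := a) (fun t ht => ht.2) (fun t ht => ht.1)
    ⟨by linarith, le_rfl⟩ ⟨le_rfl, hab⟩ (by simp [h₁0])
  have l₂ := isMIntegralCurveOn_concat l₁ k₂ (b := b)
    (fun t ht => ht.elim (fun h => h.2.trans hab) (fun h => h.2)) (fun t ht => ht.1)
    (Or.inr ⟨hab, le_rfl⟩) ⟨le_rfl, by linarith⟩
    (by rw [concat_of_ge (by simp [h₁0]) hab]; simp [h₂0])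
  refine ⟨min δ₁ δ₂, lt_min hδ₁ hδ₂, _, fun t ht => ?_, l₂.mono fun t ht => ?_⟩
  · rw [concat_of_le ht.2, concat_of_ge (by simp [h₁0]) ht.1]
  · have h3 : a - δ₁ < t := by linarith [ht.1, min_le_left δ₁ δ₂]
    have h4 : t < b + δ₂ := by linarith [ht.2, min_le_right δ₁ δ₂]
    rcases le_total t a with h | h
    · exact Or.inl (Or.inl ⟨h3, h⟩)
    · rcases le_total t b with h' | h'
      · exact Or.inl (Or.inr ⟨h, h'⟩)
      · exact Or.inr ⟨h', h4⟩

variable [T2Space M]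

theorem IsSmoothField.eqOn_Ioo (hX : IsSmoothField X) {γ₁ γ₂ : ℝ → M} {a b t₀ : ℝ}
    (ht₀ : t₀ ∈ Ioo a b) (h₁ : IsMIntegralCurveOn (I := I) γ₁ X (Ioo a b))
    (h₂ : IsMIntegralCurveOn (I := I) γ₂ X (Ioo a b)) (h : γ₁ t₀ = γ₂ t₀) :
    EqOn γ₁ γ₂ (Ioo a b) :=
  isMIntegralCurveOn_Ioo_eqOn_of_contMDiff_boundaryless ht₀ (hX.of_le (by simp)) h₁ h₂ h

theorem IsSmoothField.eqOn_Icc (hX : IsSmoothField X) {γ₁ γ₂ : ℝ → M} {a b : ℝ} (hab : a ≤ b)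
    (h₁ : IsMIntegralCurveOn (I := I) γ₁ X (Icc a b))
    (h₂ : IsMIntegralCurveOn (I := I) γ₂ X (Icc a b)) (h : γ₁ a = γ₂ a) :
    EqOn γ₁ γ₂ (Icc a b) := by
  obtain ⟨δ₁, hδ₁, γ₁', e₁, k₁⟩ := hX.exists_extension hab h₁
  obtain ⟨δ₂, hδ₂, γ₂', e₂, k₂⟩ := hX.exists_extension hab h₂
  have ha : a ∈ Icc a b := ⟨le_rfl, hab⟩
  have hδ : 0 < min δ₁ δ₂ := lt_min hδ₁ hδ₂
  have := hX.eqOn_Ioo (a := a - min δ₁ δ₂) (b := b + min δ₁ δ₂) (t₀ := a)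
    ⟨by linarith, by linarith⟩
    (k₁.mono (Ioo_subset_Ioo (by linarith [min_le_left δ₁ δ₂]) (by linarith [min_le_left δ₁ δ₂])))
    (k₂.mono (Ioo_subset_Ioo (by linarith [min_le_right δ₁ δ₂]) (by linarith [min_le_right δ₁ δ₂])))
    (by rw [e₁ ha, e₂ ha, h])
  intro t ht
  rw [← e₁ ht, ← e₂ ht]
  exact this ⟨by linarith [ht.1], by linarith [ht.2]⟩

end ManifoldFlow
end

noncomputable section

set_option linter.unusedSectionVars false

/-! ### Hybrid trajectories with a prescribed number of resets -/

section CountedReach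

universe u
variable {E : Type u} [NormedAddCommGroup E] [NormedSpace ℝ E] [FiniteDimensional ℝ E]
  {H : Type*} [TopologicalSpace H] {I : ModelWithCorners ℝ E H} [I.Boundaryless]
  {M : Type*} [TopologicalSpace M] [ChartedSpace H M] [IsManifold I ∞ M]

/-- The hybrid system takes `x` to `y` in time `t` with exactly `N` resets. -/
inductive CountedReach (X : (z : M) → TangentSpace I z) (S : Set M) (Δ : M → M) :
    ℕ → ℝ → M → M → Prop
  | flow {t : ℝ} {γ : ℝ → M} {x y : M} (ht : 0 ≤ t)
      (hγ : IsMIntegralCurveOn (I := I) γ X (Icc 0 t))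
      (hS : ∀ s ∈ Ico 0 t, γ s ∉ S) (hx : γ 0 = x) (hy : γ t = y) : CountedReach X S Δ 0 t x y
  | jump {N : ℕ} {s t u : ℝ} {γ : ℝ → M} {x z y : M} (hs : 0 ≤ s)
      (hγ : IsMIntegralCurveOn (I := I) γ X (Icc 0 s))
      (hS : ∀ r ∈ Ico 0 s, γ r ∉ S) (hx : γ 0 = x) (hz : γ s = z) (hmem : z ∈ S) (ht : 0 < t)
      (hu : u = s + t) (hy : CountedReach X S Δ N t (Δ z) y) : CountedReach X S Δ (N + 1) u x y

variable {X : (z : M) → TangentSpace I z} {S : Set M} {Δ : M → M}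

theorem HybridReach.exists_countedReach {t : ℝ} {x y : M} (h : HybridReach I X S Δ t x y) :
    ∃ N, CountedReach X S Δ N t x y := by
  induction h with
  | flow t γ ht hγ hS => exact ⟨0, .flow ht hγ hS rfl rfl⟩
  | jump s t γ y hs hγ hS hmem ht _ ih =>
    obtain ⟨N, hN⟩ := ih
    exact ⟨N + 1, .jump hs hγ hS rfl rfl hmem ht rfl hN⟩

theorem CountedReach.nonneg {N : ℕ} {t : ℝ} {x y : M} (h : CountedReach X S Δ N t x y) :
    0 ≤ t := by
  cases h with
  | flow ht => exact ht
  | jump hs _ _ _ _ _ ht hu => linarith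

/-- The last arc of the first run and the first arc of the second are concatenated. Avoidance of the
guard is required on half-open intervals only, so the junction is tested exactly once, as the start
of the second arc. -/
theorem CountedReach.trans {K N : ℕ} {τ t : ℝ} {x y z : M} (h₁ : CountedReach X S Δ K τ x y)
    (h₂ : CountedReach X S Δ N t y z) : CountedReach X S Δ (K + N) (τ + t) x z := by
  induction h₁ with
  | @flow τ γ x y hτ hγ hS hx hy =>
    rw [zero_add]
    cases h₂ with
    | @flow _ γ₂ _ _ ht hγ₂ hS₂ hx₂ hy₂ =>
      have hb : γ τ = (fun r => γ₂ (r + -τ)) τ := by simp [hy, hx₂]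
      have hc := isMIntegralCurveOn_concat hγ (hγ₂.shift (-τ) (s' := Icc τ (τ + t))
        fun r hr => ⟨by linarith [hr.1], by linarith [hr.2]⟩) (b := τ) (fun r hr => hr.2)
        (fun r hr => hr.1) ⟨hτ, le_rfl⟩ ⟨le_rfl, by linarith⟩ hb
      refine .flow (γ := concat γ (fun r => γ₂ (r + -τ)) τ) (by linarith) (hc.mono ?_)
        (fun r hr => ?_) ?_ ?_
      · rw [Icc_union_Icc_eq_Icc hτ (by linarith)]
      · rcases lt_or_ge r τ with h | h
        · rw [concat_of_le h.le]
          exact hS r ⟨hr.1, h⟩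
        · rw [concat_of_ge hb h]
          exact hS₂ _ ⟨by linarith, by linarith [hr.2]⟩
      · rw [concat_of_le hτ, hx]
      · rw [concat_of_ge hb (by linarith)]
        simp [hy₂]
    | @jump _ s t _ γ₂ _ w _ hs hγ₂ hS₂ hx₂ hw hmem ht hu h =>
      have hb : γ τ = (fun r => γ₂ (r + -τ)) τ := by simp [hy, hx₂]
      have hc := isMIntegralCurveOn_concat hγ (hγ₂.shift (-τ) (s' := Icc τ (τ + s))
        fun r hr => ⟨by linarith [hr.1], by linarith [hr.2]⟩) (b := τ) (fun r hr => hr.2)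
        (fun r hr => hr.1) ⟨hτ, le_rfl⟩ ⟨le_rfl, by linarith⟩ hb
      refine .jump (γ := concat γ (fun r => γ₂ (r + -τ)) τ) (s := τ + s) (by linarith) (hc.mono ?_)
        (fun r hr => ?_) ?_ ?_ hmem ht (by linarith) h
      · rw [Icc_union_Icc_eq_Icc hτ (by linarith)]
      · rcases lt_or_ge r τ with h | h
        · rw [concat_of_le h.le]
          exact hS r ⟨hr.1, h⟩
        · rw [concat_of_ge hb h]
          exact hS₂ _ ⟨by linarith, by linarith [hr.2]⟩
      · rw [concat_of_le hτ, hx]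
      · rw [concat_of_ge hb (by linarith)]
        simp [hw]
  | @jump K s r u γ x w y hs hγ hS hx hw hmem hr hu _ ih =>
    rw [Nat.add_right_comm]
    exact .jump hs hγ hS hx hw hmem (by linarith [h₂.nonneg]) (by linarith) (ih h₂)

variable [T2Space M]

/-- Determinism: integral curves from the same point agree, so the first contact with the guard is
the same for both runs and their arcs can be matched one after another. What remains of the longer
run starts at the endpoint of the shorter one. -/
theorem CountedReach.split (hX : IsSmoothField X) {K : ℕ} {τ : ℝ} {x y : M}
    (h₁ : CountedReach X S Δ K τ x y) : ∀ {N : ℕ} {t : ℝ} {z : M},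
    CountedReach X S Δ N t x z → τ ≤ t →
      ∃ N', N = K + N' ∧ CountedReach X S Δ N' (t - τ) y z := by
  induction h₁ with
  | @flow τ γ x y hτ hγ hS hx hy =>
    intro N t z h₂ hle
    cases h₂ with
    | @flow _ γ₂ _ _ ht hγ₂ hS₂ hx₂ hy₂ =>
      have he := hX.eqOn_Icc hτ hγ (hγ₂.mono (Icc_subset_Icc_right hle)) (by rw [hx, hx₂])
      refine ⟨0, rfl, .flow (γ := fun r => γ₂ (r + τ)) (by linarith)
        (hγ₂.shift τ fun r hr => ⟨by linarith [hr.1], by linarith [hr.2]⟩)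
        (fun r hr => hS₂ _ ⟨by linarith [hr.1], by linarith [hr.2]⟩) ?_ ?_⟩
      · rw [zero_add, ← he ⟨hτ, le_rfl⟩, hy]
      · rw [sub_add_cancel, hy₂]
    | @jump N s r _ γ₂ _ w _ hs hγ₂ hS₂ hx₂ hw hmem hr hu h =>
      rcases le_or_gt τ s with hτs | hτs
      · have he := hX.eqOn_Icc hτ hγ (hγ₂.mono (Icc_subset_Icc_right hτs)) (by rw [hx, hx₂])
        refine ⟨N + 1, by ring, .jump (γ := fun r => γ₂ (r + τ)) (s := s - τ) (by linarith)
          (hγ₂.shift τ fun r hr => ⟨by linarith [hr.1], by linarith [hr.2]⟩)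
          (fun r hr => hS₂ _ ⟨by linarith [hr.1], by linarith [hr.2]⟩) ?_ ?_ hmem hr
          (by linarith) h⟩
        · rw [zero_add, ← he ⟨hτ, le_rfl⟩, hy]
        · rw [sub_add_cancel, hw]
      · have he := hX.eqOn_Icc hs (hγ.mono (Icc_subset_Icc_right hτs.le)) hγ₂ (by rw [hx, hx₂])
        have := hS s ⟨hs, hτs⟩
        rw [he ⟨hs, le_rfl⟩, hw] at this
        exact absurd hmem this
  | @jump K s r u γ x w y hs hγ hS hx hw hmem hr hu _ ih =>
    intro N t z h₂ hle
    cases h₂ with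
    | @flow _ γ₂ _ _ ht hγ₂ hS₂ hx₂ hy₂ =>
      have hst : s < t := by linarith
      have he := hX.eqOn_Icc hs hγ (hγ₂.mono (Icc_subset_Icc_right hst.le)) (by rw [hx, hx₂])
      have := hS₂ s ⟨hs, hst⟩
      rw [← he ⟨hs, le_rfl⟩, hw] at this
      exact absurd hmem this
    | @jump N s₂ r₂ _ γ₂ _ w₂ _ hs₂ hγ₂ hS₂ hx₂ hw₂ hmem₂ hr₂ hu₂ h =>
      have hss : s = s₂ := by
        rcases lt_trichotomy s s₂ with h | h | h
        · have he := hX.eqOn_Icc hs hγ (hγ₂.mono (Icc_subset_Icc_right h.le)) (by rw [hx, hx₂])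
          have := hS₂ s ⟨hs, h⟩
          rw [← he ⟨hs, le_rfl⟩, hw] at this
          exact absurd hmem this
        · exact h
        · have he := hX.eqOn_Icc hs₂ (hγ.mono (Icc_subset_Icc_right h.le)) hγ₂ (by rw [hx, hx₂])
          have := hS s₂ ⟨hs₂, h⟩
          rw [he ⟨hs₂, le_rfl⟩, hw₂] at this
          exact absurd hmem₂ this
      subst hss
      have he := hX.eqOn_Icc hs hγ hγ₂ (by rw [hx, hx₂])
      have hww : w = w₂ := by rw [← hw, ← hw₂, he ⟨hs, le_rfl⟩]
      subst hww
      obtain ⟨N', hN', h'⟩ := ih h (by linarith)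
      refine ⟨N', by omega, ?_⟩
      have ht : t - u = r₂ - r := by linarith
      rwa [ht]

/-- Splitting at the full time leaves a run of duration zero, which contains no reset because
positive time must remain after each reset. -/
theorem CountedReach.unique (hX : IsSmoothField X) {N N' : ℕ} {t : ℝ} {x y y' : M}
    (h : CountedReach X S Δ N t x y) (h' : CountedReach X S Δ N' t x y') : N = N' ∧ y = y' := by
  obtain ⟨k, hk, h0⟩ := h.split hX h' le_rfl
  rw [sub_self] at h0
  cases h0 with
  | flow _ _ _ hx hy => exact ⟨hk.symm, hx.symm.trans hy⟩
  | jump hs _ _ _ _ _ ht hu => linarith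

end CountedReach
end

noncomputable section

set_option linter.unusedSectionVars false

/-! ### Vector-valued functions on a manifold -/

section VectorValued

variable {E : Type*} [NormedAddCommGroup E] [NormedSpace ℝ E]
  {H : Type*} [TopologicalSpace H] {I : ModelWithCorners ℝ E H}
  {M : Type*} [TopologicalSpace M] [ChartedSpace H M]
  {E' : Type*} [NormedAddCommGroup E'] [NormedSpace ℝ E']
  {H' : Type*} [TopologicalSpace H'] {I' : ModelWithCorners ℝ E' H'}
  {M' : Type*} [TopologicalSpace M'] [ChartedSpace H' M']
  {V : Type*} [NormedAddCommGroup V] [NormedSpace ℝ V]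

variable (I) in
/-- The differential of a vector-valued function. -/
def vderiv (f : M → V) (z : M) : TangentSpace I z →L[ℝ] V := mfderiv I 𝓘(ℝ, V) f z

theorem differential_eq_vderiv (f : M → ℝ) (z : M) : differential I f z = vderiv I f z := rfl

theorem HasMFDerivAt.vderiv_eq {f : M → V} {z : M} {L : TangentSpace I z →L[ℝ] V}
    (h : HasMFDerivAt I 𝓘(ℝ, V) f z L) : vderiv I f z = L := h.mfderiv

theorem vderiv_comp {f : M' → V} {G : M → M'} {z : M}
    (hf : MDifferentiableAt I' 𝓘(ℝ, V) f (G z)) (hG : MDifferentiableAt I I' G z)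
    (u : TangentSpace I z) :
    vderiv I (fun w => f (G w)) z u = vderiv I' f (G z) (mfderiv I I' G z u) :=
  congrArg (fun L => L u) (hf.hasMFDerivAt.comp z hG.hasMFDerivAt).mfderiv

theorem fderiv_comp_vderiv {f : M → V} {G : E' → M} {y : E'}
    (hf : MDifferentiableAt I 𝓘(ℝ, V) f (G y)) (hG : MDifferentiableAt 𝓘(ℝ, E') I G y) (a : E') :
    fderiv ℝ (fun y => f (G y)) y a = vderiv I f (G y) (mfderiv 𝓘(ℝ, E') I G y a) := by
  have := vderiv_comp hf hG a
  rw [vderiv, mfderiv_eq_fderiv] at this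
  exact this

end VectorValued

/-! ### Invariance of an exact two-form along a family of maps -/

section FlatInvariance

set_option synthInstance.maxHeartbeats 200000

variable {E : Type*} [NormedAddCommGroup E] [NormedSpace ℝ E]
  {V : Type*} [NormedAddCommGroup V] [NormedSpace ℝ V]

theorem hasFDerivAt_pairing {P : E → V →L[ℝ] ℝ} {Q : E → V} {p : E}
    (hP : ContDiffAt ℝ 2 P p) (hQ : ContDiffAt ℝ 2 Q p) (α β ξ : E) :
    HasFDerivAt (fun p => fderiv ℝ P p β (fderiv ℝ Q p α))
      (fderiv ℝ (fun p => fderiv ℝ P p β (fderiv ℝ Q p α)) p) p ∧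
    fderiv ℝ (fun p => fderiv ℝ P p β (fderiv ℝ Q p α)) p ξ =
      fderiv ℝ (fderiv ℝ P) p ξ β (fderiv ℝ Q p α) +
        fderiv ℝ P p β (fderiv ℝ (fderiv ℝ Q) p ξ α) := by
  have hP' : HasFDerivAt (fderiv ℝ P) (fderiv ℝ (fderiv ℝ P) p) p :=
    ((hP.fderiv_right (m := 1) (by norm_num)).differentiableAt (by norm_num)).hasFDerivAt
  have hQ' : HasFDerivAt (fderiv ℝ Q) (fderiv ℝ (fderiv ℝ Q) p) p :=
    ((hQ.fderiv_right (m := 1) (by norm_num)).differentiableAt (by norm_num)).hasFDerivAt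
  have h := (hP'.clm_apply (hasFDerivAt_const β p)).clm_apply
    (hQ'.clm_apply (hasFDerivAt_const α p))
  refine ⟨h.differentiableAt.hasFDerivAt, ?_⟩
  rw [h.fderiv]
  simp [add_comm]

/-- If `i_e (dQ ∧ dP) = dK` on the slices, then `dQ ∧ dP` restricted to the slices does not change
in the direction `e`. -/
theorem pairing_derivative_eq_zero {P : E → V →L[ℝ] ℝ} {Q : E → V} {K : E → ℝ} {p : E}
    (hP : ContDiffAt ℝ 2 P p) (hQ : ContDiffAt ℝ 2 Q p) (hK : ContDiffAt ℝ 2 K p) {e α β : E}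
    (hα : ∀ᶠ p in 𝓝 p, fderiv ℝ K p α =
      fderiv ℝ P p α (fderiv ℝ Q p e) - fderiv ℝ P p e (fderiv ℝ Q p α))
    (hβ : ∀ᶠ p in 𝓝 p, fderiv ℝ K p β =
      fderiv ℝ P p β (fderiv ℝ Q p e) - fderiv ℝ P p e (fderiv ℝ Q p β)) :
    fderiv ℝ (fun p => fderiv ℝ P p β (fderiv ℝ Q p α)) p e -
      fderiv ℝ (fun p => fderiv ℝ P p α (fderiv ℝ Q p β)) p e = 0 := by
  have hK' : HasFDerivAt (fderiv ℝ K) (fderiv ℝ (fderiv ℝ K) p) p :=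
    ((hK.fderiv_right (m := 1) (by norm_num)).differentiableAt (by norm_num)).hasFDerivAt
  have key : ∀ {α : E}, (∀ᶠ p in 𝓝 p, fderiv ℝ K p α =
      fderiv ℝ P p α (fderiv ℝ Q p e) - fderiv ℝ P p e (fderiv ℝ Q p α)) → ∀ ξ,
      fderiv ℝ (fderiv ℝ K) p ξ α = fderiv ℝ (fderiv ℝ P) p ξ α (fderiv ℝ Q p e) +
        fderiv ℝ P p α (fderiv ℝ (fderiv ℝ Q) p ξ e) -
        (fderiv ℝ (fderiv ℝ P) p ξ e (fderiv ℝ Q p α) +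
          fderiv ℝ P p e (fderiv ℝ (fderiv ℝ Q) p ξ α)) := by
    intro α hα ξ
    have h1 : fderiv ℝ (fun p => fderiv ℝ K p α) p ξ = fderiv ℝ (fderiv ℝ K) p ξ α := by
      rw [(hK'.clm_apply (hasFDerivAt_const α p)).fderiv]
      simp
    have h2 := hasFDerivAt_pairing hP hQ e α ξ
    have h3 := hasFDerivAt_pairing hP hQ α e ξ
    rw [← h1, Filter.EventuallyEq.fderiv_eq hα, (h2.1.fun_sub h3.1).fderiv, sub_apply, h2.2, h3.2]
  have sP := hP.isSymmSndFDerivAt (by simp)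
  have sQ := hQ.isSymmSndFDerivAt (by simp)
  have sK := hK.isSymmSndFDerivAt (by simp)
  -- Subtracting these two relations is ddK = 0. The symmetric second derivatives of `P` and `Q`
  -- cancel, and what is left is the derivative in direction `e`: Cartan's formula for a closed
  -- form.
  have k1 := key hα β
  have k2 := key hβ α
  rw [(hasFDerivAt_pairing hP hQ α β e).2, (hasFDerivAt_pairing hP hQ β α e).2]
  have e1 := sP.eq α β
  have e2 := sQ.eq α β
  have e3 := sK.eq α β
  have e4 := sP.eq e α
  have e5 := sP.eq e β
  have e6 := sQ.eq e α
  have e7 := sQ.eq e β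
  rw [e1, e2, e3] at k2
  rw [e4, e5, e6, e7]
  linarith

/-- The derivative vanishes along r ↦ (r, y). The ball is taken in the maximum norm, so the segment
from (s, y) to (0, y) stays inside it. -/
theorem pairing_invariant {P : ℝ × E → V →L[ℝ] ℝ} {Q : ℝ × E → V} {K : ℝ × E → ℝ} {y₀ : E}
    {δ : ℝ} (hP : ∀ p ∈ Metric.ball ((0 : ℝ), y₀) δ, ContDiffAt ℝ 2 P p)
    (hQ : ∀ p ∈ Metric.ball ((0 : ℝ), y₀) δ, ContDiffAt ℝ 2 Q p)
    (hK : ∀ p ∈ Metric.ball ((0 : ℝ), y₀) δ, ContDiffAt ℝ 2 K p)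
    (h : ∀ p ∈ Metric.ball ((0 : ℝ), y₀) δ, ∀ b : E, fderiv ℝ K p (0, b) =
      fderiv ℝ P p (0, b) (fderiv ℝ Q p (1, 0)) - fderiv ℝ P p (1, 0) (fderiv ℝ Q p (0, b)))
    {s : ℝ} {y : E} (hsy : (s, y) ∈ Metric.ball ((0 : ℝ), y₀) δ) (a b : E) :
    fderiv ℝ P (s, y) (0, b) (fderiv ℝ Q (s, y) (0, a)) -
        fderiv ℝ P (s, y) (0, a) (fderiv ℝ Q (s, y) (0, b)) =
      fderiv ℝ P (0, y) (0, b) (fderiv ℝ Q (0, y) (0, a)) -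
        fderiv ℝ P (0, y) (0, a) (fderiv ℝ Q (0, y) (0, b)) := by
  have hmem : ∀ r : ℝ, |r| < δ → (r, y) ∈ Metric.ball ((0 : ℝ), y₀) δ := by
    intro r hr
    rw [Metric.mem_ball, Prod.dist_eq] at hsy ⊢
    exact max_lt (by simpa [Real.dist_eq] using hr) ((max_lt_iff.1 hsy).2)
  have hs : |s| < δ := by
    rw [Metric.mem_ball, Prod.dist_eq] at hsy
    simpa [Real.dist_eq] using (max_lt_iff.1 hsy).1
  have hδ : 0 < δ := (abs_nonneg s).trans_lt hs
  let f : ℝ × E → ℝ := fun p => fderiv ℝ P p (0, b) (fderiv ℝ Q p (0, a)) -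
    fderiv ℝ P p (0, a) (fderiv ℝ Q p (0, b))
  have hd : ∀ r ∈ Ioo (-δ) δ, HasDerivAt (fun r => f (r, y)) 0 r := by
    intro r hr
    have hp := hmem r (abs_lt.2 hr)
    have h1 := (hasFDerivAt_pairing (hP _ hp) (hQ _ hp) (0, a) (0, b) (1, 0)).1
    have h2 := (hasFDerivAt_pairing (hP _ hp) (hQ _ hp) (0, b) (0, a) (1, 0)).1
    have h3 : HasDerivAt (fun r : ℝ => (r, y)) ((1 : ℝ), (0 : E)) r :=
      (hasDerivAt_id r).prodMk (hasDerivAt_const r y)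
    have h4 := (h1.sub h2).comp_hasDerivAt r h3
    have hev : ∀ c : E, ∀ᶠ p in 𝓝 (r, y), fderiv ℝ K p (0, c) =
        fderiv ℝ P p (0, c) (fderiv ℝ Q p (1, 0)) - fderiv ℝ P p (1, 0) (fderiv ℝ Q p (0, c)) :=
      fun c => eventually_of_mem (Metric.isOpen_ball.mem_nhds hp) fun p hp => h p hp c
    have h5 := pairing_derivative_eq_zero (hP _ hp) (hQ _ hp) (hK _ hp) (hev a) (hev b)
    rw [sub_apply, h5] at h4
    exact h4
  have hconst := (isOpen_Ioo (a := -δ) (b := δ)).is_const_of_deriv_eq_zero isPreconnected_Ioo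
    (fun r hr => (hd r hr).differentiableAt.differentiableWithinAt) (fun r hr => (hd r hr).deriv)
    (abs_lt.1 hs) (show (0 : ℝ) ∈ Ioo (-δ) δ from ⟨by linarith, hδ⟩)
  exact hconst

end FlatInvariance
end

noncomputable section

set_option linter.unusedSectionVars false

/-! ### Presymplectic systems -/

/-- A family of operators on a finite-dimensional space is `C^n` at a point if all its values
are. -/
theorem contDiffAt_clm_of_apply {D E F : Type*} [NormedAddCommGroup D] [NormedSpace ℝ D]
    [NormedAddCommGroup E] [NormedSpace ℝ E] [FiniteDimensional ℝ E] [NormedAddCommGroup F]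
    [NormedSpace ℝ F] {n : WithTop ℕ∞} {f : D → E →L[ℝ] F} {x : D}
    (h : ∀ y, ContDiffAt ℝ n (fun x => f x y) x) : ContDiffAt ℝ n f x := by
  have hd : Module.finrank ℝ E = Module.finrank ℝ (Fin (Module.finrank ℝ E) → ℝ) :=
    (Module.finrank_fin_fun ℝ).symm
  let e₁ := ContinuousLinearEquiv.ofFinrankEq hd
  let e₂ := (e₁.arrowCongr (1 : F ≃L[ℝ] F)).trans
    (ContinuousLinearEquiv.piRing (Fin (Module.finrank ℝ E)))
  rw [← Function.id_comp f, ← e₂.symm_comp_self]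
  exact e₂.symm.contDiff.contDiffAt.comp x (contDiffAt_pi.mpr fun i => h _)

section Presymplectic

universe u
variable {E : Type u} [NormedAddCommGroup E] [NormedSpace ℝ E] [FiniteDimensional ℝ E]
  {H : Type*} [TopologicalSpace H] {I : ModelWithCorners ℝ E H} [I.Boundaryless]
  {M : Type*} [TopologicalSpace M] [ChartedSpace H M] [IsManifold I ∞ M]
  {V : Type*} [NormedAddCommGroup V] [NormedSpace ℝ V]

/-- Near `z₀` the two-form `Ω` is `dq ∧ dp` for smooth functions `q` and `p`. -/
structure IsPotentialAt (Ω : (z : M) → TangentSpace I z [⋀^Fin 2]→ₗ[ℝ] ℝ) (q : M → V)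
    (p : M → V →L[ℝ] ℝ) (z₀ : M) : Prop where
  smooth_q : ContMDiffAt I 𝓘(ℝ, V) ∞ q z₀
  smooth_p : ContMDiffAt I 𝓘(ℝ, V →L[ℝ] ℝ) ∞ p z₀
  form_eq : ∀ᶠ z in 𝓝 z₀, ∀ u v, Ω z ![u, v] =
    vderiv I p z v (vderiv I q z u) - vderiv I p z u (vderiv I q z v)

variable (V) in
/-- A vector field `X` with `i_X Ω = dK` and `dT(X) = c` for a two-form `Ω` that locally is
`dq ∧ dp`, such that `Ω` and `dT` have no common kernel. -/
structure PresymplecticSystem (X : (z : M) → TangentSpace I z)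
    (Ω : (z : M) → TangentSpace I z [⋀^Fin 2]→ₗ[ℝ] ℝ) (K T : M → ℝ) (c : ℝ) : Prop where
  potential : ∀ z, ∃ (q : M → V) (p : M → V →L[ℝ] ℝ), IsPotentialAt Ω q p z
  smooth_K : ContMDiff I 𝓘(ℝ, ℝ) ∞ K
  smooth_T : ContMDiff I 𝓘(ℝ, ℝ) ∞ T
  hamilton : ∀ z v, Ω z ![X z, v] = differential I K z v
  clock : ∀ z, differential I T z (X z) = c
  nondegenerate : ∀ z u, (∀ v, Ω z ![u, v] = 0) → differential I T z u = 0 → u = 0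

/-- The coordinate vector `a` at the point with coordinates `y` in the chart at `z`. -/
def chartVector (z : M) (y : E) : E →L[ℝ] TangentSpace I ((extChartAt I z).symm y) :=
  mfderiv 𝓘(ℝ, E) I (extChartAt I z).symm y

theorem chartVector_surjective {z : M} {y : E} (hy : y ∈ (extChartAt I z).target) :
    Function.Surjective (chartVector (I := I) z y) := by
  intro v
  refine ⟨mfderiv I 𝓘(ℝ, E) (extChartAt I z) ((extChartAt I z).symm y) v, ?_⟩
  have := mfderiv_extChartAt_symm_mfderiv_extChartAt ((extChartAt I z).map_target hy) v
  rw [(extChartAt I z).right_inv hy] at this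
  exact this

theorem chartVector_fieldInChart {X : (z : M) → TangentSpace I z} {z : M} {y : E}
    (hy : y ∈ (extChartAt I z).target) :
    chartVector z y (fieldInChart X z y) = X ((extChartAt I z).symm y) := by
  have := mfderiv_extChartAt_symm_mfderiv_extChartAt ((extChartAt I z).map_target hy)
    (X ((extChartAt I z).symm y))
  rw [(extChartAt I z).right_inv hy] at this
  exact this

theorem eventually_of_eventually_chart {r : M → Prop} {z : M}
    (h : ∀ᶠ y in 𝓝 (extChartAt I z z), r ((extChartAt I z).symm y)) : ∀ᶠ w in 𝓝 z, r w := by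
  filter_upwards [(continuousAt_extChartAt (I := I) z).eventually h,
    extChartAt_source_mem_nhds (I := I) z] with w hw hs
  rwa [(extChartAt I z).left_inv hs] at hw

theorem eventually_chart_of_eventually {r : M → Prop} {z : M} (h : ∀ᶠ w in 𝓝 z, r w) :
    ∀ᶠ y in 𝓝 (extChartAt I z z), r ((extChartAt I z).symm y) := by
  have hc := continuousAt_extChartAt_symm (I := I) z
  rw [ContinuousAt, extChartAt_to_inv] at hc
  exact hc.eventually h

theorem eventually_mem_target (z : M) :
    ∀ᶠ y in 𝓝 (extChartAt I z z), y ∈ (extChartAt I z).target :=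
  extChartAt_target_mem_nhds_of_boundaryless z (mem_extChartAt_target z)

theorem contDiffAt_chart {W : Type*} [NormedAddCommGroup W] [NormedSpace ℝ W] {f : M → W} {z : M}
    {n : WithTop ℕ∞} (hn : n ≤ ∞) (h : ContMDiffAt I 𝓘(ℝ, W) n f z) :
    ContDiffAt ℝ n (fun y => f ((extChartAt I z).symm y)) (extChartAt I z z) := by
  rw [← contMDiffAt_iff_contDiffAt]
  have h1 : ContMDiffAt 𝓘(ℝ, E) I n (extChartAt I z).symm (extChartAt I z z) :=
    ((contMDiffOn_extChartAt_symm (n := ∞) z).contMDiffAt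
      (extChartAt_target_mem_nhds_of_boundaryless z (mem_extChartAt_target z))).of_le hn
  exact ContMDiffAt.comp (g := f) _ (by rwa [extChartAt_to_inv]) h1

theorem eventually_mdifferentiableAt {W : Type*} [NormedAddCommGroup W] [NormedSpace ℝ W]
    {f : M → W} {z : M} (h : ContMDiffAt I 𝓘(ℝ, W) ∞ f z) :
    ∀ᶠ w in 𝓝 z, MDifferentiableAt I 𝓘(ℝ, W) f w := by
  have h1 : ContMDiffAt I 𝓘(ℝ, W) 1 f z := h.of_le (by simp)
  filter_upwards [(contMDiffAt_iff_contMDiffAt_nhds (by simp)).1 h1] with w hw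
  exact hw.mdifferentiableAt (by simp)

theorem fderiv_chart_eq {W : Type*} [NormedAddCommGroup W] [NormedSpace ℝ W] {f : M → W} {z : M}
    {y : E} (hy : y ∈ (extChartAt I z).target)
    (hf : MDifferentiableAt I 𝓘(ℝ, W) f ((extChartAt I z).symm y)) (a : E) :
    fderiv ℝ (fun y => f ((extChartAt I z).symm y)) y a =
      vderiv I f ((extChartAt I z).symm y) (chartVector z y a) :=
  fderiv_comp_vderiv hf (hasMFDerivAt_extChartAt_symm hy).mdifferentiableAt a

theorem IsPotentialAt.eventually_chart {Ω : (z : M) → TangentSpace I z [⋀^Fin 2]→ₗ[ℝ] ℝ}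
    {q : M → V} {p : M → V →L[ℝ] ℝ} {z : M} (h : IsPotentialAt Ω q p z) :
    ∀ᶠ y in 𝓝 (extChartAt I z z), ∀ a b : E,
      Ω ((extChartAt I z).symm y) ![chartVector z y a, chartVector z y b] =
        fderiv ℝ (fun y => p ((extChartAt I z).symm y)) y b
            (fderiv ℝ (fun y => q ((extChartAt I z).symm y)) y a) -
          fderiv ℝ (fun y => p ((extChartAt I z).symm y)) y a
            (fderiv ℝ (fun y => q ((extChartAt I z).symm y)) y b) := by
  filter_upwards [eventually_mem_target z, eventually_chart_of_eventually h.form_eq,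
    eventually_chart_of_eventually (eventually_mdifferentiableAt h.smooth_q),
    eventually_chart_of_eventually (eventually_mdifferentiableAt h.smooth_p)] with y hy h1 h2 h3 a b
  rw [h1, fderiv_chart_eq hy h2, fderiv_chart_eq hy h2, fderiv_chart_eq hy h3,
    fderiv_chart_eq hy h3]

-- In a chart the field solves the linear system A(X) = (dK, c), where A(u) = (i_u Ω, dT(u)) has
-- smooth coefficients and is injective by nondegeneracy. The system is overdetermined, so a left
-- inverse `L` of A at the centre is fixed. Then B = L ∘ A is invertible nearby and X = B⁻¹ L(dK, c)
-- is smooth.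
set_option synthInstance.maxHeartbeats 200000 in
theorem PresymplecticSystem.isSmoothField {X : (z : M) → TangentSpace I z}
    {Ω : (z : M) → TangentSpace I z [⋀^Fin 2]→ₗ[ℝ] ℝ} {K T : M → ℝ} {c : ℝ}
    (h : PresymplecticSystem V X Ω K T c) : IsSmoothField X := by
  refine isSmoothField_of_chart fun z => ?_
  obtain ⟨q, p, hpot⟩ := h.potential z
  set e := extChartAt I z with he
  let Q : E → V := fun y => q (e.symm y)
  let P : E → V →L[ℝ] ℝ := fun y => p (e.symm y)
  have hQ : ContDiffAt ℝ ∞ Q (e z) := contDiffAt_chart le_rfl hpot.smooth_q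
  have hP : ContDiffAt ℝ ∞ P (e z) := contDiffAt_chart le_rfl hpot.smooth_p
  have hK : ContDiffAt ℝ ∞ (fun y => K (e.symm y)) (e z) := contDiffAt_chart le_rfl (h.smooth_K z)
  have hT : ContDiffAt ℝ ∞ (fun y => T (e.symm y)) (e z) := contDiffAt_chart le_rfl (h.smooth_T z)
  let A₁ : E → E →L[ℝ] E →L[ℝ] ℝ := fun y => (fderiv ℝ P y).flip ∘L fderiv ℝ Q y
  let A : E → E →L[ℝ] ((E →L[ℝ] ℝ) × ℝ) := fun y =>
    ContinuousLinearMap.prod (A₁ y - (A₁ y).flip) (fderiv ℝ (fun y => T (e.symm y)) y)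
  have hpair : ∀ a b : E, ContDiffAt ℝ ∞ (fun y => fderiv ℝ P y b (fderiv ℝ Q y a)) (e z) :=
    fun a b => ((hP.fderiv_right (m := ∞) (by simp)).clm_apply contDiffAt_const).clm_apply
      ((hQ.fderiv_right (m := ∞) (by simp)).clm_apply contDiffAt_const)
  have hA : ContDiffAt ℝ ∞ A (e z) := by
    refine contDiffAt_clm_of_apply fun a => ContDiffAt.prodMk
      (contDiffAt_clm_of_apply fun b => ?_) ?_
    · exact (hpair a b).sub (hpair b a)
    · exact (hT.fderiv_right (m := ∞) (by simp)).clm_apply contDiffAt_const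
  have hform : ∀ᶠ y in 𝓝 (e z), ∀ a, A y a = ⟨(A y a).1, fderiv ℝ (fun y => T (e.symm y)) y a⟩ ∧
      ∀ b, (A y a).1 b = Ω (e.symm y) ![chartVector z y a, chartVector z y b] := by
    filter_upwards [hpot.eventually_chart] with y hy a
    exact ⟨rfl, fun b => (hy a b).symm⟩
  have hinj : Function.Injective (A (e z)) := by
    rw [injective_iff_map_eq_zero]
    intro a ha
    have hmem : e z ∈ e.target := mem_extChartAt_target z
    have hcv : chartVector (I := I) z (e z) a = 0 := by
      refine h.nondegenerate _ _ (fun v => ?_) ?_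
      · obtain ⟨b, rfl⟩ := chartVector_surjective hmem v
        rw [← (hform.self_of_nhds a).2 b, ha]
        rfl
      · have := congrArg Prod.snd ha
        refine Eq.trans ?_ this
        exact (fderiv_chart_eq hmem ((h.smooth_T _).mdifferentiableAt (by simp)) a).symm
    have := mfderiv_extChartAt_mfderiv_extChartAt_symm hmem a
    rw [← this]
    exact (congrArg _ hcv).trans (map_zero _)
  obtain ⟨L, hL⟩ := (A (e z)).toLinearMap.exists_leftInverse_of_injective
    (LinearMap.ker_eq_bot.2 hinj)
  let B : E → E →L[ℝ] E := fun y => LinearMap.toContinuousLinearMap L ∘L A y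
  have hB : ContDiffAt ℝ ∞ B (e z) := contDiffAt_const.clm_comp hA
  have hB₀ : B (e z) = (ContinuousLinearEquiv.refl ℝ E : E →L[ℝ] E) := by
    ext a
    exact congrArg (fun l => l a) hL
  have hinv : ContDiffAt ℝ ∞ (fun y => (B y).inverse) (e z) := by
    refine ContDiffAt.comp (g := ContinuousLinearMap.inverse) (e z) ?_ hB
    rw [hB₀]
    exact contDiffAt_map_inverse _
  have hrhs : ContDiffAt ℝ ∞ (fun y => (B y).inverse (L (fderiv ℝ (fun y => K (e.symm y)) y, c)))
      (e z) := by
    refine hinv.clm_apply ((LinearMap.toContinuousLinearMap L).contDiff.contDiffAt.comp (e z) ?_)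
    exact (hK.fderiv_right (m := ∞) (by simp)).prodMk contDiffAt_const
  have hunit : ∀ᶠ y in 𝓝 (e z), (B y).IsInvertible := by
    have := hB.continuousAt.preimage_mem_nhds
      (by rw [hB₀]; exact ContinuousLinearEquiv.nhds (ContinuousLinearEquiv.refl ℝ E))
    filter_upwards [this] with y hy
    exact hy
  have hX : fieldInChart X z =ᶠ[𝓝 (e z)]
      fun y => (B y).inverse (L (fderiv ℝ (fun y => K (e.symm y)) y, c)) := by
    filter_upwards [hunit, hform, eventually_mem_target z] with y hy hf hmem
    have hAX : A y (fieldInChart X z y) = (fderiv ℝ (fun y => K (e.symm y)) y, c) := by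
      refine Prod.ext ?_ ?_
      · ext b
        rw [(hf _).2 b, chartVector_fieldInChart hmem, h.hamilton,
          fderiv_chart_eq hmem ((h.smooth_K _).mdifferentiableAt (by simp)) b]
        rfl
      · rw [(hf _).1]
        refine (fderiv_chart_eq hmem ((h.smooth_T _).mdifferentiableAt (by simp)) _).trans ?_
        rw [chartVector_fieldInChart hmem]
        exact h.clock _
    rw [← hAX]
    obtain ⟨B', hB'⟩ := hy
    have : L (A y (fieldInChart X z y)) = B y (fieldInChart X z y) := rfl
    rw [this, ← hB', ContinuousLinearMap.inverse_equiv]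
    simp
  have hcd := hrhs.congr_of_eventuallyEq hX
  have hcm : ContMDiffAt I 𝓘(ℝ, E) ∞ (fun w => fieldInChart X z (e w)) z :=
    ContMDiffAt.comp z hcd.contMDiffAt contMDiffAt_extChartAt
  refine hcm.congr_of_eventuallyEq ?_
  filter_upwards [extChartAt_source_mem_nhds (I := I) z] with w hw
  simp only [fieldInChart]
  rw [(extChartAt I z).left_inv hw]

end Presymplectic
end

noncomputable section

set_option linter.unusedSectionVars false

/-! ### The flow of a presymplectic system -/

section PresymplecticFlow

universe u
variable {E : Type u} [NormedAddCommGroup E] [NormedSpace ℝ E] [FiniteDimensional ℝ E]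
  {H : Type*} [TopologicalSpace H] {I : ModelWithCorners ℝ E H} [I.Boundaryless]
  {M : Type*} [TopologicalSpace M] [ChartedSpace H M] [IsManifold I ∞ M]
  {V : Type*} [NormedAddCommGroup V] [NormedSpace ℝ V]
  {X : (z : M) → TangentSpace I z} {Ω : (z : M) → TangentSpace I z [⋀^Fin 2]→ₗ[ℝ] ℝ}
  {K T : M → ℝ} {c : ℝ}

theorem mfderiv_prod_left_eq {Ψ : ℝ × E → M} {s : ℝ} {y : E} {v : TangentSpace I (Ψ (s, y))}
    (h : MDifferentiableAt 𝓘(ℝ, ℝ × E) I Ψ (s, y))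
    (hv : HasMFDerivAt 𝓘(ℝ, ℝ) I (fun r => Ψ (r, y)) s ((1 : ℝ →L[ℝ] ℝ).smulRight v)) :
    mfderiv 𝓘(ℝ, ℝ × E) I Ψ (s, y) ((1 : ℝ), (0 : E)) = v := by
  have h1 : HasMFDerivAt 𝓘(ℝ, ℝ) 𝓘(ℝ, ℝ × E) (fun r : ℝ => (r, y)) s
      (ContinuousLinearMap.inl ℝ ℝ E) :=
    hasMFDerivAt_iff_hasFDerivAt.2 (hasFDerivAt_prodMk_left s y)
  have h2 := hasMFDerivAt_unique (h.hasMFDerivAt.comp s h1) hv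
  have h3 := congrArg (fun L => L (1 : ℝ)) h2
  refine Eq.trans ?_ (h3.trans ?_)
  · rfl
  · exact one_smul ℝ v

theorem mfderiv_prod_right_eq {Ψ : ℝ × E → M} {s : ℝ} {y : E}
    (h : MDifferentiableAt 𝓘(ℝ, ℝ × E) I Ψ (s, y)) (b : E) :
    mfderiv 𝓘(ℝ, ℝ × E) I Ψ (s, y) ((0 : ℝ), b) =
      mfderiv 𝓘(ℝ, E) I (fun y => Ψ (s, y)) y b := by
  have h1 : HasMFDerivAt 𝓘(ℝ, E) 𝓘(ℝ, ℝ × E) (fun y : E => (s, y)) y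
      (ContinuousLinearMap.inr ℝ ℝ E) :=
    hasMFDerivAt_iff_hasFDerivAt.2 (hasFDerivAt_prodMk_right s y)
  exact (congrArg (fun L => L b) (h.hasMFDerivAt.comp y h1).mfderiv).symm

/-- Every tangent space is by definition the model space, so the same vectors of `E` can be read at
equal base points without casts. -/
theorem twoForm_apply_congr (Ω : (z : M) → TangentSpace I z [⋀^Fin 2]→ₗ[ℝ] ℝ) {y y' : M}
    (h : y = y') (a b : E) :
    Ω y ![(show TangentSpace I y from a), (show TangentSpace I y from b)] =
      Ω y' ![(show TangentSpace I y' from a), (show TangentSpace I y' from b)] := by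
  subst h; rfl

/-- The map `F` pulls the 2-form `Ω` back to itself at the point `x`. -/
def PullsBackAt (Ω : (z : M) → TangentSpace I z [⋀^Fin 2]→ₗ[ℝ] ℝ) (F : M → M) (x : M) : Prop :=
  ∀ u v, Ω (F x) ![mfderiv I I F x u, mfderiv I I F x v] = Ω x ![u, v]

theorem PullsBackAt.congr {F G : M → M} {x : M} (hF : PullsBackAt Ω F x)
    (h : G =ᶠ[𝓝 x] F) : PullsBackAt Ω G x := by
  intro u v
  refine Eq.trans ?_ (hF u v)
  have h1 : ∀ w, (mfderiv I I G x w : E) = (mfderiv I I F x w : E) := fun w =>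
    congrArg (fun L : E →L[ℝ] E => L w) h.mfderiv_eq
  refine (twoForm_apply_congr Ω h.eq_of_nhds _ _).trans ?_
  exact congrArg₂ (fun a b : E => Ω (F x) ![(show TangentSpace I (F x) from a),
    (show TangentSpace I (F x) from b)]) (h1 u) (h1 v)

theorem pullsBackAt_id (Ω : (z : M) → TangentSpace I z [⋀^Fin 2]→ₗ[ℝ] ℝ) (x : M) :
    PullsBackAt Ω id x := by
  intro u v
  rw [mfderiv_id]; rfl

theorem PullsBackAt.comp {F G : M → M} {x : M} (hG : PullsBackAt Ω G (F x))
    (hF : PullsBackAt Ω F x) (hGd : MDifferentiableAt I I G (F x))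
    (hFd : MDifferentiableAt I I F x) : PullsBackAt Ω (fun z => G (F z)) x := by
  intro u v
  refine Eq.trans ?_ ((hG _ _).trans (hF u v))
  have h1 : ∀ w, mfderiv I I (fun z => G (F z)) x w = mfderiv I I G (F x) (mfderiv I I F x w) :=
    fun w => congrArg (fun L => L w) (mfderiv_comp x hGd hFd)
  rw [h1, h1]

theorem eventually_contDiffAt_comp {D F : Type*} [NormedAddCommGroup D] [NormedSpace ℝ D]
    [NormedAddCommGroup F] [NormedSpace ℝ F] {Ψ : D → M} {x₀ : D} {z₀ : M} {f : M → F}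
    (hΨ : ContMDiffAt 𝓘(ℝ, D) I ∞ Ψ x₀) (hΨ₀ : Ψ x₀ = z₀) (hf : ContMDiffAt I 𝓘(ℝ, F) ∞ f z₀) :
    ∀ᶠ x in 𝓝 x₀, ContDiffAt ℝ 2 (fun x => f (Ψ x)) x := by
  have h1 : ContDiffAt ℝ ∞ (fun x => f (Ψ x)) x₀ := by
    rw [← contMDiffAt_iff_contDiffAt]
    exact ContMDiffAt.comp (g := f) _ (by rwa [hΨ₀]) hΨ
  exact (h1.of_le (m := 2) (by norm_cast)).eventually (by simp)

/-- The potentials and `K` are composed with Ψ(s, y) = Φ(s, y), the point y being read in the chart.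
The time derivative of Ψ is `X`, so i_X Ω = dK becomes the hypothesis of `pairing_invariant` with
time direction (1, 0). The pullback of Ω at time s thus equals the one at time 0, where Φ is the
identity. -/
theorem PresymplecticSystem.exists_localFlow (h : PresymplecticSystem V X Ω K T c) (z₀ : M) :
    ∃ Φ : ℝ × M → M, ContMDiffAt (𝓘(ℝ, ℝ).prod I) I ∞ Φ (0, z₀) ∧
      ∃ δ > 0, ∃ W ∈ 𝓝 z₀, ∀ z ∈ W, Φ (0, z) = z ∧
        IsMIntegralCurveOn (I := I) (fun s => Φ (s, z)) X (Ioo (-δ) δ) ∧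
        ∀ s ∈ Ioo (-δ) δ, ContMDiffAt (𝓘(ℝ, ℝ).prod I) I 1 Φ (s, z) ∧
          PullsBackAt Ω (fun z => Φ (s, z)) z := by
  obtain ⟨Φ, hΦ, δ₀, hδ₀, W₀, hW₀, hflow⟩ := h.isSmoothField.exists_localFlow z₀
  obtain ⟨q, p, hpot⟩ := h.potential z₀
  set e := extChartAt I z₀
  let Ψ : ℝ × E → M := fun x => Φ (x.1, e.symm x.2)
  have hΦ₀ : Φ (0, z₀) = z₀ := (hflow z₀ (mem_of_mem_nhds hW₀)).1
  have hsymm : e.symm (e z₀) = z₀ := extChartAt_to_inv (I := I) z₀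
  have hpair : ContMDiffAt 𝓘(ℝ, ℝ × E) (𝓘(ℝ, ℝ).prod I) ∞
      (fun x : ℝ × E => (x.1, e.symm x.2)) (0, e z₀) := by
    have h1 : ContMDiffAt 𝓘(ℝ, E) I ∞ e.symm (e z₀) :=
      (contMDiffOn_extChartAt_symm z₀).contMDiffAt
        (extChartAt_target_mem_nhds_of_boundaryless z₀ (mem_extChartAt_target z₀))
    exact contDiffAt_fst.contMDiffAt.prodMk (h1.comp (0, e z₀) contDiffAt_snd.contMDiffAt)
  have hΨ : ContMDiffAt 𝓘(ℝ, ℝ × E) I ∞ Ψ (0, e z₀) :=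
    ContMDiffAt.comp (g := Φ) (0, e z₀) (by simpa [hsymm] using hΦ) hpair
  have hΨ₀ : Ψ (0, e z₀) = z₀ := by simp only [Ψ]; rw [hsymm, hΦ₀]
  have hcont : Tendsto Ψ (𝓝 (0, e z₀)) (𝓝 z₀) := by
    have := hΨ.continuousAt
    rwa [ContinuousAt, hΨ₀] at this
  have hsmall : ∀ᶠ x in 𝓝 ((0 : ℝ), e z₀), x.1 ∈ Ioo (-δ₀) δ₀ :=
    continuousAt_fst.eventually (Ioo_mem_nhds (by simpa using hδ₀) (by simpa using hδ₀))
  have hW₀' : ∀ᶠ x in 𝓝 ((0 : ℝ), e z₀), e.symm x.2 ∈ W₀ :=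
    (continuousAt_snd (p := ((0 : ℝ), e z₀))).eventually
      (eventually_chart_of_eventually (I := I) hW₀)
  have htarget : ∀ᶠ x in 𝓝 ((0 : ℝ), e z₀), x.2 ∈ e.target :=
    (continuousAt_snd (p := ((0 : ℝ), e z₀))).eventually (eventually_mem_target (I := I) z₀)
  have hΦ1 : ∀ᶠ x in 𝓝 ((0 : ℝ), e z₀),
      ContMDiffAt (𝓘(ℝ, ℝ).prod I) I 1 Φ (x.1, e.symm x.2) := by
    have h1 := (contMDiffAt_iff_contMDiffAt_nhds (by simp)).1 (hΦ.of_le (m := 1) (by simp))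
    have h2 := hpair.continuousAt
    rw [ContinuousAt, hsymm] at h2
    exact h2.eventually h1
  have hall := (eventually_contDiffAt_comp hΨ hΨ₀ hpot.smooth_q).and <|
    (eventually_contDiffAt_comp hΨ hΨ₀ hpot.smooth_p).and <|
    (eventually_contDiffAt_comp hΨ hΨ₀ (h.smooth_K z₀)).and <| hsmall.and <| hW₀'.and <|
    htarget.and <| hΦ1.and <|
    hcont.eventually hpot.form_eq |>.and <|
    (hcont.eventually (eventually_mdifferentiableAt hpot.smooth_q)).and
    (hcont.eventually (eventually_mdifferentiableAt hpot.smooth_p))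
  obtain ⟨ρ, hρ, hall⟩ := Metric.eventually_nhds_iff_ball.1 hall
  have hmd : ∀ x ∈ Metric.ball ((0 : ℝ), e z₀) ρ,
      MDifferentiableAt 𝓘(ℝ, ℝ × E) I Ψ x := by
    intro x hx
    obtain ⟨-, -, -, -, -, hy, h1, -⟩ := hall x hx
    have h2 : MDifferentiableAt 𝓘(ℝ, ℝ × E) (𝓘(ℝ, ℝ).prod I)
        (fun x : ℝ × E => (x.1, e.symm x.2)) x :=
      differentiableAt_fst.mdifferentiableAt.prodMk
        (MDifferentiableAt.comp x (hasMFDerivAt_extChartAt_symm hy).mdifferentiableAt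
          differentiableAt_snd.mdifferentiableAt)
    exact MDifferentiableAt.comp (g := Φ) x (h1.mdifferentiableAt (by simp)) h2
  have hleft : ∀ s y, (s, y) ∈ Metric.ball ((0 : ℝ), e z₀) ρ →
      mfderiv 𝓘(ℝ, ℝ × E) I Ψ (s, y) ((1 : ℝ), (0 : E)) = X (Ψ (s, y)) := by
    intro s y hx
    obtain ⟨-, -, -, hs, hw, -⟩ := hall _ hx
    exact mfderiv_prod_left_eq (hmd _ hx)
      (((hflow _ hw).2 s hs).hasMFDerivAt (isOpen_Ioo.mem_nhds hs))
  have hright : ∀ s y, (s, y) ∈ Metric.ball ((0 : ℝ), e z₀) ρ → ∀ b : E,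
      mfderiv 𝓘(ℝ, ℝ × E) I Ψ (s, y) ((0 : ℝ), b) =
        mfderiv I I (fun z => Φ (s, z)) (e.symm y) (chartVector z₀ y b) := by
    intro s y hx b
    obtain ⟨-, -, -, -, -, hy, h1, -⟩ := hall _ hx
    rw [mfderiv_prod_right_eq (hmd _ hx)]
    have h2 : MDifferentiableAt I I (fun z => Φ (s, z)) (e.symm y) :=
      MDifferentiableAt.comp (g := Φ) (e.symm y) (h1.mdifferentiableAt (by simp))
        (mdifferentiableAt_const.prodMk mdifferentiableAt_id)
    exact congrArg (fun L => L b)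
      (h2.hasMFDerivAt.comp y (hasMFDerivAt_extChartAt_symm hy)).mfderiv
  have hinv := fun (s : ℝ) (y : E) => pairing_invariant (s := s) (y := y)
    (P := fun x => p (Ψ x)) (Q := fun x => q (Ψ x))
    (K := fun x => K (Ψ x)) (fun x hx => (hall x hx).2.1) (fun x hx => (hall x hx).1)
    (fun x hx => (hall x hx).2.2.1) (fun x hx b => by
      obtain ⟨-, -, -, hs, hw, hy, -, hform, hq, hp⟩ := hall x hx
      rw [fderiv_comp_vderiv hq (hmd x hx), fderiv_comp_vderiv hq (hmd x hx),
        fderiv_comp_vderiv hp (hmd x hx), fderiv_comp_vderiv hp (hmd x hx),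
        fderiv_comp_vderiv ((h.smooth_K _).mdifferentiableAt (by simp)) (hmd x hx),
        hleft x.1 x.2 hx]
      have := h.hamilton (Ψ x) (mfderiv 𝓘(ℝ, ℝ × E) I Ψ x ((0 : ℝ), b))
      rw [hform] at this
      exact this.symm)
  have hfinal : ∀ s y, (s, y) ∈ Metric.ball ((0 : ℝ), e z₀) ρ → ∀ a b : E,
      Ω (Ψ (s, y)) ![mfderiv I I (fun z => Φ (s, z)) (e.symm y) (chartVector z₀ y a),
        mfderiv I I (fun z => Φ (s, z)) (e.symm y) (chartVector z₀ y b)] =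
      fderiv ℝ (fun x => p (Ψ x)) (0, y) (0, b) (fderiv ℝ (fun x => q (Ψ x)) (0, y) (0, a)) -
      fderiv ℝ (fun x => p (Ψ x)) (0, y) (0, a) (fderiv ℝ (fun x => q (Ψ x)) (0, y) (0, b)) := by
    intro s y hx a b
    obtain ⟨-, -, -, hs, hw, hy, -, hform, hq, hp⟩ := hall _ hx
    rw [← hinv s y hx a b, fderiv_comp_vderiv hq (hmd _ hx), fderiv_comp_vderiv hq (hmd _ hx),
      fderiv_comp_vderiv hp (hmd _ hx), fderiv_comp_vderiv hp (hmd _ hx),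
      hright _ _ hx, hright _ _ hx, hform]
  have hball : ∀ s : ℝ, ∀ y, |s| < ρ → y ∈ Metric.ball (e z₀) ρ →
      (s, y) ∈ Metric.ball ((0 : ℝ), e z₀) ρ := by
    intro s y hs hy
    rw [Metric.mem_ball, Prod.dist_eq]
    exact max_lt (by simpa [Real.dist_eq] using hs) hy
  let r := min δ₀ ρ
  have hr : 0 < r := lt_min hδ₀ hρ
  refine ⟨Φ, hΦ, r, hr, interior W₀ ∩ (e.source ∩ e ⁻¹' Metric.ball (e z₀) ρ), ?_, ?_⟩
  · exact inter_mem (interior_mem_nhds.2 hW₀) (inter_mem (extChartAt_source_mem_nhds z₀)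
      ((continuousAt_extChartAt z₀).preimage_mem_nhds (Metric.ball_mem_nhds _ hρ)))
  rintro z ⟨hz, hsrc, hzb⟩
  obtain ⟨h0, h1⟩ := hflow z (interior_subset hz)
  have hzz : e.symm (e z) = z := e.left_inv hsrc
  refine ⟨h0, h1.mono (Ioo_subset_Ioo (by linarith [min_le_left δ₀ ρ]) (min_le_left _ _)),
    fun s hs => ?_⟩
  have hsρ : |s| < ρ := abs_lt.2 ⟨by linarith [hs.1, min_le_right δ₀ ρ],
    by linarith [hs.2, min_le_right δ₀ ρ]⟩
  refine ⟨?_, ?_⟩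
  · have := (hall _ (hball s (e z) hsρ hzb)).2.2.2.2.2.2.1
    simpa only [hzz] using this
  · have key : PullsBackAt Ω (fun z => Φ (s, z)) (e.symm (e z)) := by
      intro u v
      have ht : e z ∈ e.target := e.map_source hsrc
      obtain ⟨a, rfl⟩ := chartVector_surjective ht u
      obtain ⟨b, rfl⟩ := chartVector_surjective ht v
      refine (hfinal s (e z) (hball s _ hsρ hzb) a b).trans ?_
      rw [← hfinal 0 (e z) (hball 0 _ (by simpa using hρ) hzb) a b]
      -- Only a neighbourhood identity determines the derivative at time zero; this is why the
      -- interior of `W₀` was taken.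
      have hid : (fun w => Φ (0, w)) =ᶠ[𝓝 (e.symm (e z))] id := by
        rw [hzz]
        filter_upwards [isOpen_interior.mem_nhds hz] with w hw
        exact (hflow w (interior_subset hw)).1
      exact (pullsBackAt_id Ω _).congr hid _ _
    rw [hzz] at key
    exact key

end PresymplecticFlow
end

noncomputable section

set_option linter.unusedSectionVars false

/-! ### Regular points of the hybrid flow -/

/-- Continuous induction on an interval. -/
theorem forall_mem_Icc_of_local_step {t : ℝ} {A : ℝ → Prop} (ht : 0 ≤ t) (h0 : A 0)
    (h : ∀ r ∈ Icc 0 t, ∃ η > 0, ∀ s ∈ Icc 0 t, ∀ s' ∈ Icc 0 t, |s - r| < η → |s' - r| < η →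
      s ≤ s' → A s → A s') : ∀ s ∈ Icc 0 t, A s := by
  let B : Set ℝ := {s | s ∈ Icc 0 t ∧ ∀ r ∈ Icc 0 s, A r}
  have hB0 : (0 : ℝ) ∈ B := ⟨⟨le_rfl, ht⟩, fun r hr => by rwa [le_antisymm hr.2 hr.1]⟩
  have hbdd : BddAbove B := ⟨t, fun s hs => hs.1.2⟩
  set c := sSup B
  have hc : c ∈ Icc 0 t := ⟨le_csSup hbdd hB0, csSup_le ⟨0, hB0⟩ fun s hs => hs.1.2⟩
  obtain ⟨η, hη, hstep⟩ := h c hc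
  obtain ⟨s, hs, hsc⟩ := exists_lt_of_lt_csSup ⟨0, hB0⟩ (show c - η < sSup B by linarith)
  have hsc' : s ≤ c := le_csSup hbdd hs
  -- The local step at the supremum `c` starts from some `s` of the set within distance `η` and
  -- carries the property past `c` unless `t` is already reached.
  have hmem : min t (c + η / 2) ∈ B := by
    refine ⟨⟨le_min ht (by linarith [hc.1]), min_le_left _ _⟩, fun r hr => ?_⟩
    by_cases hrs : r ≤ s
    · exact hs.2 r ⟨hr.1, hrs⟩
    · push Not at hrs
      have h1 := hr.2.trans (min_le_left _ _)
      have h2 := hr.2.trans (min_le_right _ _)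
      exact hstep s hs.1 r ⟨hr.1, h1⟩ (abs_lt.2 ⟨by linarith, by linarith⟩)
        (abs_lt.2 ⟨by linarith, by linarith⟩) hrs.le (hs.2 s ⟨hs.1.1, le_rfl⟩)
  have hle := le_csSup hbdd hmem
  have htc : t ≤ c := by
    by_contra hlt
    push Not at hlt
    rcases min_choice t (c + η / 2) with h1 | h1 <;> rw [h1] at hle <;> change _ ≤ c at hle <;>
      linarith
  intro r hr
  exact hmem.2 r ⟨hr.1, le_min hr.2 (by linarith [hr.2])⟩

section Regular

universe u
variable {E : Type u} [NormedAddCommGroup E] [NormedSpace ℝ E] [FiniteDimensional ℝ E]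
  {H : Type*} [TopologicalSpace H] {I : ModelWithCorners ℝ E H} [I.Boundaryless]
  {M : Type*} [TopologicalSpace M] [ChartedSpace H M] [IsManifold I ∞ M] [T2Space M]
  {V : Type*} [NormedAddCommGroup V] [NormedSpace ℝ V]
  {X : (z : M) → TangentSpace I z} {Ω : (z : M) → TangentSpace I z [⋀^Fin 2]→ₗ[ℝ] ℝ}
  {K T : M → ℝ} {c : ℝ} {S : Set M} {Δ : M → M}

/-- Near `x` the time-`t` hybrid flow is a map with `N` resets that takes `x` to `y`, is `C^1` at
`x` and pulls `Ω` back to itself at `x`. -/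
def RegularAt (X : (z : M) → TangentSpace I z) (S : Set M) (Δ : M → M)
    (Ω : (z : M) → TangentSpace I z [⋀^Fin 2]→ₗ[ℝ] ℝ) (N : ℕ) (t : ℝ) (x y : M) : Prop :=
  ∃ G : M → M, G x = y ∧ ContMDiffAt I I 1 G x ∧ PullsBackAt Ω G x ∧
    ∀ᶠ x' in 𝓝 x, CountedReach X S Δ N t x' (G x')

theorem RegularAt.comp {N N' : ℕ} {t t' : ℝ} {x y z : M} (h₁ : RegularAt X S Δ Ω N t x y)
    (h₂ : RegularAt X S Δ Ω N' t' y z) : RegularAt X S Δ Ω (N + N') (t + t') x z := by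
  obtain ⟨G, rfl, hG, hGΩ, hGr⟩ := h₁
  obtain ⟨F, rfl, hF, hFΩ, hFr⟩ := h₂
  refine ⟨fun w => F (G w), rfl, hF.comp x hG, hFΩ.comp hGΩ (hF.mdifferentiableAt (by simp))
    (hG.mdifferentiableAt (by simp)), ?_⟩
  filter_upwards [hGr, hG.continuousAt.eventually hFr] with w h1 h2 using h1.trans h2

theorem RegularAt.reach {N : ℕ} {t : ℝ} {x y : M} (h : RegularAt X S Δ Ω N t x y) :
    CountedReach X S Δ N t x y := by
  obtain ⟨G, rfl, -, -, h⟩ := h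
  exact h.self_of_nhds

theorem PresymplecticSystem.regularAt_zero (h : PresymplecticSystem V X Ω K T c) (x : M) :
    RegularAt X S Δ Ω 0 0 x x := by
  refine ⟨id, rfl, contMDiffAt_id, pullsBackAt_id Ω x, Eventually.of_forall fun w => ?_⟩
  obtain ⟨Φ, -, δ, hδ, W, hW, hflow⟩ := h.isSmoothField.exists_localFlow w
  obtain ⟨h0, hc⟩ := hflow w (mem_of_mem_nhds hW)
  refine .flow (γ := fun s => Φ (s, w)) le_rfl (hc.mono fun s hs => ?_) (fun s hs => ?_) h0 h0
  · rw [le_antisymm hs.2 hs.1]; exact ⟨by linarith, hδ⟩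
  · exact absurd (hs.1.trans_lt hs.2) (lt_irrefl _)

/-- Short trajectories that stay away from a closed set containing the guard are regular. -/
theorem PresymplecticSystem.exists_regularAt (h : PresymplecticSystem V X Ω K T c) {C : Set M}
    (hC : IsClosed C) (hSC : S ⊆ C) {z₀ : M} (hz₀ : z₀ ∉ C) :
    ∃ δ > 0, ∃ W ∈ 𝓝 z₀, ∀ z ∈ W, ∀ s ∈ Ico 0 δ, ∃ γ : ℝ → M, γ 0 = z ∧
      IsMIntegralCurveOn (I := I) γ X (Icc 0 s) ∧ RegularAt X S Δ Ω 0 s z (γ s) := by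
  obtain ⟨Φ, hΦ, δ₀, hδ₀, W₀, hW₀, hflow⟩ := h.exists_localFlow z₀
  have hΦ₀ : Φ (0, z₀) = z₀ := (hflow z₀ (mem_of_mem_nhds hW₀)).1
  have h1 : ∀ᶠ x in 𝓝 ((0 : ℝ), z₀), Φ x ∉ C :=
    hΦ.continuousAt.eventually (by rw [hΦ₀]; exact hC.isOpen_compl.mem_nhds hz₀)
  rw [nhds_prod_eq] at h1
  obtain ⟨pa, ha, pb, hb, hab⟩ := eventually_prod_iff.1 h1
  obtain ⟨δ₁, hδ₁, hball⟩ := Metric.eventually_nhds_iff.1 ha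
  refine ⟨min δ₀ δ₁, lt_min hδ₀ hδ₁, interior (W₀ ∩ {z | pb z}),
    interior_mem_nhds.2 (inter_mem hW₀ hb), fun z hz s hs => ?_⟩
  have hs0 := hs.2.trans_le (min_le_left _ _)
  have hs1 := hs.2.trans_le (min_le_right _ _)
  have hsub : Icc 0 s ⊆ Ioo (-δ₀) δ₀ := fun r hr => ⟨by linarith [hr.1], hr.2.trans_lt hs0⟩
  obtain ⟨hz0, hzc, hzs⟩ := hflow z (interior_subset hz).1
  obtain ⟨hsm, hsΩ⟩ := hzs s (hsub ⟨hs.1, le_rfl⟩)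
  refine ⟨fun s => Φ (s, z), hz0, hzc.mono hsub, fun z => Φ (s, z), rfl, ?_, hsΩ, ?_⟩
  · exact ContMDiffAt.comp (g := Φ) z hsm (contMDiffAt_const.prodMk contMDiffAt_id)
  · filter_upwards [isOpen_interior.mem_nhds hz] with w hw
    obtain ⟨hw0, hwc, -⟩ := hflow w (interior_subset hw).1
    refine .flow (γ := fun s => Φ (s, w)) hs.1 (hwc.mono hsub) (fun r hr hrS => ?_) hw0 rfl
    refine hab (x := r) (hball ?_) (y := w) (interior_subset hw).2 (hSC hrS)
    rw [Real.dist_eq, sub_zero, abs_of_nonneg hr.1]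
    exact hr.2.trans hs1

/-- Short regular pieces are composed along the curve by continuous induction. A closed set `C`
containing the guard is needed because the guard is not closed in general: neighbouring trajectories
must avoid it too. The choice `C = ∅`, with empty guard, yields regularity of the unreset flow. -/
theorem PresymplecticSystem.regularAt_of_avoids (h : PresymplecticSystem V X Ω K T c) {C : Set M}
    (hC : IsClosed C) (hSC : S ⊆ C) {γ : ℝ → M} {t : ℝ} (ht : 0 ≤ t)
    (hγ : IsMIntegralCurveOn (I := I) γ X (Icc 0 t)) (hav : ∀ s ∈ Icc 0 t, γ s ∉ C) :
    RegularAt X S Δ Ω 0 t (γ 0) (γ t) := by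
  refine forall_mem_Icc_of_local_step (A := fun s => RegularAt X S Δ Ω 0 s (γ 0) (γ s)) ht
    (h.regularAt_zero _) (fun r hr => ?_) t ⟨ht, le_rfl⟩
  obtain ⟨δ, hδ, W, hW, hreg⟩ := h.exists_regularAt (Δ := Δ) hC hSC (hav r hr)
  have hcont : ContinuousWithinAt γ (Icc 0 t) r := (hγ r hr).continuousWithinAt
  obtain ⟨η, hη, hηW⟩ := Metric.mem_nhdsWithin_iff.1 (hcont.preimage_mem_nhdsWithin hW)
  refine ⟨min η (δ / 2), lt_min hη (by linarith), fun s hs s' hs' hsr hsr' hss' hA => ?_⟩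
  have hsW : γ s ∈ W := hηW ⟨by
    rw [Metric.mem_ball, Real.dist_eq]; exact hsr.trans_le (min_le_left _ _), hs⟩
  have hlt : s' - s < δ := by
    have h1 := abs_lt.1 (hsr.trans_le (min_le_right _ _))
    have h2 := abs_lt.1 (hsr'.trans_le (min_le_right _ _))
    linarith [h1.1, h2.2]
  obtain ⟨γ', hγ'0, hγ', hr'⟩ := hreg (γ s) hsW (s' - s) ⟨by linarith, hlt⟩
  have hsh : IsMIntegralCurveOn (I := I) (fun r => γ (r + s)) X (Icc 0 (s' - s)) :=
    hγ.shift s (s' := Icc 0 (s' - s)) (fun r hr => ⟨by linarith [hr.1, hs.1],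
      by linarith [hr.2, hs'.2]⟩)
  have heq := h.isSmoothField.eqOn_Icc (sub_nonneg.2 hss') hγ' hsh (by simpa using hγ'0)
    ⟨by linarith, le_rfl⟩
  have hres := hA.comp hr'
  rw [heq] at hres
  simpa using hres

theorem PresymplecticSystem.clock_of_curve (h : PresymplecticSystem V X Ω K T c) {γ : ℝ → M}
    {t : ℝ} (hγ : IsMIntegralCurveOn (I := I) γ X (Icc 0 t)) (ht : 0 ≤ t) :
    T (γ t) = T (γ 0) + c * t := by
  have hd : ∀ s ∈ Icc 0 t, HasDerivWithinAt (fun s => T (γ s) - c * s) 0 (Icc 0 t) s := by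
    intro s hs
    have h1 : HasMFDerivAt I 𝓘(ℝ, ℝ) T (γ s) (differential I T (γ s)) :=
      ((h.smooth_T (γ s)).mdifferentiableAt (by simp)).hasMFDerivAt
    have h2 : HasFDerivWithinAt (fun s => T (γ s))
        ((differential I T (γ s)).comp ((1 : ℝ →L[ℝ] ℝ).smulRight (X (γ s))) : ℝ →L[ℝ] ℝ)
        (Icc 0 t) s := (h1.comp_hasMFDerivWithinAt s (hγ s hs)).hasFDerivWithinAt
    have h3 : HasDerivWithinAt (fun s => T (γ s)) c (Icc 0 t) s := by
      refine h2.hasDerivWithinAt.congr_deriv ?_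
      refine Eq.trans ?_ (h.clock (γ s))
      exact congrArg (differential I T (γ s)) (one_smul ℝ _)
    exact (h3.fun_sub ((hasDerivAt_id s).const_mul c).hasDerivWithinAt).congr_deriv (by simp)
  have := constant_of_derivWithin_zero (fun s hs => (hd s hs).differentiableWithinAt)
    (fun s hs => by
      have hs' := Ico_subset_Icc_self hs
      exact (hd s hs').derivWithin (uniqueDiffOn_Icc (hs.1.trans_lt hs.2) s hs')) t ⟨ht, le_rfl⟩
  simp only [mul_zero, sub_zero] at this
  linarith

theorem PresymplecticSystem.clock_of_reach (h : PresymplecticSystem V X Ω K T c)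
    (hT : ∀ z ∈ S, T (Δ z) = T z) {N : ℕ} {t : ℝ} {x y : M} (hr : CountedReach X S Δ N t x y) :
    T y = T x + c * t := by
  induction hr with
  | flow ht hγ hS hx hy => rw [← hx, ← hy]; exact h.clock_of_curve hγ ht
  | jump hs hγ hS hx hz hmem ht hu hy ih =>
    rw [ih, hT _ hmem, ← hz, h.clock_of_curve hγ hs, hx, hu]; ring

end Regular
end

noncomputable section

set_option linter.unusedSectionVars false

/-! ### Hitting times -/

section Hitting

universe u
variable {E : Type u} [NormedAddCommGroup E] [NormedSpace ℝ E] [FiniteDimensional ℝ E]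
  {H : Type*} [TopologicalSpace H] {I : ModelWithCorners ℝ E H} [I.Boundaryless]
  {M : Type*} [TopologicalSpace M] [ChartedSpace H M] [IsManifold I ∞ M]
  {X : (z : M) → TangentSpace I z}

theorem hasDerivWithinAt_comp_integralCurve {g : M → ℝ} {γ : ℝ → M} {s : Set ℝ} {t : ℝ}
    (hg : MDifferentiableAt I 𝓘(ℝ, ℝ) g (γ t)) (hγ : IsMIntegralCurveOn (I := I) γ X s)
    (ht : t ∈ s) :
    HasDerivWithinAt (fun t => g (γ t)) (differential I g (γ t) (X (γ t))) s t := by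
  have h1 : HasMFDerivAt I 𝓘(ℝ, ℝ) g (γ t) (differential I g (γ t)) := hg.hasMFDerivAt
  have h2 : HasFDerivWithinAt (fun s => g (γ s))
      ((differential I g (γ t)).comp ((1 : ℝ →L[ℝ] ℝ).smulRight (X (γ t))) : ℝ →L[ℝ] ℝ)
      s t := (h1.comp_hasMFDerivWithinAt t (hγ t ht)).hasFDerivWithinAt
  refine h2.hasDerivWithinAt.congr_deriv ?_
  exact congrArg (differential I g (γ t)) (one_smul ℝ _)

/-- Implicit function theorem for g(Φ(s, w)) = 0, solved for the time `s`; the partial derivative in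
`s` is the nonzero number `a`. -/
theorem exists_hittingTime {Φ : ℝ × M → M} {z : M} {g : M → ℝ} {a : ℝ}
    (hΦ : ContMDiffAt (𝓘(ℝ, ℝ).prod I) I ∞ Φ (0, z)) (hΦz : Φ (0, z) = z)
    (hg : ContMDiffAt I 𝓘(ℝ, ℝ) ∞ g z) (hgz : g z = 0)
    (hd : HasDerivAt (fun s => g (Φ (s, z))) a 0) (ha : a ≠ 0) :
    ∃ τ : M → ℝ, ContMDiffAt I 𝓘(ℝ, ℝ) ∞ τ z ∧ τ z = 0 ∧ ∀ᶠ w in 𝓝 z, g (Φ (τ w, w)) = 0 := by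
  set e := extChartAt I z
  have hsymm : e.symm (e z) = z := extChartAt_to_inv (I := I) z
  let f : E × ℝ → ℝ := fun x => g (Φ (x.2, e.symm x.1))
  have hpair : ContMDiffAt 𝓘(ℝ, E × ℝ) (𝓘(ℝ, ℝ).prod I) ∞
      (fun x : E × ℝ => (x.2, e.symm x.1)) (e z, 0) := by
    have h1 : ContMDiffAt 𝓘(ℝ, E) I ∞ e.symm (e z) :=
      (contMDiffOn_extChartAt_symm z).contMDiffAt
        (extChartAt_target_mem_nhds_of_boundaryless z (mem_extChartAt_target z))
    exact contDiffAt_snd.contMDiffAt.prodMk (h1.comp (e z, 0) contDiffAt_fst.contMDiffAt)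
  have hf : ContDiffAt ℝ ∞ f (e z, 0) := by
    rw [← contMDiffAt_iff_contDiffAt]
    refine ContMDiffAt.comp (g := g) (I' := I) _ (by rwa [hsymm, hΦz]) ?_
    exact ContMDiffAt.comp (g := Φ) _ (by simpa only [hsymm] using hΦ) hpair
  have hfd : HasDerivAt (fun s => f (e z, s)) a 0 := by
    simpa only [f, hsymm] using hd
  have hval : (fderiv ℝ f (e z, 0) ∘L .inr ℝ E ℝ) 1 = a := by
    have h1 := ((hf.differentiableAt (by simp)).hasFDerivAt.comp (0 : ℝ)
      (hasFDerivAt_prodMk_right (e z) (0 : ℝ))).hasDerivAt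
    exact h1.unique hfd
  have hinv : (fderiv ℝ f (e z, 0) ∘L .inr ℝ E ℝ).IsInvertible := by
    refine ⟨ContinuousLinearEquiv.unitsEquivAut ℝ (Units.mk0 a ha), ?_⟩
    ext
    rw [hval]
    simp
  let ψ := hf.implicitFunction (by simp) hinv
  have hψ0 : ψ (e z) = 0 := hf.implicitFunction_apply_self (by simp) hinv
  refine ⟨fun w => ψ (e w), ?_, hψ0, ?_⟩
  · exact ContMDiffAt.comp (g := ψ) z
      (hf.contDiffAt_implicitFunction (by simp) hinv).contMDiffAt contMDiffAt_extChartAt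
  · have h1 := hf.eventually_apply_implicitFunction (by simp) hinv
    have hf0 : f (e z, 0) = 0 := by simp only [f]; rw [hsymm, hΦz, hgz]
    filter_upwards [(continuousAt_extChartAt (I := I) z).eventually h1,
      extChartAt_source_mem_nhds (I := I) z] with w hw hws
    rw [hf0] at hw
    change g (Φ (ψ (e w), e.symm (e w))) = 0 at hw
    rwa [show e.symm (e w) = w from e.left_inv hws] at hw

/-- At time zero the space derivative of Φ is the identity and its time derivative is `x₀`; the
chain rule adds the two contributions. This serves both the projection to the guard and the flow
back after the reset. -/
theorem hasMFDerivAt_flow_comp {Φ : ℝ × M → M} {σ : M → ℝ} {R : M → M} {a : M} {x₀ : E}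
    (hΦ : MDifferentiableAt (𝓘(ℝ, ℝ).prod I) I Φ (0, R a)) (hid : ∀ᶠ w in 𝓝 (R a), Φ (0, w) = w)
    (hx₀ : HasMFDerivAt 𝓘(ℝ, ℝ) I (fun s => Φ (s, R a)) 0
      (((1 : ℝ →L[ℝ] ℝ).smulRight x₀ : ℝ →L[ℝ] E)))
    (hσa : σ a = 0) {σ' : E →L[ℝ] ℝ} {R' : E →L[ℝ] E} (hσ : HasMFDerivAt I 𝓘(ℝ, ℝ) σ a σ')
    (hR : HasMFDerivAt I I R a R') :
    HasMFDerivAt I I (fun n => Φ (σ n, R n)) a (R' + σ'.smulRight x₀ : E →L[ℝ] E) := by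
  rw [← hσa] at hΦ hid hx₀
  have hpair : HasMFDerivAt I (𝓘(ℝ, ℝ).prod I) (fun n => (σ n, R n)) a (σ'.prod R') :=
    hσ.prodMk hR
  let L : ℝ × E →L[ℝ] E := mfderiv (𝓘(ℝ, ℝ).prod I) I Φ (σ a, R a)
  have hL : HasMFDerivAt (𝓘(ℝ, ℝ).prod I) I Φ (σ a, R a) L := hΦ.hasMFDerivAt
  have h1 : ∀ r : ℝ, L (r, 0) = r • x₀ := by
    have h2 : HasMFDerivAt 𝓘(ℝ, ℝ) (𝓘(ℝ, ℝ).prod I) (fun s : ℝ => (s, R a)) (σ a)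
        ((ContinuousLinearMap.id ℝ ℝ).prod (0 : ℝ →L[ℝ] E)) :=
      (hasMFDerivAt_id _).prodMk (hasMFDerivAt_const (c := R a) (x := σ a))
    have h3 := hasMFDerivAt_unique (HasMFDerivAt.comp (σ a) (f := fun s : ℝ => (s, R a)) hL h2) hx₀
    intro r
    exact congrArg (fun L : ℝ →L[ℝ] E => L r) h3
  have h2 : ∀ b : E, L (0, b) = b := by
    have h2 : HasMFDerivAt I (𝓘(ℝ, ℝ).prod I) (fun w : M => (σ a, w)) (R a)
        ((0 : E →L[ℝ] ℝ).prod (ContinuousLinearMap.id ℝ E)) :=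
      (hasMFDerivAt_const (c := σ a) (x := R a)).prodMk (hasMFDerivAt_id _)
    have h4 : HasMFDerivAt I I (fun w => Φ (σ a, w)) (R a) (ContinuousLinearMap.id ℝ E) :=
      (hasMFDerivAt_id (R a)).congr_of_eventuallyEq hid
    have h3 := hasMFDerivAt_unique (HasMFDerivAt.comp (R a) (f := fun w : M => (σ a, w)) hL h2) h4
    intro b
    exact congrArg (fun L : E →L[ℝ] E => L b) h3
  have h3 : L.comp (σ'.prod R') = R' + σ'.smulRight x₀ := by
    ext v
    have : L (σ' v, R' v) = L (σ' v, 0) + L (0, R' v) := by rw [← map_add]; simp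
    simp [this, h1, h2, add_comm]
  rw [← h3]
  exact HasMFDerivAt.comp a (f := fun n => (σ n, R n)) hL hpair

end Hitting
end

noncomputable section

set_option linter.unusedSectionVars false

/-! ### Linear algebra of an impact -/

section TwoForm

variable {V : Type*} [AddCommGroup V] [Module ℝ V]

theorem twoForm_swap (η : V [⋀^Fin 2]→ₗ[ℝ] ℝ) (u v : V) : η ![u, v] = -η ![v, u] := by
  have := η.map_swap ![v, u] (i := 0) (j := 1) (by simp)
  rw [← this]
  congr 1
  ext i
  fin_cases i <;> rfl

/-- A 2-form as a bilinear form. -/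
def twoFormBilin (η : V [⋀^Fin 2]→ₗ[ℝ] ℝ) : V →ₗ[ℝ] V →ₗ[ℝ] ℝ :=
  LinearMap.mk₂ ℝ (fun u v => η ![u, v]) (fun u u' v => η.map_vecCons_add _ u u')
    (fun a u v => η.map_vecCons_smul _ a u)
    (fun u v v' => by
      rw [twoForm_swap η u, twoForm_swap η u v, twoForm_swap η u v', η.map_vecCons_add, neg_add])
    (fun a u v => by
      rw [twoForm_swap η u, twoForm_swap η u v, η.map_vecCons_smul, smul_neg])

theorem twoFormBilin_apply (η : V [⋀^Fin 2]→ₗ[ℝ] ℝ) (u v : V) :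
    twoFormBilin η u v = η ![u, v] := rfl

theorem twoFormBilin_swap (η : V [⋀^Fin 2]→ₗ[ℝ] ℝ) (u v : V) :
    twoFormBilin η u v = -twoFormBilin η v u := twoForm_swap η u v

theorem twoFormBilin_self (η : V [⋀^Fin 2]→ₗ[ℝ] ℝ) (u : V) : twoFormBilin η u u = 0 := by
  have := twoFormBilin_swap η u u
  linarith

/-- If `D` respects the forms on the kernel of `γ`, the vector `x'` is not in the kernel of
`γ'`. -/
theorem transversal_of_reset [FiniteDimensional ℝ V] {η η' : V [⋀^Fin 2]→ₗ[ℝ] ℝ}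
    {k k' θ θ' γ γ' : V →ₗ[ℝ] ℝ} {x x' : V} {D : V →ₗ[ℝ] V} (hx : ∀ v, η ![x, v] = k v)
    (hx' : ∀ v, η' ![x', v] = k' v) (hθ : θ x = θ' x')
    (hnd : ∀ u, (∀ v, η ![u, v] = 0) → θ u = 0 → u = 0) (hγ : γ x ≠ 0) (hγ' : γ' ≠ 0)
    (hη : ∀ u v, γ u = 0 → γ v = 0 → η' ![D u, D v] = η ![u, v])
    (hk : ∀ u, γ u = 0 → k' (D u) = k u) (hθD : ∀ u, γ u = 0 → θ' (D u) = θ u)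
    (hγD : ∀ u, γ u = 0 → γ' (D u) = 0) : γ' x' ≠ 0 := by
  simp only [← twoFormBilin_apply] at *
  have hdec : ∀ v, ∃ (b : V) (r : ℝ), γ b = 0 ∧ v = b + r • x := fun v =>
    ⟨v - (γ v / γ x) • x, γ v / γ x, by simp [hγ], by simp⟩
  have hzero : ∀ u, twoFormBilin η u x = 0 → (∀ b, γ b = 0 → twoFormBilin η u b = 0) →
      θ u = 0 → u = 0 := by
    intro u h1 h2 h3
    refine hnd u (fun v => ?_) h3
    obtain ⟨b, r, hb, rfl⟩ := hdec v
    simp [h1, h2 b hb]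
  -- If `D a = 0` with `a` in the kernel of `γ`, then `η` pairs `a` to zero with that kernel by `hη`
  -- and with `x` by `hk`, and `θ a = 0` by `hθD`. As `x` and the kernel span, nondegeneracy gives
  -- `a = 0`.
  have hinj : Function.Injective (D.restrict (p := LinearMap.ker γ) (q := LinearMap.ker γ')
      fun u hu => hγD u hu) := by
    rw [← LinearMap.ker_eq_bot, LinearMap.ker_eq_bot']
    rintro ⟨a, ha⟩ h0
    have hDa : D a = 0 := congrArg Subtype.val h0
    have ha' : γ a = 0 := ha
    refine Subtype.ext (hzero a ?_ (fun b hb => ?_) ?_)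
    · rw [twoFormBilin_swap, hx, ← hk a ha', hDa, map_zero, neg_zero]
    · rw [← hη a b ha' hb, hDa]; simp
    · rw [← hθD a ha', hDa, map_zero]
  -- The two kernels have equal dimension, so `D` maps one onto the other, and a vector `x'` in the
  -- kernel of `γ'` would be `D a`. Then `a - x` lies in the common kernel of `η` and `θ`, so `a =
  -- x`, against `γ x ≠ 0`.
  intro h0
  have hdim : Module.finrank ℝ (LinearMap.ker γ) = Module.finrank ℝ (LinearMap.ker γ') := by
    have hne : γ ≠ 0 := fun h => hγ (by simp [h])
    have h1 := Module.Dual.finrank_ker_add_one_of_ne_zero hne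
    have h2 := Module.Dual.finrank_ker_add_one_of_ne_zero hγ'
    omega
  have hsurj := (LinearMap.injective_iff_surjective_of_finrank_eq_finrank hdim).1 hinj
  obtain ⟨⟨a, ha⟩, hax⟩ := hsurj ⟨x', h0⟩
  have hDa : D a = x' := congrArg Subtype.val hax
  have ha' : γ a = 0 := ha
  have hax : a - x = 0 := by
    refine hzero _ ?_ (fun b hb => ?_) ?_
    · rw [map_sub, LinearMap.sub_apply, twoFormBilin_self, twoFormBilin_swap, hx, ← hk a ha', hDa,
        ← hx', twoFormBilin_self]
      simp
    · rw [map_sub, LinearMap.sub_apply, ← hη a b ha' hb, hDa, hx', hk b hb, hx, sub_self]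
    · rw [map_sub, ← hθD a ha', hDa, hθ, sub_self]
  rw [sub_eq_zero.1 hax] at ha'
  exact hγ ha'

/-- On the projected vectors u + σ(u)x the forms agree. Projecting adds σ(u)k(v) - σ(v)k(u) to the
value on (u, v), and subtracting σ(u)x' and σ(v)x' afterwards removes the same amount, because k' ∘
D = k on the kernel of γ and k(x) = k'(x') = 0. -/
theorem jump_preserves {η η' : V [⋀^Fin 2]→ₗ[ℝ] ℝ} {k k' γ σ : V →ₗ[ℝ] ℝ} {x x' : V}
    {D : V →ₗ[ℝ] V} (hx : ∀ v, η ![x, v] = k v) (hx' : ∀ v, η' ![x', v] = k' v)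
    (hη : ∀ u v, γ u = 0 → γ v = 0 → η' ![D u, D v] = η ![u, v])
    (hk : ∀ u, γ u = 0 → k' (D u) = k u) (hσ : ∀ u, γ (u + σ u • x) = 0) (u v : V) :
    η' ![D (u + σ u • x) - σ u • x', D (v + σ v • x) - σ v • x'] = η ![u, v] := by
  simp only [← twoFormBilin_apply] at *
  have hx2 : ∀ v, twoFormBilin η v x = -k v := fun v => by rw [twoFormBilin_swap, hx]
  have hx2' : ∀ v, twoFormBilin η' v x' = -k' v := fun v => by rw [twoFormBilin_swap, hx']
  have hself : k x = 0 := by rw [← hx, twoFormBilin_self]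
  have hself' : k' x' = 0 := by rw [← hx', twoFormBilin_self]
  simp only [map_sub, LinearMap.sub_apply, map_smul, LinearMap.smul_apply, hx', hx2',
    hη _ _ (hσ u) (hσ v), hk _ (hσ u), hk _ (hσ v), hself', smul_eq_mul]
  simp only [map_add, LinearMap.add_apply, map_smul, LinearMap.smul_apply, hx, hx2, hself,
    smul_eq_mul]
  ring

end TwoForm
end

noncomputable section

set_option linter.unusedSectionVars false

/-! ### Impacts -/

section Impacts

universe u
variable {E : Type u} [NormedAddCommGroup E] [NormedSpace ℝ E] [FiniteDimensional ℝ E]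
  {H : Type*} [TopologicalSpace H] {I : ModelWithCorners ℝ E H} [I.Boundaryless]
  {M : Type*} [TopologicalSpace M] [ChartedSpace H M] [IsManifold I ∞ M]
  {V : Type*} [NormedAddCommGroup V] [NormedSpace ℝ V]
  {X : (z : M) → TangentSpace I z} {Ω : (z : M) → TangentSpace I z [⋀^Fin 2]→ₗ[ℝ] ℝ}
  {K T g : M → ℝ} {c : ℝ} {Δ : M → M}

/-- The value of a vector field as a vector of the model space. -/
def fieldVec (X : (z : M) → TangentSpace I z) (z : M) : E := X z

variable (I) in
/-- The differential of a function as a covector on the model space. -/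
def covector (f : M → ℝ) (z : M) : E →L[ℝ] ℝ := differential I f z

theorem IsSmoothField.continuous_differential (hX : IsSmoothField X)
    (hg : ContMDiff I 𝓘(ℝ, ℝ) ∞ g) : Continuous fun z => differential I g z (X z) := by
  rw [continuous_iff_continuousAt]
  intro z
  have h1 : ContinuousAt (fun y => fderiv ℝ (fun y => g ((extChartAt I z).symm y)) y
      (fieldInChart X z y)) (extChartAt I z z) := by
    have h2 : ContDiffAt ℝ ∞ (fun y => g ((extChartAt I z).symm y)) (extChartAt I z z) :=
      contDiffAt_chart le_rfl (hg z)
    have h3 : ContinuousAt (fderiv ℝ (fun y => g ((extChartAt I z).symm y))) (extChartAt I z z) :=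
      (h2.fderiv_right (m := 0) (by simp)).continuousAt
    exact h3.clm_apply (((hX.contDiffOn_fieldInChart z).continuousOn.continuousAt
      (extChartAt_target_mem_nhds_of_boundaryless z (mem_extChartAt_target z))))
  refine (h1.comp (f := extChartAt I z) (continuousAt_extChartAt z)).congr_of_eventuallyEq ?_
  filter_upwards [extChartAt_source_mem_nhds (I := I) z] with w hw
  have hy := (extChartAt I z).map_source hw
  have h2 := fderiv_chart_eq (f := g) (I := I) hy ((hg _).mdifferentiableAt (by simp))
    (fieldInChart X z (extChartAt I z w))
  rw [chartVector_fieldInChart hy, (extChartAt I z).left_inv hw] at h2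
  exact h2.symm

variable (V) in
/-- A presymplectic system with a reset that preserves the level set of `g`, the functions `K` and
`T` and satisfies the specular condition for `Ω`. -/
structure PresymplecticImpact (X : (z : M) → TangentSpace I z)
    (Ω : (z : M) → TangentSpace I z [⋀^Fin 2]→ₗ[ℝ] ℝ) (K T : M → ℝ) (c : ℝ) (g : M → ℝ)
    (Δ : M → M) : Prop where
  system : PresymplecticSystem V X Ω K T c
  smooth_g : ContMDiff I 𝓘(ℝ, ℝ) ∞ g
  regular_g : ∀ z, g z = 0 → differential I g z ≠ 0
  smooth_reset : ContMDiffOn I I ∞ Δ (outwardGuard I X g)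
  disjoint : Disjoint (outwardGuard I X g) (Δ '' outwardGuard I X g)
  reset_g : ∀ z ∈ outwardGuard I X g, g (Δ z) = 0
  reset_K : ∀ z ∈ outwardGuard I X g, K (Δ z) = K z
  reset_T : ∀ z ∈ outwardGuard I X g, T (Δ z) = T z
  specular : ResetPullbackEq I (outwardGuard I X g) Δ Ω

theorem tangentBundle_mk_eq {z z' : M} (h : z = z') {v v' : E} (hv : v = v') :
    (⟨z, v⟩ : TangentBundle I M) = ⟨z', v'⟩ := by
  subst h; subst hv; rfl

/-- The flow projects a neighbourhood of a point of the guard to the guard. -/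
theorem PresymplecticSystem.exists_guardProjection (h : PresymplecticSystem V X Ω K T c)
    (hg : ContMDiff I 𝓘(ℝ, ℝ) ∞ g) {z : M} (hz : z ∈ outwardGuard I X g) {Φ : ℝ × M → M}
    (hΦ : ContMDiffAt (𝓘(ℝ, ℝ).prod I) I ∞ Φ (0, z)) {δ : ℝ} (hδ : 0 < δ) {W : Set M}
    (hW : W ∈ 𝓝 z) (hflow : ∀ w ∈ W, Φ (0, w) = w ∧
      IsMIntegralCurveOn (I := I) (fun s => Φ (s, w)) X (Ioo (-δ) δ)) :
    ∃ (τ : M → ℝ) (τ' : E →L[ℝ] ℝ), ContMDiffAt I 𝓘(ℝ, ℝ) ∞ τ z ∧ τ z = 0 ∧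
      HasMFDerivAt I 𝓘(ℝ, ℝ) τ z τ' ∧
      ContMDiffAt I I ∞ (fun w => Φ (τ w, w)) z ∧
      (∀ᶠ w in 𝓝 z, Φ (τ w, w) ∈ outwardGuard I X g) ∧
      HasMFDerivAt I I (fun w => Φ (τ w, w)) z
        (ContinuousLinearMap.id ℝ E + τ'.smulRight (fieldVec X z) : E →L[ℝ] E) ∧
      ∀ v : E, covector I g z (v + τ' v • fieldVec X z) = 0 := by
  have h0 : (0 : ℝ) ∈ Ioo (-δ) δ := ⟨by linarith, hδ⟩
  obtain ⟨hΦz, hcurve⟩ := hflow z (mem_of_mem_nhds hW)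
  have hd : HasDerivAt (fun s => g (Φ (s, z)))
      (differential I g (Φ (0, z)) (X (Φ (0, z)))) 0 :=
    (hasDerivWithinAt_comp_integralCurve ((hg _).mdifferentiableAt (by simp)) hcurve h0).hasDerivAt
      (isOpen_Ioo.mem_nhds h0)
  rw [hΦz] at hd
  obtain ⟨τ, hτ, hτ0, hτg⟩ := exists_hittingTime hΦ hΦz (hg z) hz.1 hd hz.2.ne'
  have hpair : ContMDiffAt I (𝓘(ℝ, ℝ).prod I) ∞ (fun w => (τ w, w)) z := hτ.prodMk contMDiffAt_id
  have hP : ContMDiffAt I I ∞ (fun w => Φ (τ w, w)) z :=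
    ContMDiffAt.comp (g := Φ) z (by simpa only [hτ0] using hΦ) hpair
  have hPz : Φ (τ z, z) = z := by rw [hτ0, hΦz]
  have hτ' := (hτ.mdifferentiableAt (by simp)).hasMFDerivAt
  have hcz : HasMFDerivAt 𝓘(ℝ, ℝ) I (fun s => Φ (s, z)) 0
      (((1 : ℝ →L[ℝ] ℝ).smulRight (fieldVec X z) : ℝ →L[ℝ] E)) := by
    have h1 := (hcurve 0 h0).hasMFDerivAt (isOpen_Ioo.mem_nhds h0)
    have h2 : fieldVec X (Φ (0, z)) = fieldVec X z := by rw [hΦz]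
    rw [← h2]
    exact h1
  have hP' : HasMFDerivAt I I (fun w => Φ (τ w, w)) z
      (ContinuousLinearMap.id ℝ E +
        (covector I τ z).smulRight (fieldVec X z) : E →L[ℝ] E) :=
    hasMFDerivAt_flow_comp (R := id) (hΦ.mdifferentiableAt (by simp))
      (by filter_upwards [hW] with w hw using (hflow w hw).1) hcz hτ0 hτ' (hasMFDerivAt_id z)
  refine ⟨τ, covector I τ z, hτ, hτ0, hτ', hP, ?_, hP', ?_⟩
  · have h1 : ∀ᶠ w in 𝓝 z, 0 < differential I g w (X w) :=
      (h.isSmoothField.continuous_differential hg).continuousAt.eventually (lt_mem_nhds hz.2)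
    have h2 : Tendsto (fun w => Φ (τ w, w)) (𝓝 z) (𝓝 z) := by
      have := hP.continuousAt
      rwa [ContinuousAt, hPz] at this
    filter_upwards [hτg, h2.eventually h1] with w h3 h4 using ⟨h3, h4⟩
  -- Since `g` vanishes identically after the projection, the derivative of the projection takes its
  -- values in the kernel of dg.
  · have h1 : HasMFDerivAt I 𝓘(ℝ, ℝ) g (Φ (τ z, z)) (differential I g (Φ (τ z, z))) :=
      ((hg _).mdifferentiableAt (by simp)).hasMFDerivAt
    have h2 := HasMFDerivAt.comp (g := g) z h1 hP'
    have h3 : HasMFDerivAt I 𝓘(ℝ, ℝ) (fun w => g (Φ (τ w, w))) z (0 : E →L[ℝ] ℝ) :=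
      (hasMFDerivAt_const (c := (0 : ℝ)) (x := z)).congr_of_eventuallyEq hτg
    have h4 := hasMFDerivAt_unique h2 h3
    intro v
    have h5 : covector I g (Φ (τ z, z)) = covector I g z := by rw [hPz]
    rw [← h5]
    exact congrArg (fun L : E →L[ℝ] ℝ => L v) h4

end Impacts
end

noncomputable section

set_option linter.unusedSectionVars false

/-! ### The jump map -/

section Jump

universe u
variable {E : Type u} [NormedAddCommGroup E] [NormedSpace ℝ E] [FiniteDimensional ℝ E]
  {H : Type*} [TopologicalSpace H] {I : ModelWithCorners ℝ E H} [I.Boundaryless]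
  {M : Type*} [TopologicalSpace M] [ChartedSpace H M] [IsManifold I ∞ M]
  {V : Type*} [NormedAddCommGroup V] [NormedSpace ℝ V]
  {X : (z : M) → TangentSpace I z} {Ω : (z : M) → TangentSpace I z [⋀^Fin 2]→ₗ[ℝ] ℝ}
  {K T g : M → ℝ} {c : ℝ} {Δ : M → M}

variable (I) in
/-- The derivative of a reset as an operator on the model space. -/
def resetDeriv (Δ : M → M) (S : Set M) (z : M) : E →L[ℝ] E := mfderivWithin I I Δ S z

/-- A 2-form at a point, as a form on the model space. -/
def formVec (Ω : (z : M) → TangentSpace I z [⋀^Fin 2]→ₗ[ℝ] ℝ) (z : M) : E [⋀^Fin 2]→ₗ[ℝ] ℝ := Ω z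

theorem hasMFDerivAt_covector {f : M → ℝ} {z : M} (hf : MDifferentiableAt I 𝓘(ℝ, ℝ) f z) :
    HasMFDerivAt I 𝓘(ℝ, ℝ) f z (covector (E := E) I f z) := hf.hasMFDerivAt

/-- The reset has a derivative only within the guard. After a map that lands in the guard near `a`
the chain rule holds within a full neighbourhood, so the composition is differentiable in the
ordinary sense. -/
theorem hasMFDerivAt_reset_comp {S : Set M} (hΔ : ContMDiffOn I I ∞ Δ S) {N : Type*}
    {E' : Type*} [NormedAddCommGroup E'] [NormedSpace ℝ E'] {H' : Type*} [TopologicalSpace H']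
    {I' : ModelWithCorners ℝ E' H'} [TopologicalSpace N] [ChartedSpace H' N] {P : N → M} {a : N}
    {P' : E' →L[ℝ] E} (hP : HasMFDerivAt I' I P a P') (hPS : ∀ᶠ w in 𝓝 a, P w ∈ S) :
    HasMFDerivAt I' I (fun w => Δ (P w)) a
      ((resetDeriv (E := E) I Δ S (P a)).comp P' : E' →L[ℝ] E) := by
  have h1 : HasMFDerivWithinAt I I Δ S (P a) (resetDeriv (E := E) I Δ S (P a)) :=
    ((hΔ (P a) hPS.self_of_nhds).mdifferentiableWithinAt (by simp)).hasMFDerivWithinAt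
  have h2 := HasMFDerivWithinAt.comp (g := Δ) (f := P) (s := P ⁻¹' S) a h1 hP.hasMFDerivWithinAt
    Subset.rfl
  exact h2.hasMFDerivAt hPS

theorem IsTangentTo.covector_eq_zero {z : M} {v : E} (hg : ContMDiff I 𝓘(ℝ, ℝ) ∞ g)
    (h : IsTangentTo I (outwardGuard I X g) z v) : covector I g z v = 0 := by
  obtain ⟨γ, hγ, hγS, heq⟩ := h
  have h1 := (hγ.mdifferentiableAt (by simp)).hasMFDerivAt
  have h2 := HasMFDerivAt.comp (g := g) 0
    (hasMFDerivAt_covector ((hg (γ 0)).mdifferentiableAt (by simp))) h1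
  have h3 : HasMFDerivAt 𝓘(ℝ, ℝ) 𝓘(ℝ, ℝ) (fun s => g (γ s)) 0 (0 : ℝ →L[ℝ] ℝ) :=
    (hasMFDerivAt_const (c := (0 : ℝ)) (x := (0 : ℝ))).congr_of_eventuallyEq
      (hγS.mono fun s hs => hs.1)
  have h4 := congrArg (fun L : ℝ →L[ℝ] ℝ => L 1) (hasMFDerivAt_unique h2 h3)
  have h5 : ∀ b : TangentBundle I M, b = ⟨z, v⟩ → covector I g b.1 b.2 = 0 →
      covector I g z v = 0 := by
    rintro b rfl h; exact h
  exact h5 _ heq h4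

/-- A coordinate line with velocity `v` is projected to the guard along the flow. The projected
curve has velocity v + τ'(v)X, and dg(v) = 0 with dg(X) > 0 forces τ'(v) = 0. Hence tangency to the
guard amounts to lying in the kernel of dg. -/
theorem PresymplecticSystem.isTangentTo_of_covector_eq_zero (h : PresymplecticSystem V X Ω K T c)
    (hg : ContMDiff I 𝓘(ℝ, ℝ) ∞ g) {z : M} (hz : z ∈ outwardGuard I X g) {v : E}
    (hv : covector I g z v = 0) : IsTangentTo I (outwardGuard I X g) z v := by
  obtain ⟨Φ, hΦ, δ, hδ, W, hW, hflow⟩ := h.isSmoothField.exists_localFlow z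
  obtain ⟨τ, τ', hτ, hτ0, hτ', hP, hPS, hP', hker⟩ := h.exists_guardProjection hg hz hΦ hδ hW hflow
  have hτv : τ' v = 0 := by
    have h1 := hker v
    rw [map_add, hv, zero_add, map_smul, smul_eq_mul] at h1
    exact (mul_eq_zero.1 h1).resolve_right hz.2.ne'
  set e := extChartAt I z
  have hsymm : e.symm (e z) = z := extChartAt_to_inv (I := I) z
  let w : E := mfderiv I 𝓘(ℝ, E) e z v
  let l : ℝ → M := fun s => e.symm (e z + s • w)
  have hl0 : l 0 = z := by simp only [l, zero_smul, add_zero, hsymm]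
  have hl : ContMDiffAt 𝓘(ℝ, ℝ) I ∞ l 0 := by
    have h1 : ContMDiffAt 𝓘(ℝ, E) I ∞ e.symm (e z + (0 : ℝ) • w) := by
      rw [zero_smul, add_zero]
      exact (contMDiffOn_extChartAt_symm z).contMDiffAt
        (extChartAt_target_mem_nhds_of_boundaryless z (mem_extChartAt_target z))
    have h2 : ContDiffAt ℝ ∞ (fun s : ℝ => e z + s • w) 0 := by fun_prop
    exact h1.comp 0 h2.contMDiffAt
  have hl' : HasMFDerivAt 𝓘(ℝ, ℝ) I l 0 ((1 : ℝ →L[ℝ] ℝ).smulRight v : ℝ →L[ℝ] E) := by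
    have h1 : HasMFDerivAt 𝓘(ℝ, E) I e.symm (e z + (0 : ℝ) • w)
        (mfderiv 𝓘(ℝ, E) I e.symm (e z) : E →L[ℝ] E) := by
      rw [zero_smul, add_zero]
      exact hasMFDerivAt_extChartAt_symm (mem_extChartAt_target z)
    have h2 : HasFDerivAt (fun s : ℝ => e z + s • w) ((1 : ℝ →L[ℝ] ℝ).smulRight w) 0 :=
      ((hasFDerivAt_id (0 : ℝ)).smul_const w).const_add (e z)
    have h3 := HasMFDerivAt.comp (0 : ℝ) h1 h2.hasMFDerivAt
    let A : E →L[ℝ] E := mfderiv 𝓘(ℝ, E) I e.symm (e z)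
    have h4 : A w = v :=
      mfderiv_extChartAt_symm_mfderiv_extChartAt (mem_extChartAt_source z) v
    have h5 : A.comp ((1 : ℝ →L[ℝ] ℝ).smulRight w) =
        ((1 : ℝ →L[ℝ] ℝ).smulRight v : ℝ →L[ℝ] E) := by
      ext
      change A ((1 : ℝ) • w) = (1 : ℝ) • v
      rw [map_smul, h4]
    rw [← h5]
    exact h3
  refine ⟨fun s => Φ (τ (l s), l s), ?_, ?_, ?_⟩
  · exact ContMDiffAt.comp (g := fun w => Φ (τ w, w)) 0 (by rwa [hl0]) hl
  · have h1 := hl.continuousAt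
    rw [ContinuousAt, hl0] at h1
    exact h1.eventually hPS
  · have hP2 : HasMFDerivAt I I (fun w => Φ (τ w, w)) (l 0)
        (ContinuousLinearMap.id ℝ E + τ'.smulRight (fieldVec X z) : E →L[ℝ] E) := by
      rwa [hl0]
    have h2 := (HasMFDerivAt.comp (g := fun w => Φ (τ w, w)) (0 : ℝ) hP2 hl').mfderiv
    refine tangentBundle_mk_eq ?_ ?_
    · change Φ (τ (l 0), l 0) = z
      rw [hl0, hτ0]; exact (hflow z (mem_of_mem_nhds hW)).1
    · refine (congrArg (fun L : ℝ →L[ℝ] E => L 1) h2).trans ?_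
      change (ContinuousLinearMap.id ℝ E + τ'.smulRight (fieldVec X z)) ((1 : ℝ) • v) = v
      simp [hτv]

end Jump
end

noncomputable section

set_option linter.unusedSectionVars false

/-! ### Differential of the reset on the guard; inward motion and invariance of the form at an
impact. -/

section Jump

universe u
variable {E : Type u} [NormedAddCommGroup E] [NormedSpace ℝ E] [FiniteDimensional ℝ E]
  {H : Type*} [TopologicalSpace H] {I : ModelWithCorners ℝ E H} [I.Boundaryless]
  {M : Type*} [TopologicalSpace M] [ChartedSpace H M] [IsManifold I ∞ M]
  {V : Type*} [NormedAddCommGroup V] [NormedSpace ℝ V]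
  {X : (z : M) → TangentSpace I z} {Ω : (z : M) → TangentSpace I z [⋀^Fin 2]→ₗ[ℝ] ℝ}
  {K T g : M → ℝ} {c : ℝ} {Δ : M → M}

theorem PresymplecticImpact.specular_vec (h : PresymplecticImpact V X Ω K T c g Δ) {z : M}
    (hz : z ∈ outwardGuard I X g) {u v : E} (hu : covector I g z u = 0)
    (hv : covector I g z v = 0) :
    formVec Ω (Δ z) ![resetDeriv I Δ (outwardGuard I X g) z u,
      resetDeriv I Δ (outwardGuard I X g) z v] = formVec Ω z ![u, v] := by
  have h1 := h.specular z hz ![u, v] (by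
    intro i
    fin_cases i
    · exact h.system.isTangentTo_of_covector_eq_zero h.smooth_g hz hu
    · exact h.system.isTangentTo_of_covector_eq_zero h.smooth_g hz hv)
  refine Eq.trans ?_ h1
  refine congrArg (formVec Ω (Δ z)) ?_
  funext i
  fin_cases i <;> rfl

/-- The identity f ∘ Δ = f is differentiated along a curve in the guard with velocity `v`. It is
applied to `K`, to `T` and to `g` itself. -/
theorem PresymplecticImpact.reset_covector (h : PresymplecticImpact V X Ω K T c g Δ) {f : M → ℝ}
    (hf : ContMDiff I 𝓘(ℝ, ℝ) ∞ f) (hfΔ : ∀ w ∈ outwardGuard I X g, f (Δ w) = f w) {z : M}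
    (hz : z ∈ outwardGuard I X g) {v : E} (hv : covector I g z v = 0) :
    covector I f (Δ z) (resetDeriv I Δ (outwardGuard I X g) z v) = covector I f z v := by
  obtain ⟨γ, hγ, hγS, heq⟩ := h.system.isTangentTo_of_covector_eq_zero h.smooth_g hz hv
  have h1 := (hγ.mdifferentiableAt (by simp)).hasMFDerivAt
  have h2 := hasMFDerivAt_reset_comp h.smooth_reset h1 hγS
  have h3 := HasMFDerivAt.comp (g := f) 0
    (hasMFDerivAt_covector ((hf (Δ (γ 0))).mdifferentiableAt (by simp))) h2
  have h4 := HasMFDerivAt.comp (g := f) 0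
    (hasMFDerivAt_covector ((hf (γ 0)).mdifferentiableAt (by simp))) h1
  have h5 : (fun s => f (Δ (γ s))) =ᶠ[𝓝 0] fun s => f (γ s) := hγS.mono fun s hs => hfΔ _ hs
  have h6 := congrArg (fun L : ℝ →L[ℝ] ℝ => L 1)
    (hasMFDerivAt_unique h3 (h4.congr_of_eventuallyEq h5))
  have h7 : ∀ b : TangentBundle I M, b = ⟨z, v⟩ →
      covector I f (Δ b.1) (resetDeriv I Δ (outwardGuard I X g) b.1 b.2) = covector I f b.1 b.2 →
      covector I f (Δ z) (resetDeriv I Δ (outwardGuard I X g) z v) = covector I f z v := by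
    rintro b rfl h; exact h
  exact h7 _ heq h6

/-- After a reset the system points inwards. -/
theorem PresymplecticImpact.covector_reset_neg (h : PresymplecticImpact V X Ω K T c g Δ) {z : M}
    (hz : z ∈ outwardGuard I X g) : differential I g (Δ z) (X (Δ z)) < 0 := by
  have hne : covector I g (Δ z) (fieldVec X (Δ z)) ≠ 0 :=
    transversal_of_reset (η := formVec Ω z) (η' := formVec Ω (Δ z))
      (k := (covector I K z).toLinearMap) (k' := (covector I K (Δ z)).toLinearMap)
      (θ := (covector I T z).toLinearMap) (θ' := (covector I T (Δ z)).toLinearMap)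
      (γ := (covector I g z).toLinearMap) (γ' := (covector I g (Δ z)).toLinearMap)
      (x := fieldVec X z) (x' := fieldVec X (Δ z))
      (D := (resetDeriv I Δ (outwardGuard I X g) z).toLinearMap)
      (fun v => h.system.hamilton z v) (fun v => h.system.hamilton (Δ z) v)
      ((h.system.clock z).trans (h.system.clock (Δ z)).symm)
      (fun u => h.system.nondegenerate z u) hz.2.ne'
      (fun h0 => h.regular_g _ (h.reset_g z hz)
        (ContinuousLinearMap.ext fun v => congrArg (fun L : E →ₗ[ℝ] ℝ => L v) h0))
      (fun u v hu hv => h.specular_vec hz hu hv)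
      (fun u hu => h.reset_covector h.system.smooth_K h.reset_K hz hu)
      (fun u hu => h.reset_covector h.system.smooth_T h.reset_T hz hu)
      (fun u hu => (h.reset_covector h.smooth_g
        (fun w hw => (h.reset_g w hw).trans hw.1.symm) hz hu).trans hu)
  -- A positive value would put `Δ z` on the guard, which the image of the reset does not meet.
  refine lt_of_le_of_ne (not_lt.1 fun hlt => ?_) hne
  exact h.disjoint.le_bot ⟨⟨h.reset_g z hz, hlt⟩, mem_image_of_mem Δ hz⟩

theorem ContMDiffOn.comp_eventually {S : Set M} (hΔ : ContMDiffOn I I ∞ Δ S) {P : M → M} {a : M}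
    (hP : ContMDiffAt I I ∞ P a) (hPS : ∀ᶠ w in 𝓝 a, P w ∈ S) :
    ContMDiffAt I I ∞ (fun w => Δ (P w)) a :=
  ((hΔ (P a) hPS.self_of_nhds).comp (s := P ⁻¹' S) a hP.contMDiffWithinAt
    (fun _ hw => hw)).contMDiffAt hPS

/-- The jump map: flow to the guard, reset, and flow back for the same time. -/
theorem PresymplecticImpact.exists_jump (h : PresymplecticImpact V X Ω K T c g Δ) {z : M}
    (hz : z ∈ outwardGuard I X g) {Φ Φ' : ℝ × M → M}
    (hΦ : ContMDiffAt (𝓘(ℝ, ℝ).prod I) I ∞ Φ (0, z)) {δ : ℝ} (hδ : 0 < δ) {W : Set M}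
    (hW : W ∈ 𝓝 z) (hflow : ∀ w ∈ W, Φ (0, w) = w ∧
      IsMIntegralCurveOn (I := I) (fun s => Φ (s, w)) X (Ioo (-δ) δ))
    (hΦ' : ContMDiffAt (𝓘(ℝ, ℝ).prod I) I ∞ Φ' (0, Δ z)) {δ' : ℝ} (hδ' : 0 < δ') {W' : Set M}
    (hW' : W' ∈ 𝓝 (Δ z)) (hflow' : ∀ w ∈ W', Φ' (0, w) = w ∧
      IsMIntegralCurveOn (I := I) (fun s => Φ' (s, w)) X (Ioo (-δ') δ')) :
    ∃ τ : M → ℝ, ContinuousAt τ z ∧ τ z = 0 ∧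
      (∀ᶠ w in 𝓝 z, Φ (τ w, w) ∈ outwardGuard I X g) ∧
      ContinuousAt (fun w => Δ (Φ (τ w, w))) z ∧
      ContMDiffAt I I 1 (fun w => Φ' (-τ w, Δ (Φ (τ w, w)))) z ∧
      PullsBackAt Ω (fun w => Φ' (-τ w, Δ (Φ (τ w, w)))) z := by
  obtain ⟨τ, τ', hτ, hτ0, hτ', hP, hPS, hP', hker⟩ :=
    h.system.exists_guardProjection h.smooth_g hz hΦ hδ hW hflow
  have hΦz : Φ (0, z) = z := (hflow z (mem_of_mem_nhds hW)).1
  obtain ⟨hΦz', hcurve'⟩ := hflow' (Δ z) (mem_of_mem_nhds hW')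
  have hPz : Φ (τ z, z) = z := by rw [hτ0, hΦz]
  have hΔP := ContMDiffOn.comp_eventually h.smooth_reset hP hPS
  have hJz : Φ' (-τ z, Δ (Φ (τ z, z))) = Δ z := by rw [hPz, hτ0, neg_zero, hΦz']
  refine ⟨τ, hτ.continuousAt, hτ0, hPS, hΔP.continuousAt, ?_, ?_⟩
  · have hpair : ContMDiffAt I (𝓘(ℝ, ℝ).prod I) ∞ (fun w => (-τ w, Δ (Φ (τ w, w)))) z :=
      (ContMDiffAt.comp (g := fun r : ℝ => -r) z contDiff_neg.contDiffAt.contMDiffAt hτ).prodMk hΔP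
    exact (ContMDiffAt.comp (g := Φ') z (by rwa [hPz, hτ0, neg_zero]) hpair).of_le (by simp)
  · have h0 : (0 : ℝ) ∈ Ioo (-δ') δ' := ⟨by linarith, hδ'⟩
    let D : E →L[ℝ] E := resetDeriv I Δ (outwardGuard I X g) z
    have hR : HasMFDerivAt I I (fun w => Δ (Φ (τ w, w))) z
        (D.comp (ContinuousLinearMap.id ℝ E + τ'.smulRight (fieldVec X z)) : E →L[ℝ] E) := by
      have h1 := hasMFDerivAt_reset_comp h.smooth_reset hP' hPS
      rwa [hPz] at h1
    have hcz : HasMFDerivAt 𝓘(ℝ, ℝ) I (fun s => Φ' (s, Δ z)) 0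
        (((1 : ℝ →L[ℝ] ℝ).smulRight (fieldVec X (Δ z)) : ℝ →L[ℝ] E)) := by
      have h1 := (hcurve' 0 h0).hasMFDerivAt (isOpen_Ioo.mem_nhds h0)
      have h2 : fieldVec X (Φ' (0, Δ z)) = fieldVec X (Δ z) := by rw [hΦz']
      rw [← h2]
      exact h1
    have hJ : HasMFDerivAt I I (fun w => Φ' (-τ w, Δ (Φ (τ w, w)))) z
        (D.comp (ContinuousLinearMap.id ℝ E + τ'.smulRight (fieldVec X z)) +
          (-τ').smulRight (fieldVec X (Δ z)) : E →L[ℝ] E) := by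
      refine hasMFDerivAt_flow_comp (Φ := Φ') (σ := fun w => -τ w)
        (R := fun w => Δ (Φ (τ w, w))) (x₀ := fieldVec X (Δ z)) ?_ ?_ ?_ ?_ ?_ hR
      · rw [hPz]; exact hΦ'.mdifferentiableAt (by simp)
      · rw [hPz]; filter_upwards [hW'] with w hw using (hflow' w hw).1
      · rw [hPz]; exact hcz
      · rw [hτ0, neg_zero]
      · exact hτ'.neg
    -- The first summand projects to the kernel of dg and applies the reset; the second comes from
    -- flowing back for time τ. This is the shape treated by `jump_preserves`.
    have hval : ∀ u : E, (mfderiv I I (fun w => Φ' (-τ w, Δ (Φ (τ w, w)))) z u : E) =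
        D (u + τ' u • fieldVec X z) - τ' u • fieldVec X (Δ z) := by
      intro u
      refine (congrArg (fun L : E →L[ℝ] E => L u) hJ.mfderiv).trans ?_
      simp [sub_eq_add_neg]
    intro u v
    refine (twoForm_apply_congr Ω hJz _ _).trans ?_
    refine Eq.trans ?_ (jump_preserves (η := formVec Ω z) (η' := formVec Ω (Δ z))
      (k := (covector I K z).toLinearMap) (k' := (covector I K (Δ z)).toLinearMap)
      (γ := (covector I g z).toLinearMap) (σ := τ'.toLinearMap)
      (x := fieldVec X z) (x' := fieldVec X (Δ z)) (D := D.toLinearMap)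
      (fun v => h.system.hamilton z v) (fun v => h.system.hamilton (Δ z) v)
      (fun u v hu hv => h.specular_vec hz hu hv)
      (fun u hu => h.reset_covector h.system.smooth_K h.reset_K hz hu) hker u v)
    exact congrArg₂ (fun a b : E => formVec Ω (Δ z) ![a, b]) (hval u) (hval v)

end Jump
end

noncomputable section

set_option linter.unusedSectionVars false

/-! ### Regularity of a single impact -/

section JumpRegular

universe u
variable {E : Type u} [NormedAddCommGroup E] [NormedSpace ℝ E] [FiniteDimensional ℝ E]
  {H : Type*} [TopologicalSpace H] {I : ModelWithCorners ℝ E H} [I.Boundaryless]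
  {M : Type*} [TopologicalSpace M] [ChartedSpace H M] [IsManifold I ∞ M]
  {V : Type*} [NormedAddCommGroup V] [NormedSpace ℝ V]
  {X : (z : M) → TangentSpace I z} {Ω : (z : M) → TangentSpace I z [⋀^Fin 2]→ₗ[ℝ] ℝ}
  {K T g : M → ℝ} {c : ℝ} {Δ : M → M}

/-- `Φ` is the flow of `X` for times in `(-δ, δ)` on the open set `W`, with values in `O`. -/
structure IsFlowBox (X : (z : M) → TangentSpace I z)
    (Ω : (z : M) → TangentSpace I z [⋀^Fin 2]→ₗ[ℝ] ℝ) (Φ : ℝ × M → M) (δ : ℝ) (W O : Set M) :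
    Prop where
  pos : 0 < δ
  isOpen : IsOpen W
  zero : ∀ z ∈ W, Φ (0, z) = z
  curve : ∀ z ∈ W, IsMIntegralCurveOn (I := I) (fun s => Φ (s, z)) X (Ioo (-δ) δ)
  contMDiffAt : ∀ z ∈ W, ∀ s ∈ Ioo (-δ) δ, ContMDiffAt (𝓘(ℝ, ℝ).prod I) I 1 Φ (s, z)
  pullsBack : ∀ z ∈ W, ∀ s ∈ Ioo (-δ) δ, PullsBackAt Ω (fun z => Φ (s, z)) z
  mem : ∀ z ∈ W, ∀ s ∈ Ioo (-δ) δ, Φ (s, z) ∈ O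

theorem PresymplecticSystem.exists_flowBox (h : PresymplecticSystem V X Ω K T c) {z₀ : M}
    {O : Set M} (hO : O ∈ 𝓝 z₀) : ∃ Φ : ℝ × M → M, ContMDiffAt (𝓘(ℝ, ℝ).prod I) I ∞ Φ (0, z₀) ∧
      ∃ (δ : ℝ) (W : Set M), z₀ ∈ W ∧ IsFlowBox X Ω Φ δ W O := by
  obtain ⟨Φ, hΦ, δ₀, hδ₀, W₀, hW₀, hflow⟩ := h.exists_localFlow z₀
  have hΦ₀ : Φ (0, z₀) = z₀ := (hflow z₀ (mem_of_mem_nhds hW₀)).1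
  have h1 : ∀ᶠ x in 𝓝 ((0 : ℝ), z₀), Φ x ∈ O :=
    hΦ.continuousAt.eventually (by rw [hΦ₀]; exact hO)
  rw [nhds_prod_eq] at h1
  obtain ⟨pa, ha, pb, hb, hab⟩ := eventually_prod_iff.1 h1
  obtain ⟨δ₁, hδ₁, hball⟩ := Metric.eventually_nhds_iff.1 ha
  have hsub : Ioo (-min δ₀ δ₁) (min δ₀ δ₁) ⊆ Ioo (-δ₀) δ₀ :=
    Ioo_subset_Ioo (neg_le_neg (min_le_left _ _)) (min_le_left _ _)
  have hW : ∀ z ∈ interior (W₀ ∩ {z | pb z}), z ∈ W₀ := fun z hz => (interior_subset hz).1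
  refine ⟨Φ, hΦ, min δ₀ δ₁, interior (W₀ ∩ {z | pb z}),
    mem_interior_iff_mem_nhds.2 (inter_mem hW₀ hb), lt_min hδ₀ hδ₁, isOpen_interior,
    fun z hz => (hflow z (hW z hz)).1, fun z hz => (hflow z (hW z hz)).2.1.mono hsub,
    fun z hz s hs => ((hflow z (hW z hz)).2.2 s (hsub hs)).1,
    fun z hz s hs => ((hflow z (hW z hz)).2.2 s (hsub hs)).2, fun z hz s hs => ?_⟩
  refine hab (hball ?_) (interior_subset hz).2
  rw [Real.dist_eq, sub_zero, abs_lt]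
  exact ⟨by linarith [hs.1, min_le_right δ₀ δ₁], by linarith [hs.2, min_le_right δ₀ δ₁]⟩

namespace IsFlowBox

variable {Φ : ℝ × M → M} {δ : ℝ} {W O : Set M}

theorem add [T2Space M] (h : IsFlowBox X Ω Φ δ W O) (hX : IsSmoothField X) {z : M} (hz : z ∈ W)
    {s r : ℝ} (hs : s ∈ Ioo (-δ) δ) (hr : r ∈ Ioo (-δ) δ) (hsr : r + s ∈ Ioo (-δ) δ)
    (hsW : Φ (s, z) ∈ W) : Φ (r, Φ (s, z)) = Φ (r + s, z) := by
  have h1 : IsMIntegralCurveOn (I := I) (fun r => Φ (r, Φ (s, z))) X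
      (Ioo (max (-δ) (-δ - s)) (min δ (δ - s))) :=
    (h.curve _ hsW).mono (Ioo_subset_Ioo (le_max_left _ _) (min_le_left _ _))
  have h2 : IsMIntegralCurveOn (I := I) (fun r => Φ (r + s, z)) X
      (Ioo (max (-δ) (-δ - s)) (min δ (δ - s))) :=
    (h.curve z hz).shift s fun r hr => ⟨by linarith [(max_lt_iff.1 hr.1).2],
      by linarith [(lt_min_iff.1 hr.2).2]⟩
  exact hX.eqOn_Ioo (t₀ := 0)
    ⟨max_lt (by linarith [h.pos]) (by linarith [hs.1]), lt_min h.pos (by linarith [hs.2])⟩ h1 h2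
    (by simp [h.zero _ hsW])
    ⟨max_lt hr.1 (by linarith [hsr.1]), lt_min hr.2 (by linarith [hsr.2])⟩

theorem eq_curve [T2Space M] (h : IsFlowBox X Ω Φ δ W O) (hX : IsSmoothField X) {γ : ℝ → M}
    {a : ℝ} (hγ : IsMIntegralCurveOn (I := I) γ X (Icc 0 a)) (h0 : γ 0 ∈ W) (ha : a ∈ Ico 0 δ) :
    ∀ s ∈ Icc 0 a, Φ (s, γ 0) = γ s := by
  have hsub : Icc 0 a ⊆ Ioo (-δ) δ := fun s hs =>
    ⟨by linarith [hs.1, h.pos], hs.2.trans_lt ha.2⟩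
  exact hX.eqOn_Icc ha.1 ((h.curve _ h0).mono hsub) hγ (h.zero _ h0)

theorem contMDiffAt_right (h : IsFlowBox X Ω Φ δ W O) {z : M} (hz : z ∈ W) {s : ℝ}
    (hs : s ∈ Ioo (-δ) δ) : ContMDiffAt I I 1 (fun z => Φ (s, z)) z :=
  ContMDiffAt.comp (g := Φ) z (h.contMDiffAt z hz s hs) (contMDiffAt_const.prodMk contMDiffAt_id)

theorem strictMonoOn (h : IsFlowBox X Ω Φ δ W O) (hg : ContMDiff I 𝓘(ℝ, ℝ) ∞ g)
    (hO : ∀ z ∈ O, 0 < differential I g z (X z)) {z : M} (hz : z ∈ W) :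
    StrictMonoOn (fun s => g (Φ (s, z))) (Ioo (-δ) δ) := by
  have hd : ∀ s ∈ Ioo (-δ) δ, HasDerivAt (fun s => g (Φ (s, z)))
      (differential I g (Φ (s, z)) (X (Φ (s, z)))) s := fun s hs =>
    (hasDerivWithinAt_comp_integralCurve ((hg _).mdifferentiableAt (by simp)) (h.curve z hz)
      hs).hasDerivAt (isOpen_Ioo.mem_nhds hs)
  refine strictMonoOn_of_deriv_pos (convex_Ioo _ _)
    (fun s hs => (hd s hs).continuousAt.continuousWithinAt) fun s hs => ?_
  rw [interior_Ioo] at hs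
  rw [(hd s hs).deriv]
  exact hO _ (h.mem z hz s hs)

end IsFlowBox

/-- Near the starting point the hybrid flow is Φ'_b ∘ J ∘ Φ_a, where J is the jump map, and all
three factors preserve Ω. A nearby point x with w = Φ_a(x) has its impact at time a + τ(w), and J
compensates this shift by leaving b - τ(w) for the second arc. No other impact occurs: `g` increases
strictly in the first flow box, and dg(X) < 0 throughout the second. -/
theorem PresymplecticImpact.exists_regularAt_jump [T2Space M]
    (h : PresymplecticImpact V X Ω K T c g Δ) {z : M} (hz : z ∈ outwardGuard I X g) :
    ∃ ε > 0, ∃ W ∈ 𝓝 z, ∀ (a : ℝ) (γ : ℝ → M), a ∈ Ioo 0 ε →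
      IsMIntegralCurveOn (I := I) γ X (Icc 0 a) → γ 0 ∈ W → γ a = z → ∀ b ∈ Ioo 0 ε,
      ∃ y, RegularAt X (outwardGuard I X g) Δ Ω 1 (a + b) (γ 0) y := by
  have hX := h.system.isSmoothField
  have hcont := hX.continuous_differential h.smooth_g
  obtain ⟨Φ, hΦ, δ, W, hzW, hbox⟩ := h.system.exists_flowBox
    (O := {z | 0 < differential I g z (X z)}) ((isOpen_lt continuous_const hcont).mem_nhds hz.2)
  obtain ⟨Φ', hΦ', δ', W', hzW', hbox'⟩ := h.system.exists_flowBox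
    (O := {z | differential I g z (X z) < 0})
    ((isOpen_lt hcont continuous_const).mem_nhds (h.covector_reset_neg hz))
  obtain ⟨τ, hτ, hτ0, hPS, hΔP, hJ, hJΩ⟩ := h.exists_jump hz hΦ hbox.pos
    (hbox.isOpen.mem_nhds hzW) (fun w hw => ⟨hbox.zero w hw, hbox.curve w hw⟩) hΦ' hbox'.pos
    (hbox'.isOpen.mem_nhds hzW') (fun w hw => ⟨hbox'.zero w hw, hbox'.curve w hw⟩)
  have hPz : Φ (τ z, z) = z := by rw [hτ0, hbox.zero z hzW]
  have hJz : Φ' (-τ z, Δ (Φ (τ z, z))) = Δ z := by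
    rw [hPz, hτ0, neg_zero, hbox'.zero _ hzW']
  refine ⟨min δ δ', lt_min hbox.pos hbox'.pos, W, hbox.isOpen.mem_nhds hzW, ?_⟩
  intro a γ ha hγ h0 haz b hb
  have haδ : a < δ := ha.2.trans_le (min_le_left _ _)
  have hbδ : b < δ' := hb.2.trans_le (min_le_right _ _)
  have ha0 := ha.1
  have hb0 := hb.1
  have ham : a ∈ Ioo (-δ) δ := ⟨by linarith, haδ⟩
  have hbm : b ∈ Ioo (-δ') δ' := ⟨by linarith, hbδ⟩
  have haΦ : Φ (a, γ 0) = z :=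
    (hbox.eq_curve hX hγ h0 ⟨ha0.le, haδ⟩ a ⟨ha0.le, le_rfl⟩).trans haz
  have hAc := hbox.contMDiffAt_right h0 ham
  have hBc := hbox'.contMDiffAt_right hzW' hbm
  have hJA : ContMDiffAt I I 1
      (fun x => Φ' (-τ (Φ (a, x)), Δ (Φ (τ (Φ (a, x)), Φ (a, x))))) (γ 0) :=
    ContMDiffAt.comp (g := fun w => Φ' (-τ w, Δ (Φ (τ w, w)))) (γ 0) (by rwa [haΦ]) hAc
  have hJAΩ : PullsBackAt Ω
      (fun x => Φ' (-τ (Φ (a, x)), Δ (Φ (τ (Φ (a, x)), Φ (a, x))))) (γ 0) :=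
    PullsBackAt.comp (G := fun w => Φ' (-τ w, Δ (Φ (τ w, w)))) (by rwa [haΦ])
      (hbox.pullsBack _ h0 a ham) (by rw [haΦ]; exact hJ.mdifferentiableAt (by simp))
      (hAc.mdifferentiableAt (by simp))
  have hJx : Φ' (-τ (Φ (a, γ 0)), Δ (Φ (τ (Φ (a, γ 0)), Φ (a, γ 0)))) = Δ z := by
    rw [haΦ, hJz]
  refine ⟨_, fun x => Φ' (b, Φ' (-τ (Φ (a, x)), Δ (Φ (τ (Φ (a, x)), Φ (a, x))))), rfl, ?_, ?_, ?_⟩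
  · exact ContMDiffAt.comp (g := fun w => Φ' (b, w)) (γ 0) (by rwa [hJx]) hJA
  · exact PullsBackAt.comp (G := fun w => Φ' (b, w))
      (by rw [hJx]; exact hbox'.pullsBack _ hzW' b hbm)
      hJAΩ (by rw [hJx]; exact hBc.mdifferentiableAt (by simp)) (hJA.mdifferentiableAt (by simp))
  · have hAt : Tendsto (fun x => Φ (a, x)) (𝓝 (γ 0)) (𝓝 z) := by
      have := hAc.continuousAt
      rwa [ContinuousAt, haΦ] at this
    -- The bounds `a` and `b` keep both arcs of positive duration; `δ - a` and `δ' - b` keep them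
    -- inside the flow boxes.
    have hτt : ∀ᶠ w in 𝓝 z, |τ w| < min (min a b) (min (δ - a) (δ' - b)) := by
      have h1 : ContinuousAt (fun w => |τ w|) z := hτ.abs
      refine h1.eventually (Iio_mem_nhds ?_)
      simp only [hτ0, abs_zero]
      exact lt_min (lt_min ha0 hb0) (lt_min (by linarith) (by linarith))
    have hΔW : ∀ᶠ w in 𝓝 z, Δ (Φ (τ w, w)) ∈ W' :=
      hΔP.eventually (hbox'.isOpen.mem_nhds (by simpa only [hPz] using hzW'))
    have hJW : ∀ᶠ w in 𝓝 z, Φ' (-τ w, Δ (Φ (τ w, w))) ∈ W' :=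
      hJ.continuousAt.eventually (hbox'.isOpen.mem_nhds (by simpa only [hJz] using hzW'))
    filter_upwards [hbox.isOpen.mem_nhds h0, hAt.eventually (hbox.isOpen.mem_nhds hzW),
      hAt.eventually hτt, hAt.eventually hΔW, hAt.eventually hJW, hAt.eventually hPS] with x hx hw
      hτw hΔw hJw hPw
    set w := Φ (a, x) with hwdef
    obtain ⟨h1, h2⟩ := lt_min_iff.1 hτw
    obtain ⟨h3, h4⟩ := lt_min_iff.1 h1
    obtain ⟨h5, h6⟩ := lt_min_iff.1 h2
    rw [abs_lt] at h3 h4 h5 h6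
    have hτm : τ w ∈ Ioo (-δ) δ := ⟨by linarith, by linarith⟩
    have hτm' : -τ w ∈ Ioo (-δ') δ' := ⟨by linarith, by linarith⟩
    have hadd : Φ (τ w, w) = Φ (τ w + a, x) :=
      hbox.add hX hx ham hτm ⟨by linarith, by linarith⟩ hw
    have hadd' : Φ' (b, Φ' (-τ w, Δ (Φ (τ w, w)))) = Φ' (b + -τ w, Δ (Φ (τ w, w))) :=
      hbox'.add hX hΔw hτm' hbm ⟨by linarith, by linarith⟩ hJw
    rw [hadd']
    refine .jump (N := 0) (s := τ w + a) (t := b + -τ w) (γ := fun s => Φ (s, x)) (by linarith)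
      ((hbox.curve x hx).mono fun s hs => ⟨by linarith [hs.1], by linarith [hs.2]⟩) ?_
      (hbox.zero x hx) hadd.symm hPw (by linarith) (by ring) ?_
    · intro s hs hsS
      have hlt := hbox.strictMonoOn h.smooth_g (fun z hz => hz) hx
        (a := s) (b := τ w + a) ⟨by linarith [hs.1], by linarith [hs.2]⟩
        ⟨by linarith, by linarith⟩ hs.2
      simp only at hlt
      rw [← hadd, hPw.1, hsS.1] at hlt
      exact lt_irrefl _ hlt
    · refine .flow (γ := fun s => Φ' (s, Δ (Φ (τ w, w)))) (by linarith)
        ((hbox'.curve _ hΔw).mono fun s hs => ⟨by linarith [hs.1], by linarith [hs.2]⟩) ?_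
        (hbox'.zero _ hΔw) rfl
      intro s hs hsS
      exact lt_asymm hsS.2 (hbox'.mem _ hΔw s ⟨by linarith [hs.1], by linarith [hs.2]⟩)

end JumpRegular
end

noncomputable section

set_option linter.unusedSectionVars false

/-! ### Meagre sets -/

/-- By second countability, countably many of the local neighbourhoods already cover `A`. -/
theorem isMeagre_of_locally {Y : Type*} [TopologicalSpace Y] [SecondCountableTopology Y]
    {A : Set Y} (h : ∀ x ∈ A, ∃ O ∈ 𝓝 x, IsMeagre (O ∩ A)) : IsMeagre A := by
  choose! O hO hm using h
  obtain ⟨t, htA, htc, hcov⟩ := TopologicalSpace.countable_cover_nhdsWithin (f := O) (s := A)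
    fun x hx => mem_nhdsWithin_of_mem_nhds (hO x hx)
  refine IsMeagre.mono (s := ⋃ x ∈ t, O x ∩ A) (fun y hy => ?_)
    (isMeagre_biUnion htc fun x hx => hm x (htA hx))
  obtain ⟨x, hx, hyx⟩ := mem_iUnion₂.1 (hcov hy)
  exact mem_iUnion₂.2 ⟨x, hx, hyx, hy⟩

/-- Preimages of meagre sets under maps that are continuous and open on an open set. -/
theorem isMeagre_inter_preimage {Y Z : Type*} [TopologicalSpace Y] [TopologicalSpace Z] {O : Set Y}
    (hO : IsOpen O) {G : Y → Z} (hG : ContinuousOn G O)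
    (hGo : ∀ x ∈ O, 𝓝 (G x) ≤ map G (𝓝 x)) {A : Set Z} (hA : IsMeagre A) :
    IsMeagre (O ∩ G ⁻¹' A) := by
  obtain ⟨𝒮, h𝒮, h𝒮c, hA𝒮⟩ := isMeagre_iff_countable_union_isNowhereDense.1 hA
  refine IsMeagre.mono (s := ⋃ C ∈ 𝒮, O ∩ G ⁻¹' closure C) (fun y hy => ?_)
    (isMeagre_biUnion h𝒮c fun C hC => IsNowhereDense.isMeagre ?_)
  · obtain ⟨C, hC, hyC⟩ := hA𝒮 hy.2
    exact mem_iUnion₂.2 ⟨C, hC, hy.1, subset_closure hyC⟩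
  -- If the closure of the preimage had an interior point, continuity would send a nonempty open
  -- subset of `O` into `closure C`, and openness of `G` would make `closure C` a neighbourhood of
  -- some point.
  · rw [IsNowhereDense, eq_empty_iff_forall_notMem]
    intro y hy
    have h1 : (interior (closure (O ∩ G ⁻¹' closure C)) ∩ (O ∩ G ⁻¹' closure C)).Nonempty :=
      mem_closure_iff.1 (interior_subset hy) _ isOpen_interior hy
    obtain ⟨x, hx, hxO, -⟩ := h1
    have h2 : interior (closure (O ∩ G ⁻¹' closure C)) ∩ O ⊆ G ⁻¹' closure C := by
      rintro w ⟨hw, hwO⟩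
      have hw' := interior_subset hw
      have hGw : ContinuousWithinAt G (O ∩ G ⁻¹' closure C) w := (hG w hwO).mono inter_subset_left
      have := hGw.mem_closure hw' (t := closure C) fun v hv => hv.2
      rwa [closure_closure] at this
    have h3 : G ⁻¹' closure C ∈ 𝓝 x :=
      mem_of_superset ((isOpen_interior.inter hO).mem_nhds ⟨hx, hxO⟩) h2
    have h4 : closure C ∈ 𝓝 (G x) := hGo x hxO h3
    have h5 : G x ∈ interior (closure C) := mem_interior_iff_mem_nhds.2 h4
    rw [h𝒮 C hC] at h5
    exact h5

/-- A one-dimensional Sard argument: the points from which the curve `s ↦ f (s, y)` has a double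
zero form a nowhere dense set, if `f` is a submersion in `y`. -/
theorem exists_isNowhereDense_doubleZero {E : Type*} [NormedAddCommGroup E] [NormedSpace ℝ E]
    [FiniteDimensional ℝ E] {f : ℝ × E → ℝ} {y₀ v : E} (hf : ContDiffAt ℝ 1 f (0, y₀))
    (hv : 0 < fderiv ℝ f (0, y₀) (0, v)) :
    ∃ ρ > 0, ∀ ρ' ∈ Ioc 0 ρ, IsNowhereDense {y | y ∈ Metric.closedBall y₀ ρ' ∧
      ∃ s ∈ Icc (-ρ') ρ', f (s, y) = 0 ∧ fderiv ℝ f (s, y) (1, 0) = 0} := by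
  set κ := fderiv ℝ f (0, y₀) (0, v) / 2 with hκ
  have hκ0 : 0 < κ := by positivity
  have h1 : ∀ᶠ x in 𝓝 ((0 : ℝ), y₀), ContDiffAt ℝ 1 f x := hf.eventually (by simp)
  have h2 : ∀ᶠ x in 𝓝 ((0 : ℝ), y₀), κ < fderiv ℝ f x (0, v) := by
    have h3 : ContinuousAt (fun x => fderiv ℝ f x (0, v)) (0, y₀) :=
      (hf.fderiv_right (m := 0) (by simp)).continuousAt.clm_apply continuousAt_const
    exact h3.eventually (lt_mem_nhds (by linarith))
  obtain ⟨r, hr, hball⟩ := Metric.eventually_nhds_iff_ball.1 (h1.and h2)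
  refine ⟨r / 2, by linarith, fun ρ hρ => ?_⟩
  have hρ0 := hρ.1
  have hρr := hρ.2
  have hmem : ∀ s ∈ Icc (-ρ) ρ, ∀ y ∈ Metric.closedBall y₀ ρ,
      (s, y) ∈ Metric.ball ((0 : ℝ), y₀) r := by
    intro s hs y hy
    rw [Metric.mem_ball, Prod.dist_eq]
    refine max_lt ?_ ((Metric.mem_closedBall.1 hy).trans_lt (by linarith))
    simp only [Real.dist_eq, sub_zero]
    exact (abs_le.2 hs).trans_lt (by linarith)
  set N := {y | y ∈ Metric.closedBall y₀ ρ ∧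
      ∃ s ∈ Icc (-ρ) ρ, f (s, y) = 0 ∧ fderiv ℝ f (s, y) (1, 0) = 0} with hN
  -- `N` is the projection of a compact set of pairs (s, y), so it is enough to show that it has no
  -- interior.
  have hclosed : IsClosed N := by
    let k : Set (ℝ × E) := Icc (-ρ) ρ ×ˢ Metric.closedBall y₀ ρ
    have hk : IsCompact k := isCompact_Icc.prod (isCompact_closedBall _ _)
    have hc : ContinuousOn (fun x => (f x, fderiv ℝ f x (1, 0))) k := by
      intro x hx
      have h3 := (hball x (hmem x.1 hx.1 x.2 hx.2)).1
      exact (h3.continuousAt.prodMk ((h3.fderiv_right (m := 0) (by simp)).continuousAt.clm_apply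
        continuousAt_const)).continuousWithinAt
    have h4 := (hc.preimage_isClosed_of_isClosed hk.isClosed
      (isClosed_singleton (x := ((0 : ℝ), (0 : ℝ)))))
    have h5 := ((hk.of_isClosed_subset h4 inter_subset_left).image continuous_snd).isClosed
    convert h5 using 1
    ext y
    constructor
    · rintro ⟨hy, s, hs, h6, h7⟩
      exact ⟨(s, y), ⟨⟨hs, hy⟩, Prod.ext h6 h7⟩, rfl⟩
    · rintro ⟨⟨s, y'⟩, ⟨⟨hs, hy⟩, h6⟩, rfl⟩
      exact ⟨hy, s, hs, congrArg Prod.fst h6, congrArg Prod.snd h6⟩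
  rw [hclosed.isNowhereDense_iff, eq_empty_iff_forall_notMem]
  intro y₁ hy₁
  -- An interior point would put a whole segment in direction `v` inside `N`. Along such a line `f
  -- (s, ·)` grows at rate at least `κ`, so each time `s` has a double zero for at most one
  -- parameter, called `Λ s`. The function `Λ` then maps its domain `B` onto an interval.
  have hline : ContinuousAt (fun l : ℝ => y₁ + l • v) 0 := by fun_prop
  have hev : ∀ᶠ l : ℝ in 𝓝 0, y₁ + l • v ∈ N :=
    hline.eventually (by simpa using mem_interior_iff_mem_nhds.1 hy₁)
  obtain ⟨ε, hε, hεN⟩ := Metric.eventually_nhds_iff_ball.1 hev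
  rw [Real.ball_eq_Ioo, zero_sub, zero_add] at hεN
  have hdl : ∀ s ∈ Icc (-ρ) ρ, ∀ l ∈ Ioo (-ε) ε,
      HasDerivAt (fun l : ℝ => f (s, y₁ + l • v)) (fderiv ℝ f (s, y₁ + l • v) (0, v)) l := by
    intro s hs l hl
    have h3 := (hball _ (hmem s hs _ (hεN l hl).1)).1.differentiableAt (by simp)
    have h4 : HasDerivAt (fun l : ℝ => (s, y₁ + l • v)) ((0 : ℝ), v) l := by
      have h5 := ((hasDerivAt_id l).smul_const v).const_add y₁
      simpa using (hasDerivAt_const l s).prodMk h5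
    exact h3.hasFDerivAt.comp_hasDerivAt l h4
  have hmono : ∀ s ∈ Icc (-ρ) ρ, ∀ l ∈ Ioo (-ε) ε, ∀ l' ∈ Ioo (-ε) ε,
      κ * |l' - l| ≤ |f (s, y₁ + l' • v) - f (s, y₁ + l • v)| := by
    intro s hs
    have key : ∀ l ∈ Ioo (-ε) ε, ∀ l' ∈ Ioo (-ε) ε, l ≤ l' →
        κ * (l' - l) ≤ f (s, y₁ + l' • v) - f (s, y₁ + l • v) := by
      refine (convex_Ioo (-ε) ε).mul_sub_le_image_sub_of_le_deriv
        (f := fun l : ℝ => f (s, y₁ + l • v))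
        (fun l hl => (hdl s hs l hl).continuousAt.continuousWithinAt) ?_ ?_
      · rw [interior_Ioo]
        exact fun l hl => (hdl s hs l hl).differentiableAt.differentiableWithinAt
      · rw [interior_Ioo]
        intro l hl
        rw [(hdl s hs l hl).deriv]
        exact (hball _ (hmem s hs _ (hεN l hl).1)).2.le
    intro l hl l' hl'
    rcases le_total l l' with hll | hll
    · rw [abs_of_nonneg (sub_nonneg.2 hll)]
      exact (key l hl l' hl' hll).trans (le_abs_self _)
    · rw [abs_sub_comm, abs_of_nonneg (sub_nonneg.2 hll), abs_sub_comm]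
      exact (key l' hl' l hl hll).trans (le_abs_self _)
  have hs : ∀ l ∈ Ioo (-ε) ε, ∃ s ∈ Icc (-ρ) ρ, f (s, y₁ + l • v) = 0 ∧
      fderiv ℝ f (s, y₁ + l • v) (1, 0) = 0 := fun l hl => (hεN l hl).2
  let B : Set ℝ := {s | s ∈ Icc (-ρ) ρ ∧ ∃ l ∈ Ioo (-ε) ε, f (s, y₁ + l • v) = 0 ∧
      fderiv ℝ f (s, y₁ + l • v) (1, 0) = 0}
  have hB : ∀ s ∈ B, ∃ l ∈ Ioo (-ε) ε, f (s, y₁ + l • v) = 0 ∧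
      fderiv ℝ f (s, y₁ + l • v) (1, 0) = 0 := fun s hs => hs.2
  choose! Λ hΛ hΛ0 hΛ1 using hB
  have himage : Ioo (-ε) ε ⊆ Λ '' B := by
    intro l hl
    obtain ⟨s, hs1, hs2, hs3⟩ := hs l hl
    have hsB : s ∈ B := ⟨hs1, l, hl, hs2, hs3⟩
    refine ⟨s, hsB, ?_⟩
    have h3 := hmono s hs1 l hl (Λ s) (hΛ s hsB)
    rw [hΛ0 s hsB, hs2, sub_self, abs_zero] at h3
    have h4 : |Λ s - l| ≤ 0 := by
      by_contra hlt
      push Not at hlt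
      nlinarith
    exact sub_eq_zero.1 (abs_nonpos_iff.1 h4)
  -- By the growth rate, κ|Λ(s') - Λ(s)| is at most |f(s', y₁ + Λ(s)v)|, which is o(s' - s) because
  -- the zero at `s` is double. A function with zero derivative on `B` has a null image, so it
  -- cannot cover an interval.
  have hderiv : ∀ s ∈ B, HasFDerivWithinAt Λ (0 : ℝ →L[ℝ] ℝ) B s := by
    intro s hsB
    have h3 := (hball _ (hmem s hsB.1 _ (hεN _ (hΛ s hsB)).1)).1.differentiableAt (by simp)
    have h4 : HasDerivAt (fun r : ℝ => (r, y₁ + Λ s • v)) ((1 : ℝ), (0 : E)) s :=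
      (hasDerivAt_id s).prodMk (hasDerivAt_const s _)
    have h5 := h3.hasFDerivAt.comp_hasDerivAt s h4
    rw [hΛ1 s hsB] at h5
    have h6 := hasDerivAt_iff_isLittleO.1 h5
    refine HasFDerivWithinAt.of_isLittleO ?_
    simp only [zero_apply, sub_zero]
    have h7 : (fun s' => Λ s' - Λ s) =O[𝓝[B] s] fun s' => f (s', y₁ + Λ s • v) := by
      refine Asymptotics.IsBigO.of_bound κ⁻¹ ?_
      filter_upwards [self_mem_nhdsWithin] with s' hs'
      have h8 := hmono s' hs'.1 (Λ s) (hΛ s hsB) (Λ s') (hΛ s' hs')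
      rw [hΛ0 s' hs', zero_sub, abs_neg] at h8
      rw [Real.norm_eq_abs, Real.norm_eq_abs, inv_mul_eq_div, le_div_iff₀ hκ0, mul_comm]
      exact h8
    refine h7.trans_isLittleO ?_
    have h8 := h6.mono (nhdsWithin_le_nhds (s := B))
    simpa [Function.comp_def, hΛ0 s hsB] using h8
  have hnull := MeasureTheory.addHaar_image_eq_zero_of_det_fderivWithin_eq_zero
    MeasureTheory.volume hderiv fun s _ => by simp [ContinuousLinearMap.det]
  have h9 : MeasureTheory.volume (Ioo (-ε) ε) = 0 := MeasureTheory.measure_mono_null himage hnull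
  rw [Real.volume_Ioo, ENNReal.ofReal_eq_zero] at h9
  linarith
end

noncomputable section

set_option linter.unusedSectionVars false

/-! ### Regular maps are local homeomorphisms; grazing trajectories are meagre -/

section Grazing

universe u
variable {E : Type u} [NormedAddCommGroup E] [NormedSpace ℝ E] [FiniteDimensional ℝ E]
  {H : Type*} [TopologicalSpace H] {I : ModelWithCorners ℝ E H} [I.Boundaryless]
  {M : Type*} [TopologicalSpace M] [ChartedSpace H M] [IsManifold I ∞ M]
  {V : Type*} [NormedAddCommGroup V] [NormedSpace ℝ V]
  {X : (z : M) → TangentSpace I z} {Ω : (z : M) → TangentSpace I z [⋀^Fin 2]→ₗ[ℝ] ℝ}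
  {K T g : M → ℝ} {c : ℝ} {S : Set M} {Δ : M → M}

theorem nhds_le_map_extChartAt {z w : M} (hw : w ∈ (extChartAt I z).source) :
    𝓝 (extChartAt I z w) ≤ map (extChartAt I z) (𝓝 w) := by
  rw [map_extChartAt_nhds' hw, I.range_eq_univ, nhdsWithin_univ]

/-- An injective derivative is invertible since the dimensions agree, and the inverse function
theorem in charts makes `G` open at all points near `x`. -/
theorem eventually_nhds_le_map {G : M → M} {x : M} (hG : ContMDiffAt I I 1 G x)
    (hinj : ∀ v, mfderiv I I G x v = 0 → v = 0) : ∀ᶠ w in 𝓝 x, 𝓝 (G w) ≤ map G (𝓝 w) := by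
  let f : E → E := extChartAt I (G x) ∘ G ∘ (extChartAt I x).symm
  have hf : ContDiffAt ℝ 1 f (extChartAt I x x) := by
    have := (contMDiffAt_iff.1 hG).2
    rwa [I.range_eq_univ, contDiffWithinAt_univ] at this
  let L : E →L[ℝ] E := mfderiv I I G x
  have hL : HasFDerivAt f L (extChartAt I x x) := by
    have h1 : HasFDerivWithinAt f L (range I) (extChartAt I x x) :=
      (hG.mdifferentiableAt (by simp)).hasMFDerivAt.2
    rwa [I.range_eq_univ, hasFDerivWithinAt_univ] at h1
  have hLinj : Function.Injective L.toLinearMap := by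
    rw [← LinearMap.ker_eq_bot, LinearMap.ker_eq_bot']
    exact fun v hv => hinj v hv
  let L' : E ≃L[ℝ] E := (LinearEquiv.ofInjectiveEndo L.toLinearMap hLinj).toContinuousLinearEquiv
  have hL' : (L' : E →L[ℝ] E) = L := by ext v; rfl
  rw [← hL'] at hL
  let φ := hf.toOpenPartialHomeomorph f hL (by simp)
  have hφs : φ.source ∈ 𝓝 (extChartAt I x x) :=
    φ.open_source.mem_nhds (hf.mem_toOpenPartialHomeomorph_source hL (by simp))
  have hGev := (contMDiffAt_iff_contMDiffAt_nhds (by simp)).1 hG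
  filter_upwards [(continuousAt_extChartAt (I := I) x).preimage_mem_nhds hφs,
    extChartAt_source_mem_nhds (I := I) x,
    hG.continuousAt.preimage_mem_nhds (extChartAt_source_mem_nhds (I := I) (G x)), hGev] with
    w hwφ hws hwG hGw
  have h1 : 𝓝 (f (extChartAt I x w)) ≤ map f (𝓝 (extChartAt I x w)) :=
    (φ.map_nhds_eq hwφ).ge
  have h2 : map f (𝓝 (extChartAt I x w)) ≤ map f (map (extChartAt I x) (𝓝 w)) :=
    map_mono (nhds_le_map_extChartAt hws)
  have hfe : (fun v => f (extChartAt I x v)) =ᶠ[𝓝 w] fun v => extChartAt I (G x) (G v) := by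
    filter_upwards [(isOpen_extChartAt_source x).mem_nhds hws] with v hv
    simp only [f, Function.comp_apply, (extChartAt I x).left_inv hv]
  have h3 : 𝓝 (extChartAt I (G x) (G w)) ≤ map (fun v => extChartAt I (G x) (G v)) (𝓝 w) := by
    rw [← Filter.map_congr hfe, ← hfe.eq_of_nhds]
    exact (h1.trans h2).trans (by rw [map_map]; rfl)
  have h4 : 𝓝 (G w) = map (extChartAt I (G x)).symm (𝓝 (extChartAt I (G x) (G w))) := by
    rw [← map_extChartAt_symm_nhdsWithin_range' hwG, I.range_eq_univ, nhdsWithin_univ]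
  rw [h4]
  refine (map_mono h3).trans ?_
  rw [map_map]
  refine (Filter.map_congr ?_).le
  filter_upwards [hGw.continuousAt.preimage_mem_nhds
    ((isOpen_extChartAt_source (I := I) (G x)).mem_nhds hwG)] with v hv
  exact (extChartAt I (G x)).left_inv hv

theorem isMeagre_preimage_of_mfderiv_injective {G : M → M} {x : M} (hG : ContMDiffAt I I 1 G x)
    (hinj : ∀ v, mfderiv I I G x v = 0 → v = 0) {A : Set M} (hA : IsMeagre A) :
    ∃ O ∈ 𝓝 x, IsMeagre (O ∩ G ⁻¹' A) := by
  obtain ⟨O, hO, hOo, hxO⟩ := eventually_nhds_iff.1 ((eventually_nhds_le_map hG hinj).and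
    ((contMDiffAt_iff_contMDiffAt_nhds (by simp)).1 hG))
  exact ⟨O, hOo.mem_nhds hxO, isMeagre_inter_preimage hOo
    (fun w hw => (hO w hw).2.continuousAt.continuousWithinAt) (fun w hw => (hO w hw).1) hA⟩

/-- A vector killed by dG pairs to zero under Ω with every vector, because `G` preserves Ω. It is
also killed by dT, because T ∘ G differs from T by a constant. The common kernel is trivial. -/
theorem PresymplecticSystem.mfderiv_injective (h : PresymplecticSystem V X Ω K T c) {G : M → M}
    {x : M} {r : ℝ} (hG : ContMDiffAt I I 1 G x) (hGΩ : PullsBackAt Ω G x)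
    (hT : ∀ᶠ w in 𝓝 x, T (G w) = T w + r) : ∀ v, mfderiv I I G x v = 0 → v = 0 := by
  intro v hv
  refine h.nondegenerate x v (fun u => ?_) ?_
  · rw [← hGΩ v u, hv]
    exact (Ω (G x)).map_coord_zero 0 rfl
  · have h1 := HasMFDerivAt.comp (g := T) x
      (hasMFDerivAt_covector ((h.smooth_T (G x)).mdifferentiableAt (by simp)))
      (hG.mdifferentiableAt (by simp)).hasMFDerivAt
    have h2 : HasMFDerivAt I 𝓘(ℝ, ℝ) (fun w => T w + r) x (covector (E := E) I T x) := by
      have h3 := (hasMFDerivAt_covector ((h.smooth_T x).mdifferentiableAt (by simp))).add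
        (hasMFDerivAt_const (c := r) (x := x))
      have h4 : covector (E := E) I T x + 0 = covector I T x := add_zero _
      rw [← h4]
      exact h3
    have h3 := congrArg (fun L : E →L[ℝ] ℝ => L v)
      (hasMFDerivAt_unique (h2.congr_of_eventuallyEq hT) h1)
    refine Eq.trans h3 ?_
    exact (congrArg (covector I T (G x)) hv).trans (map_zero _)

/-- Near one of its points this set is contained in the preimage of `A` under a fixed regular map
`G`, since uniqueness of hybrid runs forces every other endpoint to be the value of `G`. That map is
locally a homeomorphism. -/
theorem PresymplecticSystem.isMeagre_regular_preimage [T2Space M] [SecondCountableTopology M]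
    (h : PresymplecticSystem V X Ω K T c) (hT : ∀ z ∈ S, T (Δ z) = T z) (N : ℕ) (t : ℝ)
    {A : Set M} (hA : IsMeagre A) : IsMeagre {x | ∃ y ∈ A, RegularAt X S Δ Ω N t x y} := by
  refine isMeagre_of_locally ?_
  rintro x ⟨y, -, G, -, hG, hGΩ, hreach⟩
  obtain ⟨O, hO, hm⟩ := isMeagre_preimage_of_mfderiv_injective hG
    (h.mfderiv_injective hG hGΩ (hreach.mono fun w hw => h.clock_of_reach hT hw)) hA
  refine ⟨O ∩ {w | CountedReach X S Δ N t w (G w)}, inter_mem hO hreach, hm.mono ?_⟩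
  rintro w ⟨⟨hwO, hwr⟩, y', hy', hreg⟩
  refine ⟨hwO, ?_⟩
  rw [mem_preimage, (hwr.unique h.isSmoothField hreg.reach).2]
  exact hy'

theorem isNowhereDense_zeroSet (hg : ContMDiff I 𝓘(ℝ, ℝ) ∞ g)
    (hreg : ∀ z, g z = 0 → differential I g z ≠ 0) : IsNowhereDense {z | g z = 0} := by
  have hclosed : IsClosed {z | g z = 0} := isClosed_eq hg.continuous continuous_const
  rw [hclosed.isNowhereDense_iff, eq_empty_iff_forall_notMem]
  intro z hz
  have hev : g =ᶠ[𝓝 z] fun _ => 0 := mem_interior_iff_mem_nhds.1 hz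
  refine hreg z hev.eq_of_nhds ?_
  exact ((hasMFDerivAt_const (c := (0 : ℝ)) (x := z)).congr_of_eventuallyEq hev).mfderiv

/-- Grazing means a double zero of s ↦ g(Φ(s, w)). As dg does not vanish at the centre, this
function of (s, w) is a submersion in `w` at time zero, and `exists_isNowhereDense_doubleZero`
applies in a chart. -/
theorem PresymplecticSystem.exists_isMeagre_grazing (h : PresymplecticSystem V X Ω K T c)
    (hg : ContMDiff I 𝓘(ℝ, ℝ) ∞ g) {z₀ : M} (hz₀ : differential I g z₀ ≠ 0) :
    ∃ (Φ : ℝ × M → M) (δ r : ℝ) (W B : Set M), IsFlowBox X Ω Φ δ W univ ∧ 0 < r ∧ r < δ ∧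
      B ∈ 𝓝 z₀ ∧ B ⊆ W ∧ IsMeagre {w | w ∈ B ∧ ∃ s ∈ Icc (-r) r,
        g (Φ (s, w)) = 0 ∧ differential I g (Φ (s, w)) (X (Φ (s, w))) = 0} := by
  obtain ⟨Φ, hΦ, δ, W, hzW, hbox⟩ := h.exists_flowBox (z₀ := z₀) (O := univ) univ_mem
  set e := extChartAt I z₀
  have hsymm : e.symm (e z₀) = z₀ := extChartAt_to_inv (I := I) z₀
  let f : ℝ × E → ℝ := fun x => g (Φ (x.1, e.symm x.2))
  have hpair : ContMDiffAt 𝓘(ℝ, ℝ × E) (𝓘(ℝ, ℝ).prod I) ∞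
      (fun x : ℝ × E => (x.1, e.symm x.2)) (0, e z₀) := by
    have h1 : ContMDiffAt 𝓘(ℝ, E) I ∞ e.symm (e z₀) :=
      (contMDiffOn_extChartAt_symm z₀).contMDiffAt
        (extChartAt_target_mem_nhds_of_boundaryless z₀ (mem_extChartAt_target z₀))
    exact contDiffAt_fst.contMDiffAt.prodMk (h1.comp (0, e z₀) contDiffAt_snd.contMDiffAt)
  have hf : ContDiffAt ℝ 1 f (0, e z₀) := by
    rw [← contMDiffAt_iff_contDiffAt]
    refine (ContMDiffAt.comp (g := g) (I' := I) _ (hg _) ?_).of_le (m := 1) (n := ∞) (by simp)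
    exact ContMDiffAt.comp (g := Φ) _ (by simpa only [hsymm] using hΦ) hpair
  obtain ⟨v, hv⟩ : ∃ v : E, 0 < fderiv ℝ f (0, e z₀) (0, v) := by
    have h1 : ∀ a : E, fderiv ℝ f (0, e z₀) (0, a) =
        vderiv I g (e.symm (e z₀)) (chartVector z₀ (e z₀) a) := by
      intro a
      rw [← fderiv_chart_eq (mem_extChartAt_target z₀) ((hg _).mdifferentiableAt (by simp))]
      have h2 := ((hf.differentiableAt (by simp)).hasFDerivAt.comp (e z₀)
        (hasFDerivAt_prodMk_right (0 : ℝ) (e z₀))).fderiv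
      have h3 : (f ∘ fun y => ((0 : ℝ), y)) =ᶠ[𝓝 (e z₀)] fun y => g (e.symm y) := by
        filter_upwards [eventually_chart_of_eventually (I := I)
          (hbox.isOpen.mem_nhds hzW)] with y hy
        simp only [f, Function.comp_apply]
        rw [hbox.zero _ hy]
      rw [h3.fderiv_eq] at h2
      exact (congrArg (fun L => L a) h2).symm
    have h4 : ∃ u, vderiv I g (e.symm (e z₀)) u ≠ 0 := by
      rw [hsymm]
      by_contra hcon
      push Not at hcon
      exact hz₀ (ContinuousLinearMap.ext hcon)
    obtain ⟨u, hu⟩ := h4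
    obtain ⟨a, rfl⟩ := chartVector_surjective (mem_extChartAt_target z₀) u
    rcases lt_or_gt_of_ne hu with hlt | hlt
    · refine ⟨-a, ?_⟩
      rw [h1, map_neg, map_neg]
      exact neg_pos.2 hlt
    · exact ⟨a, by rwa [h1]⟩
  obtain ⟨ρ, hρ, hnd⟩ := exists_isNowhereDense_doubleZero hf hv
  set r := min ρ (δ / 2)
  have hr0 : 0 < r := lt_min hρ (by linarith [hbox.pos])
  have hrδ : r < δ := (min_le_right _ _).trans_lt (by linarith [hbox.pos])
  have hfev : ∀ᶠ x in 𝓝 ((0 : ℝ), e z₀), DifferentiableAt ℝ f x :=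
    (hf.eventually (by simp)).mono fun x hx => hx.differentiableAt (by simp)
  obtain ⟨r₁, hr₁, hball⟩ := Metric.eventually_nhds_iff_ball.1 hfev
  -- The second bound keeps all pairs (s, y) where the function is differentiable, so that its
  -- derivative in direction (1, 0) is dg(X) along the flow.
  set r' := min r (r₁ / 2)
  have hr'0 : 0 < r' := lt_min hr0 (by linarith)
  have hr'r : r' ≤ r := min_le_left _ _
  have hr'₁ : r' < r₁ := (min_le_right _ _).trans_lt (by linarith)
  have hmeagre := isMeagre_inter_preimage (isOpen_extChartAt_source (I := I) z₀)
    (continuousOn_extChartAt z₀) (fun w hw => nhds_le_map_extChartAt hw)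
    (hnd r' ⟨hr'0, hr'r.trans (min_le_left _ _)⟩).isMeagre
  refine ⟨Φ, δ, r', W, W ∩ (e.source ∩ e ⁻¹' Metric.closedBall (e z₀) r'), hbox, hr'0,
    hr'r.trans_lt hrδ, ?_, inter_subset_left, hmeagre.mono ?_⟩
  · exact inter_mem (hbox.isOpen.mem_nhds hzW) (inter_mem (extChartAt_source_mem_nhds z₀)
      ((continuousAt_extChartAt z₀).preimage_mem_nhds (Metric.closedBall_mem_nhds _ hr'0)))
  · rintro w ⟨⟨hwW, hws, hwb⟩, s, hs, h1, h2⟩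
    refine ⟨hws, hwb, s, hs, ?_, ?_⟩
    · change g (Φ (s, e.symm (e w))) = 0
      rwa [show e.symm (e w) = w from e.left_inv hws]
    · have hsm : s ∈ Ioo (-δ) δ := ⟨by linarith [hs.1], by linarith [hs.2]⟩
      have hd : DifferentiableAt ℝ f (s, e w) := by
        refine hball _ ?_
        rw [Metric.mem_ball, Prod.dist_eq]
        refine max_lt ?_ ((Metric.mem_closedBall.1 hwb).trans_lt hr'₁)
        simp only [Real.dist_eq, sub_zero]
        exact (abs_le.2 hs).trans_lt hr'₁
      have h3 : HasDerivAt (fun r : ℝ => (r, e w)) ((1 : ℝ), (0 : E)) s :=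
        (hasDerivAt_id s).prodMk (hasDerivAt_const s _)
      have h4 := hd.hasFDerivAt.comp_hasDerivAt s h3
      have h5 := (hasDerivWithinAt_comp_integralCurve ((hg _).mdifferentiableAt (by simp))
        (hbox.curve w hwW) hsm).hasDerivAt (isOpen_Ioo.mem_nhds hsm)
      rw [h2] at h5
      have h6 : (f ∘ fun r : ℝ => (r, e w)) = fun s => g (Φ (s, w)) := by
        funext r
        simp only [f, Function.comp_apply]
        rw [show e.symm (e w) = w from e.left_inv hws]
      rw [h6] at h4
      exact h4.unique h5

end Grazing
end

noncomputable section

set_option linter.unusedSectionVars false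

/-! ### The hybrid flow preserves the form -/

section HybridFlow

universe u
variable {E : Type u} [NormedAddCommGroup E] [NormedSpace ℝ E] [FiniteDimensional ℝ E]
  {H : Type*} [TopologicalSpace H] {I : ModelWithCorners ℝ E H} [I.Boundaryless]
  {M : Type*} [TopologicalSpace M] [ChartedSpace H M] [IsManifold I ∞ M] [T2Space M]
  [SecondCountableTopology M]
  {V : Type*} [NormedAddCommGroup V] [NormedSpace ℝ V]
  {X : (z : M) → TangentSpace I z} {Ω : (z : M) → TangentSpace I z [⋀^Fin 2]→ₗ[ℝ] ℝ}
  {K T g : M → ℝ} {c : ℝ} {S : Set M} {Δ : M → M}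

/-- The points whose trajectory touches the zero set of `g` tangentially. -/
def grazingPoints (X : (z : M) → TangentSpace I z) (g : M → ℝ) : Set M :=
  {x | ∃ (t : ℝ) (γ : ℝ → M), 0 ≤ t ∧ IsMIntegralCurveOn (I := I) γ X (Icc 0 t) ∧ γ 0 = x ∧
    g (γ t) = 0 ∧ differential I g (γ t) (X (γ t)) = 0}

theorem exists_rat_near_right_end {t η : ℝ} (ht : 0 ≤ t) (hη : 0 < η) :
    ∃ q : ℚ, 0 ≤ (q : ℝ) ∧ (q : ℝ) ≤ t ∧ t - q < η := by
  rcases ht.eq_or_lt with rfl | ht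
  · exact ⟨0, by simp, by simp, by simpa using hη⟩
  · obtain ⟨q, hq1, hq2⟩ := exists_rat_btwn (show max 0 (t - η) < t from max_lt ht (by linarith))
    exact ⟨q, (max_lt_iff.1 hq1).1.le, hq2.le, by linarith [(max_lt_iff.1 hq1).2]⟩

/-- Countably many local boxes cover the tangency set. A trajectory with a tangential contact at
time t lies in one of the boxes already at some rational time q just before t, so its starting point
is in the preimage of a local grazing set under the time-q flow. These trajectories are never reset,
hence the empty guard. -/
theorem PresymplecticSystem.isMeagre_grazingPoints (h : PresymplecticSystem V X Ω K T c)
    (hg : ContMDiff I 𝓘(ℝ, ℝ) ∞ g) (hreg : ∀ z, g z = 0 → differential I g z ≠ 0) :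
    IsMeagre (grazingPoints X g) := by
  have hX := h.isSmoothField
  let Γ : Set M := {z | g z = 0 ∧ differential I g z (X z) = 0}
  have hloc : ∀ z ∈ Γ, ∃ (Φ : ℝ × M → M) (δ r : ℝ) (W B : Set M), IsFlowBox X Ω Φ δ W univ ∧
      0 < r ∧ r < δ ∧ B ∈ 𝓝 z ∧ B ⊆ W ∧ IsMeagre {w | w ∈ B ∧ ∃ s ∈ Icc (-r) r,
        g (Φ (s, w)) = 0 ∧ differential I g (Φ (s, w)) (X (Φ (s, w))) = 0} := fun z hz =>
    h.exists_isMeagre_grazing hg (hreg z hz.1)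
  choose! Φ δ r W B hbox hr0 hrδ hB hBW hm using hloc
  obtain ⟨D, hDΓ, hDc, hcov⟩ := TopologicalSpace.countable_cover_nhdsWithin
    (f := fun z => interior (B z)) (s := Γ) fun z hz =>
      mem_nhdsWithin_of_mem_nhds (interior_mem_nhds.2 (hB z hz))
  refine IsMeagre.mono (s := ⋃ z ∈ D, ⋃ q : ℚ, {x | ∃ y ∈ {w | w ∈ B z ∧ ∃ s ∈ Icc (-r z) (r z),
    g (Φ z (s, w)) = 0 ∧ differential I g (Φ z (s, w)) (X (Φ z (s, w))) = 0},
    RegularAt X ∅ id Ω 0 q x y}) ?_ (isMeagre_biUnion hDc fun z hz => isMeagre_iUnion fun q =>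
      h.isMeagre_regular_preimage (by simp) 0 q (hm z (hDΓ hz)))
  rintro x ⟨t, γ, ht, hγ, rfl, hg0, hg1⟩
  obtain ⟨z, hzD, hzB⟩ := mem_iUnion₂.1 (hcov (show γ t ∈ Γ from ⟨hg0, hg1⟩))
  have hz := hDΓ hzD
  have hcont : ContinuousWithinAt γ (Icc 0 t) t := (hγ t ⟨ht, le_rfl⟩).continuousWithinAt
  obtain ⟨η, hη, hηB⟩ := Metric.mem_nhdsWithin_iff.1
    (hcont.preimage_mem_nhdsWithin (isOpen_interior.mem_nhds hzB))
  obtain ⟨q, hq0, hqt, hq⟩ := exists_rat_near_right_end ht (lt_min hη (hr0 z hz))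
  have hqB : γ q ∈ B z := interior_subset (hηB ⟨by
    rw [Metric.mem_ball, Real.dist_eq, abs_sub_comm, abs_of_nonneg (by linarith)]
    exact hq.trans_le (min_le_left _ _), hq0, hqt⟩)
  have hqr : t - q ≤ r z := (hq.trans_le (min_le_right _ _)).le
  refine mem_iUnion₂.2 ⟨z, hzD, mem_iUnion.2 ⟨q, γ q, ⟨hqB, t - q, ⟨by linarith [hr0 z hz], hqr⟩,
    ?_⟩, ?_⟩⟩
  · have hsh : IsMIntegralCurveOn (I := I) (fun s => γ (s + q)) X (Icc 0 (t - q)) :=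
      hγ.shift q fun s hs => ⟨by linarith [hs.1], by linarith [hs.2]⟩
    have h1 := (hbox z hz).eq_curve hX hsh (by simpa using hBW z hz hqB)
      ⟨by linarith, hqr.trans_lt (hrδ z hz)⟩ (t - q) ⟨by linarith, le_rfl⟩
    simp only [zero_add, sub_add_cancel] at h1
    rw [h1]
    exact ⟨hg0, hg1⟩
  · exact h.regularAt_of_avoids (C := ∅) isClosed_empty (by simp) hq0
      (hγ.mono fun s hs => ⟨hs.1, hs.2.trans hqt⟩) (by simp)

/-- Adding the tangency points to the guard gives a closed set. A trajectory that avoids the guard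
and does not graze avoids this set, as required by `PresymplecticSystem.regularAt_of_avoids`. -/
theorem PresymplecticImpact.isClosed_nonInward (h : PresymplecticImpact V X Ω K T c g Δ) :
    IsClosed {z | g z = 0 ∧ 0 ≤ differential I g z (X z)} :=
  (isClosed_eq h.smooth_g.continuous continuous_const).inter
    (isClosed_le continuous_const (h.system.isSmoothField.continuous_differential h.smooth_g))

theorem outwardGuard_subset_nonInward :
    outwardGuard I X g ⊆ {z | g z = 0 ∧ 0 ≤ differential I g z (X z)} :=
  fun _ hz => ⟨hz.1, hz.2.le⟩

/-- Points from which the time-`t` hybrid flow with `N` resets is not regular. -/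
def irregularPoints (X : (z : M) → TangentSpace I z) (S : Set M) (Δ : M → M)
    (Ω : (z : M) → TangentSpace I z [⋀^Fin 2]→ₗ[ℝ] ℝ) (N : ℕ) (t : ℝ) : Set M :=
  {x | ∃ y, CountedReach X S Δ N t x y ∧ ¬RegularAt X S Δ Ω N t x y}

/-- Without resets, irregularity forces a grazing contact or an endpoint on g = 0, and the latter is
the preimage of a nowhere dense set under the plain flow. With N + 1 resets, away from grazing
points and from g = 0, the run up to a rational time q shortly after the first impact is regular.
The rest of the run, with N resets, must then be irregular, so the starting point lies in the
preimage of a meagre set of the previous stage. The rational q keeps the union countable, and its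
variation is why all durations are treated together. -/
theorem PresymplecticImpact.isMeagre_irregularPoints (h : PresymplecticImpact V X Ω K T c g Δ)
    (N : ℕ) : ∀ t, IsMeagre (irregularPoints X (outwardGuard I X g) Δ Ω N t) := by
  have hX := h.system.isSmoothField
  have hgraz := h.system.isMeagre_grazingPoints h.smooth_g h.regular_g
  have hzero := (isNowhereDense_zeroSet h.smooth_g h.regular_g).isMeagre
  induction N with
  | zero =>
    intro t
    refine IsMeagre.mono ?_ (hgraz.union
      (h.system.isMeagre_regular_preimage (S := ∅) (Δ := id) (by simp) 0 t hzero))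
    rintro x ⟨y, hxy, hirr⟩
    cases hxy with
    | @flow _ γ _ _ ht hγ hS hx hy =>
      subst hx hy
      by_contra hcon
      rw [mem_union, not_or] at hcon
      obtain ⟨hng, hnz⟩ := hcon
      refine hirr (h.system.regularAt_of_avoids h.isClosed_nonInward outwardGuard_subset_nonInward
        ht hγ fun s hs hsC => ?_)
      rcases hsC.2.eq_or_lt with h0 | h0
      · exact hng ⟨s, γ, hs.1, hγ.mono (Icc_subset_Icc_right hs.2), rfl, hsC.1, h0.symm⟩
      · rcases hs.2.eq_or_lt with rfl | hst
        · exact hnz ⟨γ s, hsC.1, h.system.regularAt_of_avoids (C := ∅) isClosed_empty (by simp) hs.1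
            hγ (by simp)⟩
        · exact hS s ⟨hs.1, hst⟩ ⟨hsC.1, h0⟩
  | succ N ih =>
    intro u
    refine IsMeagre.mono ?_ ((hgraz.union hzero).union (isMeagre_iUnion fun q : ℚ =>
      h.system.isMeagre_regular_preimage h.reset_T 1 q (ih (u - q))))
    rintro x ⟨y, hxy, hirr⟩
    by_contra hcon
    rw [mem_union, mem_union, not_or, not_or, mem_iUnion, not_exists] at hcon
    obtain ⟨⟨hng, hnz⟩, hnq⟩ := hcon
    have hxy' := hxy
    cases hxy with
    | @jump _ s t _ γ _ z _ hs hγ hS hx hz hmem ht hu hy =>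
      subst hx hz
      -- An impact at time zero would mean starting on g = 0. A positive first arc leaves room for
      -- the time `a` spent in the flow box before the impact.
      have hs0 : 0 < s := by
        rcases hs.eq_or_lt with rfl | hs0
        · exact absurd hmem.1 hnz
        · exact hs0
      obtain ⟨ε, hε, W, hW, hjump⟩ := h.exists_regularAt_jump hmem
      have hcont : ContinuousWithinAt γ (Icc 0 s) s := (hγ s ⟨hs, le_rfl⟩).continuousWithinAt
      obtain ⟨η, hη, hηW⟩ := Metric.mem_nhdsWithin_iff.1 (hcont.preimage_mem_nhdsWithin hW)
      obtain ⟨a, ha0, ha⟩ := exists_between (lt_min (lt_min hε hs0) hη)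
      have haε := ha.trans_le ((min_le_left _ _).trans (min_le_left _ _))
      have has := ha.trans_le ((min_le_left _ _).trans (min_le_right _ _))
      have haη := ha.trans_le (min_le_right _ _)
      have haW : γ (s - a) ∈ W := hηW ⟨by
        rw [Metric.mem_ball, Real.dist_eq, abs_sub_comm, abs_of_nonneg (by linarith)]
        linarith, by linarith, by linarith⟩
      -- The bound `ε` keeps q within reach of the local impact lemma, and `t` keeps it before the
      -- end of the run.
      obtain ⟨q, hq1, hq2⟩ := exists_rat_btwn (show s < s + min ε t from
        lt_add_of_pos_right _ (lt_min hε ht))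
      have hqε : (q : ℝ) - s < ε := by linarith [min_le_left ε t]
      have hqt : (q : ℝ) - s < t := by linarith [min_le_right ε t]
      have hsh : IsMIntegralCurveOn (I := I) (fun r => γ (r + (s - a))) X (Icc 0 a) :=
        hγ.shift (s - a) fun r hr => ⟨by linarith [hr.1], by linarith [hr.2]⟩
      obtain ⟨y₁, hy₁⟩ := hjump a (fun r => γ (r + (s - a))) ⟨ha0, haε⟩ hsh
        (by simpa using haW) (by simp) (q - s) ⟨by linarith, hqε⟩
      simp only [zero_add] at hy₁
      have hfirst := h.system.regularAt_of_avoids (Δ := Δ) (t := s - a) h.isClosed_nonInward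
        outwardGuard_subset_nonInward (by linarith)
        (hγ.mono (Icc_subset_Icc_right (by linarith))) fun r hr hrC => by
          rcases hrC.2.eq_or_lt with h0 | h0
          · exact hng ⟨r, γ, hr.1, hγ.mono (Icc_subset_Icc_right (by linarith [hr.2])), rfl, hrC.1,
              h0.symm⟩
          · exact hS r ⟨hr.1, by linarith [hr.2]⟩ ⟨hrC.1, h0⟩
      have hone := hfirst.comp hy₁
      rw [zero_add, show s - a + (a + ((q : ℝ) - s)) = q by ring] at hone
      obtain ⟨N', hN', hrest⟩ := hone.reach.split hX hxy' (by linarith)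
      obtain rfl : N = N' := by omega
      refine hnq q ⟨y₁, ⟨y, hrest, fun hr => hirr ?_⟩, hone⟩
      have := hone.comp hr
      rwa [add_comm 1 N, add_sub_cancel] at this

/-- In the chart at `x`, with potentials at `x` and at `F x`, both sides are continuous functions of
the base point for fixed coordinate vectors. Equality at points accumulating at `x` therefore passes
to the limit. -/
theorem PresymplecticSystem.pullsBackAt_of_frequently (h : PresymplecticSystem V X Ω K T c)
    {F : M → M} {x : M} (hF : ContMDiffAt I I ∞ F x)
    (hfr : ∃ᶠ w in 𝓝 x, PullsBackAt Ω F w) : PullsBackAt Ω F x := by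
  obtain ⟨q, p, hpot⟩ := h.potential (F x)
  obtain ⟨q₀, p₀, hpot₀⟩ := h.potential x
  set e := extChartAt I x
  have hsymm : e.symm (e x) = x := extChartAt_to_inv (I := I) x
  have hcd : ∀ {Y : Type _} [NormedAddCommGroup Y] [NormedSpace ℝ Y] {f : E → Y} (a : E),
      ContDiffAt ℝ ∞ f (e x) → ContinuousAt (fun y => fderiv ℝ f y a) (e x) := fun a hf =>
    (hf.fderiv_right (m := 0) (by simp)).continuousAt.clm_apply continuousAt_const
  have hFq : ContMDiffAt I 𝓘(ℝ, V) ∞ (fun w => q (F w)) x := hpot.smooth_q.comp x hF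
  have hFp : ContMDiffAt I 𝓘(ℝ, V →L[ℝ] ℝ) ∞ (fun w => p (F w)) x := hpot.smooth_p.comp x hF
  have hF1 : ∀ᶠ w in 𝓝 x, MDifferentiableAt I I F w :=
    ((contMDiffAt_iff_contMDiffAt_nhds (by simp)).1 (hF.of_le (m := 1) (by simp))).mono
      fun w hw => hw.mdifferentiableAt (by simp)
  have hlhs : ∀ᶠ y in 𝓝 (e x), ∀ a b, Ω (F (e.symm y))
      ![mfderiv I I F (e.symm y) (chartVector x y a),
        mfderiv I I F (e.symm y) (chartVector x y b)] =
      fderiv ℝ (fun y => p (F (e.symm y))) y b (fderiv ℝ (fun y => q (F (e.symm y))) y a) -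
      fderiv ℝ (fun y => p (F (e.symm y))) y a (fderiv ℝ (fun y => q (F (e.symm y))) y b) := by
    filter_upwards [eventually_mem_target (I := I) x, eventually_chart_of_eventually (I := I) hF1,
      eventually_chart_of_eventually (I := I) (hF.continuousAt.eventually hpot.form_eq),
      eventually_chart_of_eventually (I := I)
        (hF.continuousAt.eventually (eventually_mdifferentiableAt hpot.smooth_q)),
      eventually_chart_of_eventually (I := I)
        (hF.continuousAt.eventually (eventually_mdifferentiableAt hpot.smooth_p))]
      with y hy hFy hform hqy hpy a b
    have h1 : ∀ a, fderiv ℝ (fun y => p (F (e.symm y))) y a =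
        vderiv I p (F (e.symm y)) (mfderiv I I F (e.symm y) (chartVector x y a)) := fun a => by
      rw [fderiv_chart_eq (f := fun w => p (F w)) hy (hpy.comp _ hFy), vderiv_comp hpy hFy]
    have h2 : ∀ a, fderiv ℝ (fun y => q (F (e.symm y))) y a =
        vderiv I q (F (e.symm y)) (mfderiv I I F (e.symm y) (chartVector x y a)) := fun a => by
      rw [fderiv_chart_eq (f := fun w => q (F w)) hy (hqy.comp _ hFy), vderiv_comp hqy hFy]
    rw [h1, h1, h2, h2]
    exact hform _ _
  have hrhs := hpot₀.eventually_chart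
  have hfr' : ∃ᶠ y in 𝓝 (e x), PullsBackAt Ω F (e.symm y) := fun hcon =>
    hfr (eventually_of_eventually_chart (I := I) hcon)
  have hP := contDiffAt_chart le_rfl hFp
  have hQ := contDiffAt_chart le_rfl hFq
  have hP₀ := contDiffAt_chart le_rfl hpot₀.smooth_p
  have hQ₀ := contDiffAt_chart le_rfl hpot₀.smooth_q
  have hfin : PullsBackAt Ω F (e.symm (e x)) := by
    intro u v
    obtain ⟨a, rfl⟩ := chartVector_surjective (mem_extChartAt_target x) u
    obtain ⟨b, rfl⟩ := chartVector_surjective (mem_extChartAt_target x) v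
    refine (hlhs.self_of_nhds a b).trans (Eq.trans ?_ (hrhs.self_of_nhds a b).symm)
    refine tendsto_nhds_unique_of_frequently_eq
      (((hcd b hP).clm_apply (hcd a hQ)).sub ((hcd a hP).clm_apply (hcd b hQ)))
      (((hcd b hP₀).clm_apply (hcd a hQ₀)).sub ((hcd a hP₀).clm_apply (hcd b hQ₀))) ?_
    refine (hfr'.and_eventually (hlhs.and hrhs)).mono ?_
    rintro y ⟨h1, h2, h3⟩
    exact (h2 a b).symm.trans ((h1 _ _).trans (h3 a b))
  rwa [hsymm] at hfin

/-- If the identity failed on a whole neighbourhood, a nonempty open set would consist of irregular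
points, contradicting Baire. At a regular point `F` agrees nearby with a regular map, since the
hybrid flow is deterministic. -/
theorem PresymplecticImpact.pullsBackAt_hybridFlow (h : PresymplecticImpact V X Ω K T c g Δ)
    {t : ℝ} {U : Set M} {F : M → M} (hU : IsOpen U) (hF : ContMDiffOn I I ∞ F U)
    (hreach : ∀ x ∈ U, HybridReach I X (outwardGuard I X g) Δ t x (F x)) {x : M} (hx : x ∈ U) :
    PullsBackAt Ω F x := by
  have hX := h.system.isSmoothField
  have : LocallyCompactSpace M := Manifold.locallyCompact_of_finiteDimensional I
  refine h.system.pullsBackAt_of_frequently (hF.contMDiffAt (hU.mem_nhds hx)) fun hcon => ?_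
  obtain ⟨O, hO, hOo, hxO⟩ := eventually_nhds_iff.1 hcon
  refine not_isMeagre_of_isOpen (hU.inter hOo) ⟨x, hx, hxO⟩
    (IsMeagre.mono ?_ (isMeagre_iUnion fun N => h.isMeagre_irregularPoints N t))
  rintro w ⟨hwU, hwO⟩
  obtain ⟨N, hN⟩ := (hreach w hwU).exists_countedReach
  refine mem_iUnion.2 ⟨N, F w, hN, fun hreg => hO w hwO ?_⟩
  obtain ⟨G, -, -, hGΩ, hGr⟩ := hreg
  refine hGΩ.congr ?_
  filter_upwards [hGr, hU.mem_nhds hwU] with v hv hvU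
  obtain ⟨N', hN'⟩ := (hreach v hvU).exists_countedReach
  exact (hN'.unique hX hv).2

end HybridFlow
end

noncomputable section

set_option linter.unusedSectionVars false

/-! ### Forms determined by a Gram matrix -/

section GramAlgebra

variable {V W : Type*} [AddCommGroup V] [Module ℝ V] [AddCommGroup W] [Module ℝ W]

theorem wedge_compLinearMap {k l : ℕ} (a : V [⋀^Fin k]→ₗ[ℝ] ℝ) (b : V [⋀^Fin l]→ₗ[ℝ] ℝ)
    (f : W →ₗ[ℝ] V) :
    (wedge a b).compLinearMap f = wedge (a.compLinearMap f) (b.compLinearMap f) := by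
  ext v
  simp only [wedge, AlternatingMap.compLinearMap_apply, AlternatingMap.domDomCongr_apply,
    LinearMap.compAlternatingMap_apply, AlternatingMap.domCoprod_apply, map_sum,
    sum_apply]
  refine Finset.sum_congr rfl fun σ _ => ?_
  induction σ using Quotient.inductionOn' with
  | h σ =>
    simp only [AlternatingMap.domCoprod.summand_mk'', smul_apply,
      MultilinearMap.domDomCongr_apply, MultilinearMap.domCoprod_apply]
    rfl

theorem wedgePow_compLinearMap (a : V [⋀^Fin 2]→ₗ[ℝ] ℝ) (f : W →ₗ[ℝ] V) (m : ℕ) :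
    (wedgePow a m).compLinearMap f = wedgePow (a.compLinearMap f) m := by
  induction m with
  | zero => ext v; rfl
  | succ m ih =>
    change (wedge (wedgePow a m) a).compLinearMap f = wedge (wedgePow (a.compLinearMap f) m) _
    rw [wedge_compLinearMap, ih]

theorem linearCombination_basisFun {k : ℕ} (u : Fin k → V) (i : Fin k) :
    Fintype.linearCombination ℝ u (Pi.basisFun ℝ (Fin k) i) = u i := by
  simp [Fintype.linearCombination_apply, Pi.single_apply]

/-- Both forms are pulled back to ℝ^k along e_i ↦ v_i and e_i ↦ w_i, where a two-form is determined
by its values on basis pairs. Wedge products commute with pullback, so they agree on the two tuples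
although no linear map between the spaces is given. -/
theorem twoForm_compLinearMap_eq {k : ℕ} {η : V [⋀^Fin 2]→ₗ[ℝ] ℝ} {η' : W [⋀^Fin 2]→ₗ[ℝ] ℝ}
    {v : Fin k → V} {w : Fin k → W} (h : ∀ i j, η ![v i, v j] = η' ![w i, w j]) :
    η.compLinearMap (Fintype.linearCombination ℝ v) =
      η'.compLinearMap (Fintype.linearCombination ℝ w) := by
  refine Module.Basis.ext_alternating (Pi.basisFun ℝ (Fin k)) fun s _ => ?_
  simp only [AlternatingMap.compLinearMap_apply, linearCombination_basisFun]
  refine Eq.trans (congrArg η ?_) ((h (s 0) (s 1)).trans (congrArg η' ?_)) <;>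
    · funext i
      fin_cases i <;> rfl

theorem oneForm_compLinearMap_eq {k : ℕ} {θ : V [⋀^Fin 1]→ₗ[ℝ] ℝ} {θ' : W [⋀^Fin 1]→ₗ[ℝ] ℝ}
    {v : Fin k → V} {w : Fin k → W} (h : ∀ i, θ (fun _ => v i) = θ' (fun _ => w i)) :
    θ.compLinearMap (Fintype.linearCombination ℝ v) =
      θ'.compLinearMap (Fintype.linearCombination ℝ w) := by
  refine Module.Basis.ext_alternating (Pi.basisFun ℝ (Fin k)) fun s _ => ?_
  simp only [AlternatingMap.compLinearMap_apply, linearCombination_basisFun]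
  refine Eq.trans (congrArg θ ?_) ((h (s 0)).trans (congrArg θ' ?_)) <;>
    · funext i
      fin_cases i
      rfl

theorem apply_eq_compLinearCombination {k : ℕ} (a : V [⋀^Fin k]→ₗ[ℝ] ℝ) (v : Fin k → V) :
    a v = a.compLinearMap (Fintype.linearCombination ℝ v) (Pi.basisFun ℝ (Fin k)) := by
  simp only [AlternatingMap.compLinearMap_apply, linearCombination_basisFun]

theorem wedgePow_eq_of_gram {m : ℕ} {η : V [⋀^Fin 2]→ₗ[ℝ] ℝ} {η' : W [⋀^Fin 2]→ₗ[ℝ] ℝ}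
    {v : Fin (2 * m) → V} {w : Fin (2 * m) → W} (h : ∀ i j, η ![v i, v j] = η' ![w i, w j]) :
    wedgePow η m v = wedgePow η' m w := by
  rw [apply_eq_compLinearCombination, apply_eq_compLinearCombination (wedgePow η' m),
    wedgePow_compLinearMap, wedgePow_compLinearMap, twoForm_compLinearMap_eq h]

theorem wedge_wedgePow_eq_of_gram {m : ℕ} {θ : V [⋀^Fin 1]→ₗ[ℝ] ℝ} {θ' : W [⋀^Fin 1]→ₗ[ℝ] ℝ}
    {η : V [⋀^Fin 2]→ₗ[ℝ] ℝ} {η' : W [⋀^Fin 2]→ₗ[ℝ] ℝ} {v : Fin (1 + 2 * m) → V}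
    {w : Fin (1 + 2 * m) → W} (hθ : ∀ i, θ (fun _ => v i) = θ' (fun _ => w i))
    (h : ∀ i j, η ![v i, v j] = η' ![w i, w j]) :
    wedge θ (wedgePow η m) v = wedge θ' (wedgePow η' m) w := by
  rw [apply_eq_compLinearCombination, apply_eq_compLinearCombination (wedge θ' (wedgePow η' m)),
    wedge_compLinearMap, wedge_compLinearMap, wedgePow_compLinearMap, wedgePow_compLinearMap,
    twoForm_compLinearMap_eq h, oneForm_compLinearMap_eq hθ]

/-- The relations `r` and `s` stand for equality of dT-values and of Ω-values. Interior
multiplication only prepends `x` and `y` to the tuples, so these relations have to be checked for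
the extended tuples. -/
theorem interiorMul_eq_of_forall {k : ℕ} {a : V [⋀^Fin k]→ₗ[ℝ] ℝ} {b : W [⋀^Fin k]→ₗ[ℝ] ℝ}
    {r : V → W → Prop} {s : V → W → V → W → Prop}
    (h : ∀ v w, (∀ i, r (v i) (w i)) → (∀ i j, s (v i) (w i) (v j) (w j)) → a v = b w) {x : V}
    {y : W} {v : Fin (k - 1) → V} {w : Fin (k - 1) → W} (hr : r x y) (hrv : ∀ i, r (v i) (w i))
    (hs : s x y x y) (hsl : ∀ i, s x y (v i) (w i)) (hsr : ∀ i, s (v i) (w i) x y)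
    (hsv : ∀ i j, s (v i) (w i) (v j) (w j)) : interiorMul x a v = interiorMul y b w := by
  cases k with
  | zero => rfl
  | succ k =>
    refine h (Matrix.vecCons x v) (Matrix.vecCons y w) (fun i => ?_) (fun i j => ?_)
    · cases i using Fin.cases with
      | zero => exact hr
      | succ i => exact hrv i
    · cases i using Fin.cases with
      | zero =>
        cases j using Fin.cases with
        | zero => exact hs
        | succ j => exact hsl j
      | succ i =>
        cases j using Fin.cases with
        | zero => exact hsr i
        | succ j => exact hsv i j

end GramAlgebra

/-! ### Preservation of forms determined by Ω and dT. -/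

section GramForms

universe u
variable {E : Type u} [NormedAddCommGroup E] [NormedSpace ℝ E] [FiniteDimensional ℝ E]
  {H : Type*} [TopologicalSpace H] {I : ModelWithCorners ℝ E H} [I.Boundaryless]
  {M : Type*} [TopologicalSpace M] [ChartedSpace H M] [IsManifold I ∞ M] [T2Space M]
  [SecondCountableTopology M]
  {V : Type*} [NormedAddCommGroup V] [NormedSpace ℝ V]
  {X : (z : M) → TangentSpace I z} {Ω : (z : M) → TangentSpace I z [⋀^Fin 2]→ₗ[ℝ] ℝ}
  {K T g : M → ℝ} {c : ℝ} {Δ : M → M}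

/-- The value of the form `α` on a tuple of vectors depends only on the values of `Ω` and `dT` on
these vectors. -/
def GramDetermined (Ω : (z : M) → TangentSpace I z [⋀^Fin 2]→ₗ[ℝ] ℝ) (T : M → ℝ) {k : ℕ}
    (α : (z : M) → TangentSpace I z [⋀^Fin k]→ₗ[ℝ] ℝ) : Prop :=
  ∀ z z' (v : Fin k → TangentSpace I z) (v' : Fin k → TangentSpace I z'),
    (∀ i, differential I T z (v i) = differential I T z' (v' i)) →
    (∀ i j, Ω z ![v i, v j] = Ω z' ![v' i, v' j]) → α z v = α z' v'

/-- Each condition reduces to comparing values of dT and of Ω. Along the flow, T increases by the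
constant c t. In the energy condition the new entries are dT(X) = c and Ω(X, v) = dK(v), both
respected by the reset. -/
theorem PresymplecticImpact.hybridPreserves (h : PresymplecticImpact V X Ω K T c g Δ) {k : ℕ}
    {α : (z : M) → TangentSpace I z [⋀^Fin k]→ₗ[ℝ] ℝ} (hα : GramDetermined Ω T α) :
    HybridPreserves I X (outwardGuard I X g) Δ α where
  flow := by
    intro t U F hU _ hF hreach x hx _
    refine AlternatingMap.ext fun v => ?_
    refine hα (F x) x (fun i => mfderiv I I F x (v i)) v (fun i => ?_)
      fun i j => h.pullsBackAt_hybridFlow hU hF hreach hx _ _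
    have h1 := HasMFDerivAt.comp (g := T) x
      (hasMFDerivAt_covector ((h.system.smooth_T (F x)).mdifferentiableAt (by simp)))
      ((hF.contMDiffAt (hU.mem_nhds hx)).mdifferentiableAt (by simp)).hasMFDerivAt
    have hT : (fun w => T (F w)) =ᶠ[𝓝 x] fun w => T w + c * t := by
      filter_upwards [hU.mem_nhds hx] with w hw
      obtain ⟨N, hN⟩ := (hreach w hw).exists_countedReach
      exact h.system.clock_of_reach h.reset_T hN
    have h2 : HasMFDerivAt I 𝓘(ℝ, ℝ) (fun w => T w + c * t) x (covector (E := E) I T x) := by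
      have h3 := (hasMFDerivAt_covector ((h.system.smooth_T x).mdifferentiableAt (by simp))).add
        (hasMFDerivAt_const (c := c * t) (x := x))
      have h4 : covector (E := E) I T x + 0 = covector I T x := add_zero _
      rw [← h4]
      exact h3
    exact congrArg (fun L : E →L[ℝ] ℝ => L (v i))
      (hasMFDerivAt_unique h1 (h2.congr_of_eventuallyEq hT))
  specular := by
    intro z hz v hv
    have hker : ∀ i, covector I g z (v i) = 0 := fun i => (hv i).covector_eq_zero h.smooth_g
    exact hα _ _ _ _ (fun i => h.reset_covector h.system.smooth_T h.reset_T hz (hker i))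
      fun i j => h.specular_vec hz (hker i) (hker j)
  energy := by
    intro z hz v hv
    have hker : ∀ i, covector I g z (v i) = 0 := fun i => (hv i).covector_eq_zero h.smooth_g
    have hXv : ∀ i, Ω (Δ z) ![X (Δ z), mfderivWithin I I Δ (outwardGuard I X g) z (v i)] =
        Ω z ![X z, v i] := fun i => by
      rw [h.system.hamilton, h.system.hamilton]
      exact h.reset_covector h.system.smooth_K h.reset_K hz (hker i)
    have hself : ∀ w, Ω w ![X w, X w] = 0 := fun w => twoFormBilin_self (Ω w) (X w)
    exact interiorMul_eq_of_forall (a := α (Δ z)) (b := α z)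
      (r := fun u w => differential I T (Δ z) u = differential I T z w)
      (s := fun u w u' w' => Ω (Δ z) ![u, u'] = Ω z ![w, w'])
      (fun v w h1 h2 => hα _ _ v w h1 h2) ((h.system.clock _).trans (h.system.clock _).symm)
      (fun i => h.reset_covector h.system.smooth_T h.reset_T hz (hker i))
      ((hself _).trans (hself _).symm) hXv
      (fun i => by rw [twoForm_swap, hXv, ← twoForm_swap])
      fun i j => h.specular_vec hz (hker i) (hker j)

theorem gramDetermined_self (Ω : (z : M) → TangentSpace I z [⋀^Fin 2]→ₗ[ℝ] ℝ) (T : M → ℝ) :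
    GramDetermined Ω T Ω := by
  intro z z' v v' _ h
  refine Eq.trans (congrArg (Ω z) ?_) ((h 0 1).trans (congrArg (Ω z') ?_)) <;>
    · funext i
      fin_cases i <;> rfl

theorem gramDetermined_wedgePow (Ω : (z : M) → TangentSpace I z [⋀^Fin 2]→ₗ[ℝ] ℝ) (T : M → ℝ)
    (m : ℕ) : GramDetermined Ω T (fun z => wedgePow (Ω z) m) :=
  fun _ _ _ _ _ h => wedgePow_eq_of_gram h

theorem gramDetermined_wedge_wedgePow (Ω : (z : M) → TangentSpace I z [⋀^Fin 2]→ₗ[ℝ] ℝ) (T : M → ℝ)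
    {θ : (z : M) → TangentSpace I z [⋀^Fin 1]→ₗ[ℝ] ℝ}
    (hθ : ∀ z u, θ z (fun _ => u) = differential I T z u) (m : ℕ) :
    GramDetermined Ω T (fun z => wedge (θ z) (wedgePow (Ω z) m)) :=
  fun _ _ _ _ h1 h => wedge_wedgePow_eq_of_gram (fun i => by rw [hθ, hθ]; exact h1 i) h

end GramForms
end

noncomputable section

set_option linter.unusedSectionVars false

/-! ### Primitives of the form `p dq` -/

theorem extDeriv_ofSubsingleton_apply {E : Type*} [NormedAddCommGroup E] [NormedSpace ℝ E]
    {f : E → E →L[ℝ] ℝ} {x : E} (hf : DifferentiableAt ℝ f x) (a b : E) :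
    extDeriv (fun y => ContinuousAlternatingMap.ofSubsingleton ℝ E ℝ (0 : Fin 1) (f y)) x ![a, b] =
      fderiv ℝ f x a b - fderiv ℝ f x b a := by
  have hd : DifferentiableAt ℝ
      (fun y => ContinuousAlternatingMap.ofSubsingleton ℝ E ℝ (0 : Fin 1) (f y)) x :=
    (ContinuousAlternatingMap.ofSubsingletonLIE (𝕜 := ℝ) (E := E) (F := ℝ)
      (0 : Fin 1)).toContinuousLinearEquiv.differentiableAt.comp x hf
  have h1 : ∀ c d : E, fderiv ℝ (fun y => f y c) x d = fderiv ℝ f x d c := by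
    intro c d
    rw [(hf.hasFDerivAt.clm_apply (hasFDerivAt_const c x)).fderiv]
    simp
  rw [extDeriv_apply hd, Fin.sum_univ_two]
  simp [h1, Fin.removeNth, Fin.succAbove]
  ring

section Primitive

universe u
variable {E : Type u} [NormedAddCommGroup E] [NormedSpace ℝ E] [FiniteDimensional ℝ E]
  {H : Type*} [TopologicalSpace H] {I : ModelWithCorners ℝ E H} [I.Boundaryless]
  {M : Type*} [TopologicalSpace M] [ChartedSpace H M] [IsManifold I ∞ M]
  {V : Type*} [NormedAddCommGroup V] [NormedSpace ℝ V]

theorem formInChart_eq_of_primitive {α : (z : M) → TangentSpace I z [⋀^Fin 1]→L[ℝ] ℝ}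
    {q : M → V} {p : M → V →L[ℝ] ℝ} {z : M} (hq : ContMDiffAt I 𝓘(ℝ, V) 2 q z)
    (hα : ∀ᶠ w in 𝓝 z, ∀ u : TangentSpace I w, α w (fun _ => u) = p w (vderiv I q w u)) :
    formInChart I α z =ᶠ[𝓝 (extChartAt I z z)] fun y =>
      ContinuousAlternatingMap.ofSubsingleton ℝ E ℝ (0 : Fin 1)
        ((p ((extChartAt I z).symm y)).comp
          (fderiv ℝ (fun y => q ((extChartAt I z).symm y)) y)) := by
  have hd : ∀ᶠ w in 𝓝 z, MDifferentiableAt I 𝓘(ℝ, V) q w := by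
    filter_upwards [(contMDiffAt_iff_contMDiffAt_nhds (by simp)).1 hq] with w hw
    exact hw.mdifferentiableAt (by simp)
  filter_upwards [eventually_mem_target z, eventually_chart_of_eventually hα,
    eventually_chart_of_eventually hd] with y hy h1 h2
  ext v
  have hv : v = fun _ => v 0 := by
    ext i; rw [Subsingleton.elim i 0]
  rw [hv]
  have h3 := h1 (chartVector z y (v 0))
  rw [← fderiv_chart_eq hy h2] at h3
  refine Eq.trans ?_ h3
  simp only [formInChart, I.range_eq_univ, mfderivWithin_univ]
  rfl

theorem vderiv_eq_fderiv {W : Type*} [NormedAddCommGroup W] [NormedSpace ℝ W] (f : E → W) (y : E) :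
    vderiv 𝓘(ℝ, E) f y = fderiv ℝ f y := mfderiv_eq_fderiv

theorem vderiv_congr {W : Type*} [NormedAddCommGroup W] [NormedSpace ℝ W] {f f' : M → W} {z : M}
    (h : f =ᶠ[𝓝 z] f') : vderiv I f z = vderiv I f' z := h.mfderiv_eq

theorem fderiv_chart_mfderiv {W : Type*} [NormedAddCommGroup W] [NormedSpace ℝ W] {f : M → W}
    {z : M} (hf : MDifferentiableAt I 𝓘(ℝ, W) f z) (u : TangentSpace I z) :
    fderiv ℝ (fun y => f ((extChartAt I z).symm y)) (extChartAt I z z)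
      (mfderiv I 𝓘(ℝ, E) (extChartAt I z) z u) = vderiv I f z u := by
  have h1 : MDifferentiableAt 𝓘(ℝ, E) 𝓘(ℝ, W) (fun y => f ((extChartAt I z).symm y))
      (extChartAt I z z) :=
    MDifferentiableAt.comp (g := f) _ (by rwa [extChartAt_to_inv])
      (hasMFDerivAt_extChartAt_symm (mem_extChartAt_target z)).mdifferentiableAt
  have h2 := vderiv_comp h1
    (hasMFDerivAt_extChartAt_of_mem (mem_extChartAt_source z)).mdifferentiableAt u
  rw [vderiv_eq_fderiv] at h2
  refine h2.symm.trans (congrArg (fun L : TangentSpace I z →L[ℝ] W => L u) (vderiv_congr ?_))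
  filter_upwards [extChartAt_source_mem_nhds (I := I) z] with w hw
  rw [(extChartAt I z).left_inv hw]

/-- The differential of a form `p dq`. -/
theorem mextDeriv_of_primitive {α : (z : M) → TangentSpace I z [⋀^Fin 1]→L[ℝ] ℝ}
    {q : M → V} {p : M → V →L[ℝ] ℝ} {z : M} (hq : ContMDiffAt I 𝓘(ℝ, V) 2 q z)
    (hp : ContMDiffAt I 𝓘(ℝ, V →L[ℝ] ℝ) 2 p z)
    (hα : ∀ᶠ w in 𝓝 z, ∀ u : TangentSpace I w, α w (fun _ => u) = p w (vderiv I q w u))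
    (u v : TangentSpace I z) :
    mextDeriv I α z ![u, v] =
      vderiv I p z u (vderiv I q z v) - vderiv I p z v (vderiv I q z u) := by
  set e := extChartAt I z with he
  let Q : E → V := fun y => q (e.symm y)
  let P : E → V →L[ℝ] ℝ := fun y => p (e.symm y)
  have hQ : ContDiffAt ℝ 2 Q (e z) := contDiffAt_chart (by norm_cast) hq
  have hP : ContDiffAt ℝ 2 P (e z) := contDiffAt_chart (by norm_cast) hp
  have hQ' : HasFDerivAt (fderiv ℝ Q) (fderiv ℝ (fderiv ℝ Q) (e z)) (e z) :=
    ((hQ.fderiv_right (m := 1) (by norm_num)).differentiableAt (by norm_num)).hasFDerivAt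
  have hPQ := (hP.differentiableAt (by norm_num)).hasFDerivAt.clm_comp hQ'
  let A : E →L[ℝ] E := mfderiv I 𝓘(ℝ, E) e z
  have h1 : mextDeriv I α z ![u, v] = extDeriv (fun y =>
      ContinuousAlternatingMap.ofSubsingleton ℝ E ℝ (0 : Fin 1) ((P y).comp (fderiv ℝ Q y))) (e z)
        ![A u, A v] := by
    rw [← (formInChart_eq_of_primitive hq hα).extDeriv_eq, ← extDerivWithin_univ,
      ← I.range_eq_univ]
    change extDerivWithin (formInChart I α z) (range I) (e z) _ = _
    congr 1
    ext i
    fin_cases i <;> rfl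
  rw [h1, extDeriv_ofSubsingleton_apply hPQ.differentiableAt, hPQ.fderiv]
  -- The terms with the second derivative of `Q` cancel by symmetry, leaving dp ∧ dq.
  have h2 := (hQ.isSymmSndFDerivAt (by simp)).eq (A u) (A v)
  have hu := fderiv_chart_mfderiv (hq.mdifferentiableAt (by simp)) u
  have hv := fderiv_chart_mfderiv (hq.mdifferentiableAt (by simp)) v
  have hu' := fderiv_chart_mfderiv (hp.mdifferentiableAt (by simp)) u
  have hv' := fderiv_chart_mfderiv (hp.mdifferentiableAt (by simp)) v
  rw [← hu, ← hv, ← hu', ← hv']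
  change P (e z) (fderiv ℝ (fderiv ℝ Q) (e z) (A u) (A v)) +
      fderiv ℝ P (e z) (A u) (fderiv ℝ Q (e z) (A v)) -
    (P (e z) (fderiv ℝ (fderiv ℝ Q) (e z) (A v) (A u)) +
      fderiv ℝ P (e z) (A v) (fderiv ℝ Q (e z) (A u))) =
    fderiv ℝ P (e z) (A u) (fderiv ℝ Q (e z) (A v)) -
      fderiv ℝ P (e z) (A v) (fderiv ℝ Q (e z) (A u))
  rw [h2]
  ring

theorem isPotentialAt_of_primitive {α : (z : M) → TangentSpace I z [⋀^Fin 1]→L[ℝ] ℝ}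
    {q : M → V} {p : M → V →L[ℝ] ℝ} {z₀ : M} (hq : ContMDiffAt I 𝓘(ℝ, V) ∞ q z₀)
    (hp : ContMDiffAt I 𝓘(ℝ, V →L[ℝ] ℝ) ∞ p z₀)
    (hα : ∀ᶠ w in 𝓝 z₀, ∀ u : TangentSpace I w, α w (fun _ => u) = p w (vderiv I q w u)) :
    IsPotentialAt (fun z => (-mextDeriv I α z).toAlternatingMap) q p z₀ := by
  refine ⟨hq, hp, ?_⟩
  have hq2 : ContMDiffAt I 𝓘(ℝ, V) 2 q z₀ := hq.of_le (by norm_cast)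
  have hp2 : ContMDiffAt I 𝓘(ℝ, V →L[ℝ] ℝ) 2 p z₀ := hp.of_le (by norm_cast)
  have : IsManifold I 2 M := IsManifold.of_le (n := ∞) (by norm_cast)
  -- The exterior derivative at `z` is computed in the chart at `z`, so the expression of the
  -- primitive is needed in a neighbourhood of each nearby point, not only of `z₀`.
  filter_upwards [hα.eventually_nhds, (contMDiffAt_iff_contMDiffAt_nhds (by simp)).1 hq2,
    (contMDiffAt_iff_contMDiffAt_nhds (by simp)).1 hp2] with z h1 h2 h3 u v
  have h4 := mextDeriv_of_primitive h2 h3 h1 u v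
  change -(mextDeriv I α z ![u, v]) = _
  rw [h4]
  ring

end Primitive
end

noncomputable section

set_option linter.unusedSectionVars false

/-! ### The specular condition for momentum jumps along a conormal -/

/-- The multiplier may depend on `s` without any regularity. Proportionality is expressed by
r(w₀)k(w) - r(w)k(w₀) = 0 with k(0)(w₀) ≠ 0, which contains no multiplier and can be differentiated
at zero. -/
theorem hasDerivAt_apply_eq_of_eventually_smul {V : Type*} [NormedAddCommGroup V] [NormedSpace ℝ V]
    {r k : ℝ → V →L[ℝ] ℝ} {r' k' : V →L[ℝ] ℝ} (hr : HasDerivAt r r' 0) (hk : HasDerivAt k k' 0)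
    (hrk : ∀ᶠ s in 𝓝 0, ∃ ε : ℝ, r s = ε • k s) (hk0 : k 0 ≠ 0) {ε : ℝ} (hε : r 0 = ε • k 0)
    {w : V} (hw : k 0 w = 0) : r' w = ε * k' w := by
  obtain ⟨w₀, hw₀⟩ := DFunLike.ne_iff.1 hk0
  have ev : ∀ {f : ℝ → V →L[ℝ] ℝ} {f' : V →L[ℝ] ℝ} (_ : HasDerivAt f f' 0) (x : V),
      HasDerivAt (fun s => f s x) (f' x) 0 := by
    intro f f' hf x
    simpa using hf.clm_apply (hasDerivAt_const (0 : ℝ) x)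
  have h1 := ((ev hr w₀).mul (ev hk w)).sub ((ev hr w).mul (ev hk w₀))
  have h2 : HasDerivAt (fun _ : ℝ => (0 : ℝ)) _ 0 := h1.congr_of_eventuallyEq (by
    filter_upwards [hrk] with s ⟨ε, hs⟩
    simp [hs]; ring)
  have h3 := h2.unique (hasDerivAt_const 0 0)
  have h4 : k 0 w₀ ≠ 0 := hw₀
  simp only [hε, smul_apply, smul_eq_mul, hw] at h3
  apply mul_right_cancel₀ h4
  linarith

section Specular

universe u
variable {E : Type u} [NormedAddCommGroup E] [NormedSpace ℝ E] [FiniteDimensional ℝ E]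
  {H : Type*} [TopologicalSpace H] {I : ModelWithCorners ℝ E H} [I.Boundaryless]
  {M : Type*} [TopologicalSpace M] [ChartedSpace H M] [IsManifold I ∞ M]
  {V : Type*} [NormedAddCommGroup V] [NormedSpace ℝ V]
  {Ω : (z : M) → TangentSpace I z [⋀^Fin 2]→ₗ[ℝ] ℝ} {S : Set M} {Δ : M → M}

theorem IsTangentTo.exists_curve {z : M} {v : E} (h : IsTangentTo I S z v) :
    ∃ γ : ℝ → M, γ 0 = z ∧ (∀ᶠ s in 𝓝 0, γ s ∈ S) ∧
      HasMFDerivAt 𝓘(ℝ, ℝ) I γ 0 ((1 : ℝ →L[ℝ] ℝ).smulRight v : ℝ →L[ℝ] E) := by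
  obtain ⟨γ, hγ, hγS, heq⟩ := h
  let L : ℝ →L[ℝ] E := mfderiv 𝓘(ℝ, ℝ) I γ 0
  have h1 : ∀ b : TangentBundle I M, b = ⟨z, v⟩ → b.1 = z ∧ @Eq E b.2 v := by
    rintro _ rfl; exact ⟨rfl, rfl⟩
  obtain ⟨h2, h3⟩ := h1 _ heq
  have h4 : L 1 = v := h3
  have h5 : L = ((1 : ℝ →L[ℝ] ℝ).smulRight v : ℝ →L[ℝ] E) := by
    ext; simp [h4]
  refine ⟨γ, h2, hγS, ?_⟩
  rw [← h5]
  exact (hγ.mdifferentiableAt (by simp)).hasMFDerivAt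

theorem hasDerivAt_comp_curve {W : Type*} [NormedAddCommGroup W] [NormedSpace ℝ W] {f : M → W}
    {γ : ℝ → M} {v : E} (hf : MDifferentiableAt I 𝓘(ℝ, W) f (γ 0))
    (hγ : HasMFDerivAt 𝓘(ℝ, ℝ) I γ 0 ((1 : ℝ →L[ℝ] ℝ).smulRight v : ℝ →L[ℝ] E)) :
    HasDerivAt (fun s => f (γ s)) (vderiv I f (γ 0) v) 0 := by
  let L : E →L[ℝ] W := vderiv I f (γ 0)
  have h1 : HasFDerivAt (fun s => f (γ s)) (L.comp ((1 : ℝ →L[ℝ] ℝ).smulRight v)) 0 :=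
    (HasMFDerivAt.comp (g := f) (0 : ℝ) hf.hasMFDerivAt hγ).hasFDerivAt
  refine h1.hasDerivAt.congr_deriv ?_
  change vderiv I f (γ 0) ((1 : ℝ) • v) = _
  rw [one_smul]

/-- Differentiation along curves in the guard shows that dq is unchanged by the reset, that its
values on tangent vectors lie in the kernel of dk, and that on this kernel dp changes by ε times the
Hessian of `k`. The Hessian is symmetric, so it drops out of dq ∧ dp. -/
theorem form_reset_eq_of_jump {q : M → V} {p : M → V →L[ℝ] ℝ} {k : V → ℝ} {z : M} (hz : z ∈ S)
    (hΔ : ContMDiffOn I I ∞ Δ S) (hpot : IsPotentialAt Ω q p z) (hpot' : IsPotentialAt Ω q p (Δ z))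
    (hk : ContDiffAt ℝ 2 k (q z)) (hreg : fderiv ℝ k (q z) ≠ 0)
    (hjump : ∀ᶠ w in 𝓝 z, w ∈ S → k (q w) = 0 ∧ q (Δ w) = q w ∧
      ∃ ε : ℝ, p (Δ w) = p w + ε • fderiv ℝ k (q w))
    {u v : E} (hu : IsTangentTo I S z u) (hv : IsTangentTo I S z v) :
    formVec Ω (Δ z) ![resetDeriv I Δ S z u, resetDeriv I Δ S z v] = formVec Ω z ![u, v] := by
  obtain ⟨-, -, ε, hε⟩ := hjump.self_of_nhds hz
  have hk' : DifferentiableAt ℝ (fderiv ℝ k) (q z) :=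
    (hk.fderiv_right (m := 1) (by norm_num)).differentiableAt (by norm_num)
  have key : ∀ u : E, IsTangentTo I S z u →
      fderiv ℝ k (q z) (vderiv I q z u) = 0 ∧
      vderiv I q (Δ z) (resetDeriv (E := E) I Δ S z u) = vderiv I q z u ∧
      ∀ w, fderiv ℝ k (q z) w = 0 → vderiv I p (Δ z) (resetDeriv (E := E) I Δ S z u) w =
        vderiv I p z u w + ε * fderiv ℝ (fderiv ℝ k) (q z) (vderiv I q z u) w := by
    intro u hu
    obtain ⟨γ, rfl, hγS, hγ⟩ := hu.exists_curve
    have hΔγ : HasMFDerivAt 𝓘(ℝ, ℝ) I (fun s => Δ (γ s)) 0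
        ((1 : ℝ →L[ℝ] ℝ).smulRight (resetDeriv (E := E) I Δ S (γ 0) u) : ℝ →L[ℝ] E) := by
      have h1 := hasMFDerivAt_reset_comp hΔ hγ hγS
      have h2 : (resetDeriv (E := E) I Δ S (γ 0)).comp ((1 : ℝ →L[ℝ] ℝ).smulRight u) =
        ((1 : ℝ →L[ℝ] ℝ).smulRight (resetDeriv (E := E) I Δ S (γ 0) u) : ℝ →L[ℝ] E) := by
        ext; simp
      rw [← h2]
      exact h1
    have hev : ∀ᶠ s in 𝓝 (0 : ℝ), k (q (γ s)) = 0 ∧ q (Δ (γ s)) = q (γ s) ∧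
      ∃ ε : ℝ, p (Δ (γ s)) = p (γ s) + ε • fderiv ℝ k (q (γ s)) := by
      filter_upwards [hγS, hγ.continuousAt.eventually hjump] with s h1 h2 using h2 h1
    have dq := hasDerivAt_comp_curve (hpot.smooth_q.mdifferentiableAt (by simp)) hγ
    have dp := hasDerivAt_comp_curve (hpot.smooth_p.mdifferentiableAt (by simp)) hγ
    have dq' := hasDerivAt_comp_curve (γ := fun s => Δ (γ s))
      (hpot'.smooth_q.mdifferentiableAt (by simp)) hΔγ
    have dp' := hasDerivAt_comp_curve (γ := fun s => Δ (γ s))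
      (hpot'.smooth_p.mdifferentiableAt (by simp)) hΔγ
    refine ⟨?_, ?_, fun w hw => ?_⟩
    · have h1 := (hk.differentiableAt (by norm_num)).hasFDerivAt.comp_hasDerivAt (0 : ℝ) dq
      exact (h1.congr_of_eventuallyEq (hev.mono fun s hs => hs.1.symm)).unique
        (hasDerivAt_const 0 0)
    · exact (dq'.congr_of_eventuallyEq (hev.mono fun s hs => hs.2.1.symm)).unique dq
    · have dk := hk'.hasFDerivAt.comp_hasDerivAt (0 : ℝ) dq
      have h1 := hasDerivAt_apply_eq_of_eventually_smul (dp'.sub dp) dk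
        (by filter_upwards [hev] with s ⟨_, _, ε, hs⟩
            exact ⟨ε, by simp [hs]⟩) hreg (ε := ε) (by simp [hε]) hw
      rw [sub_apply] at h1
      linarith
  obtain ⟨u1, u2, u3⟩ := key u hu
  obtain ⟨v1, v2, v3⟩ := key v hv
  have h2 := (hk.isSymmSndFDerivAt (by simp)).eq (vderiv I q z u) (vderiv I q z v)
  have e1 := hpot.form_eq.self_of_nhds u v
  have e2 := hpot'.form_eq.self_of_nhds (resetDeriv (E := E) I Δ S z u)
    (resetDeriv (E := E) I Δ S z v)
  rw [u2, v2, u3 _ v1, v3 _ u1] at e2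
  refine e2.trans (Eq.trans ?_ e1.symm)
  rw [h2]
  ring

/-- It suffices to check the specular condition for a two-form on pairs of vectors. -/
theorem resetPullbackEq_of_formVec
    (h : ∀ z ∈ S, ∀ u v : E, IsTangentTo I S z u → IsTangentTo I S z v →
      formVec Ω (Δ z) ![resetDeriv I Δ S z u, resetDeriv I Δ S z v] = formVec Ω z ![u, v]) :
    ResetPullbackEq I S Δ Ω := by
  intro z hz v hv
  refine (congrArg (formVec Ω (Δ z)) ?_).trans ((h z hz (v 0) (v 1) (hv 0) (hv 1)).trans
    (congrArg (formVec Ω z) ?_)) <;>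
  · funext i
    fin_cases i <;> rfl

theorem differential_ne_zero_of_eventuallyEq {g : M → ℝ} {q : M → V} {k : V → ℝ} {z : M}
    (hq : MDifferentiableAt I 𝓘(ℝ, V) q z) (hsurj : Function.Surjective (vderiv I q z))
    (hk : DifferentiableAt ℝ k (q z)) (hreg : fderiv ℝ k (q z) ≠ 0)
    (hg : g =ᶠ[𝓝 z] fun w => k (q w)) : differential I g z ≠ 0 := by
  intro h0
  refine hreg (ContinuousLinearMap.ext fun a => ?_)
  obtain ⟨u, rfl⟩ := hsurj a
  have h1 : vderiv I (fun w => k (q w)) z u = fderiv ℝ k (q z) (vderiv I q z u) :=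
    congrArg (fun A : TangentSpace I z →L[ℝ] ℝ => A u)
      (hk.hasFDerivAt.hasMFDerivAt.comp z hq.hasMFDerivAt).vderiv_eq
  rw [← h1, ← vderiv_congr hg, ← differential_eq_vderiv, h0]
  rfl

end Specular
end

noncomputable section

set_option linter.unusedSectionVars false

theorem vderiv_clm_comp {E : Type*} [NormedAddCommGroup E] [NormedSpace ℝ E]
    {H : Type*} [TopologicalSpace H] {I : ModelWithCorners ℝ E H}
    {M : Type*} [TopologicalSpace M] [ChartedSpace H M]
    {V W : Type*} [NormedAddCommGroup V] [NormedSpace ℝ V] [NormedAddCommGroup W] [NormedSpace ℝ W]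
    (L : V →L[ℝ] W) {f : M → V} {z : M} (hf : MDifferentiableAt I 𝓘(ℝ, V) f z)
    (u : TangentSpace I z) : vderiv I (fun w => L (f w)) z u = L (vderiv I f z u) :=
  congrArg (fun A : TangentSpace I z →L[ℝ] W => A u)
    (L.hasFDerivAt.hasMFDerivAt.comp z hf.hasMFDerivAt).vderiv_eq

/-! ### Canonical coordinates on the cotangent bundle -/

section CotangentCoordinates

variable {n : ℕ} {Q : Type*} [TopologicalSpace Q] [ChartedSpace (EuclideanSpace ℝ (Fin n)) Q]
  [IsManifold (𝓡 n) ∞ Q]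

/-- The position coordinates over the chart at `x₀`. -/
def cotangentPosition (x₀ : Q) (z : CotangentBundle n Q) : EuclideanSpace ℝ (Fin n) :=
  extChartAt (𝓡 n) x₀ z.proj

/-- The momentum coordinates over the chart at `x₀`. -/
def cotangentMomentum (x₀ : Q) (z : CotangentBundle n Q) : EuclideanSpace ℝ (Fin n) →L[ℝ] ℝ :=
  (trivializationAt (EuclideanSpace ℝ (Fin n) →L[ℝ] ℝ)
    (fun x : Q => TangentSpace (𝓡 n) x →L[ℝ] Bundle.Trivial Q ℝ x) x₀ z).2

theorem extChartAt_cotangentBundle (z w : CotangentBundle n Q) :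
    extChartAt (cotangentModel n) z w =
      (cotangentPosition z.proj w, cotangentMomentum z.proj w) := by
  rw [FiberBundle.extChartAt]
  rfl

theorem contMDiffAt_cotangentPosition (z : CotangentBundle n Q) :
    ContMDiffAt (cotangentModel n) 𝓘(ℝ, EuclideanSpace ℝ (Fin n)) ∞
      (cotangentPosition z.proj) z := by
  have h1 := contMDiffAt_extChartAt (I := cotangentModel n) (n := ∞) (x := z)
  exact ((contDiff_fst (𝕜 := ℝ)).contMDiff.contMDiffAt.comp z h1).congr_of_eventuallyEq
    (Eventually.of_forall fun w => (congrArg Prod.fst (extChartAt_cotangentBundle z w)).symm)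

theorem contMDiffAt_cotangentMomentum (z : CotangentBundle n Q) :
    ContMDiffAt (cotangentModel n) 𝓘(ℝ, EuclideanSpace ℝ (Fin n) →L[ℝ] ℝ) ∞
      (cotangentMomentum z.proj) z := by
  have h1 := contMDiffAt_extChartAt (I := cotangentModel n) (n := ∞) (x := z)
  exact ((contDiff_snd (𝕜 := ℝ)).contMDiff.contMDiffAt.comp z h1).congr_of_eventuallyEq
    (Eventually.of_forall fun w => (congrArg Prod.snd (extChartAt_cotangentBundle z w)).symm)

theorem vderiv_extChartAt_cotangentBundle (z : CotangentBundle n Q)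
    (u : TangentSpace (cotangentModel n) z) :
    vderiv (cotangentModel n) (extChartAt (cotangentModel n) z) z u =
      (vderiv (cotangentModel n) (cotangentPosition z.proj) z u,
        vderiv (cotangentModel n) (cotangentMomentum z.proj) z u) := by
  have h1 := (contMDiffAt_extChartAt (I := cotangentModel n) (n := ∞) (x := z)).mdifferentiableAt
    (by simp)
  refine Prod.ext ?_ ?_
  · refine (vderiv_clm_comp (ContinuousLinearMap.fst ℝ _ _) h1 u).symm.trans ?_
    exact congrArg (fun f => vderiv (cotangentModel n) f z u)
      (funext fun w => congrArg Prod.fst (extChartAt_cotangentBundle z w))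
  · refine (vderiv_clm_comp (ContinuousLinearMap.snd ℝ _ _) h1 u).symm.trans ?_
    exact congrArg (fun f => vderiv (cotangentModel n) f z u)
      (funext fun w => congrArg Prod.snd (extChartAt_cotangentBundle z w))

theorem exists_cotangent_coordinates (z : CotangentBundle n Q) (a : EuclideanSpace ℝ (Fin n))
    (b : EuclideanSpace ℝ (Fin n) →L[ℝ] ℝ) : ∃ v : TangentSpace (cotangentModel n) z,
      vderiv (cotangentModel n) (cotangentPosition z.proj) z v = a ∧
      vderiv (cotangentModel n) (cotangentMomentum z.proj) z v = b := by
  obtain ⟨v, hv⟩ : ∃ v,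
      vderiv (cotangentModel n) (extChartAt (cotangentModel n) z) z v = (a, b) := by
    refine ⟨mfderiv 𝓘(ℝ, _) (cotangentModel n) (extChartAt (cotangentModel n) z).symm
      (extChartAt (cotangentModel n) z z) (a, b), ?_⟩
    have := mfderiv_extChartAt_mfderiv_extChartAt_symm (I := cotangentModel n)
      (mem_extChartAt_target z) (a, b)
    rwa [extChartAt_to_inv] at this
  rw [vderiv_extChartAt_cotangentBundle] at hv
  exact ⟨v, congrArg Prod.fst hv, congrArg Prod.snd hv⟩

theorem eq_zero_of_cotangent_coordinates {z : CotangentBundle n Q}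
    {u : TangentSpace (cotangentModel n) z}
    (h1 : vderiv (cotangentModel n) (cotangentPosition z.proj) z u = 0)
    (h2 : vderiv (cotangentModel n) (cotangentMomentum z.proj) z u = 0) : u = 0 := by
  have h3 := vderiv_extChartAt_cotangentBundle z u
  rw [h1, h2] at h3
  have h4 := mfderiv_extChartAt_symm_mfderiv_extChartAt (I := cotangentModel n)
    (mem_extChartAt_source z) u
  let A : EuclideanSpace ℝ (Fin n) × (EuclideanSpace ℝ (Fin n) →L[ℝ] ℝ) →L[ℝ]
      EuclideanSpace ℝ (Fin n) × (EuclideanSpace ℝ (Fin n) →L[ℝ] ℝ) :=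
    mfderiv 𝓘(ℝ, _) (cotangentModel n) (extChartAt (cotangentModel n) z).symm
      (extChartAt (cotangentModel n) z z)
  exact h4.symm.trans ((congrArg A h3).trans A.map_zero)

/-- The trivialization of the dual bundle composes a covector with the differential of the inverse
chart, which gives the usual components p_i. -/
theorem cotangentMomentum_apply {x₀ : Q} {z : CotangentBundle n Q}
    (hz : z.proj ∈ (extChartAt (𝓡 n) x₀).source) (a : EuclideanSpace ℝ (Fin n)) :
    cotangentMomentum x₀ z a = (show EuclideanSpace ℝ (Fin n) →L[ℝ] ℝ from z.snd)
      ((show EuclideanSpace ℝ (Fin n) →L[ℝ] EuclideanSpace ℝ (Fin n) from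
        mfderiv 𝓘(ℝ, EuclideanSpace ℝ (Fin n)) (𝓡 n) (extChartAt (𝓡 n) x₀).symm
          (extChartAt (𝓡 n) x₀ z.proj)) a) := by
  have hz' : z.proj ∈ (chartAt (EuclideanSpace ℝ (Fin n)) x₀).source := by
    rwa [extChartAt_source] at hz
  rw [cotangentMomentum, hom_trivializationAt_apply]
  have h1 := TangentBundle.symmL_trivializationAt (I := 𝓡 n) hz'
  rw [(𝓡 n).range_eq_univ, mfderivWithin_univ] at h1
  have h2 := congrArg (fun L : EuclideanSpace ℝ (Fin n) →L[ℝ] EuclideanSpace ℝ (Fin n) => L a) h1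
  rw [← h2]
  simp [ContinuousLinearMap.inCoordinates]
  rfl

theorem tautologicalCovector_eq (z : CotangentBundle n Q) :
    ∀ᶠ w in 𝓝 z, ∀ u : TangentSpace (cotangentModel n) w, tautologicalCovector w u =
      cotangentMomentum z.proj w (vderiv (cotangentModel n) (cotangentPosition z.proj) w u) := by
  have hproj : ∀ w : CotangentBundle n Q, MDifferentiableAt (cotangentModel n) (𝓡 n)
      (fun w : CotangentBundle n Q => w.proj) w := fun w =>
    (contMDiff_proj (n := ∞) _ w).mdifferentiableAt (by simp)
  filter_upwards [(hproj z).continuousAt.eventually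
    (extChartAt_source_mem_nhds (I := 𝓡 n) z.proj)] with w hw u
  rw [cotangentMomentum_apply hw]
  have h1 := vderiv_comp (hasMFDerivAt_extChartAt_of_mem hw).mdifferentiableAt (hproj w) u
  have h2 := mfderiv_extChartAt_symm_mfderiv_extChartAt hw
    (mfderiv (cotangentModel n) (𝓡 n) (fun w : CotangentBundle n Q => w.proj) w u)
  let A : EuclideanSpace ℝ (Fin n) →L[ℝ] EuclideanSpace ℝ (Fin n) :=
    mfderiv 𝓘(ℝ, EuclideanSpace ℝ (Fin n)) (𝓡 n) (extChartAt (𝓡 n) z.proj).symm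
      (extChartAt (𝓡 n) z.proj w.proj)
  let B : EuclideanSpace ℝ (Fin n) →L[ℝ] ℝ := w.snd
  exact (congrArg B ((congrArg A h1).trans h2)).symm

/-- The base point of the chart is kept separate from `z` so that the same coordinates serve a state
and its reset, which lie in one fibre. -/
theorem isPotentialAt_symplecticForm {x₀ : Q} {z : CotangentBundle n Q} (hz : z.proj = x₀) :
    IsPotentialAt symplecticForm (cotangentPosition x₀) (cotangentMomentum x₀) z := by
  subst hz
  exact isPotentialAt_of_primitive (contMDiffAt_cotangentPosition z)
    (contMDiffAt_cotangentMomentum z) (tautologicalCovector_eq z)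

theorem symplecticForm_nondegenerate {z : CotangentBundle n Q}
    {u : TangentSpace (cotangentModel n) z} (hu : ∀ v, symplecticForm z ![u, v] = 0) : u = 0 := by
  have h := fun v => ((isPotentialAt_symplecticForm rfl).form_eq.self_of_nhds u v).symm.trans (hu v)
  refine eq_zero_of_cotangent_coordinates ?_ ?_
  · refine SeparatingDual.eq_zero_of_forall_dual_eq_zero (R := ℝ) fun b => ?_
    obtain ⟨v, h1, h2⟩ := exists_cotangent_coordinates z 0 b
    have h3 := h v
    rw [h1, h2] at h3
    simpa using h3
  · ext a
    obtain ⟨v, h1, h2⟩ := exists_cotangent_coordinates z a 0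
    have h3 := h v
    rw [h1, h2] at h3
    simpa using h3

theorem mem_chart_source_cotangentBundle {z w : CotangentBundle n Q} :
    w ∈ (chartAt (ModelProd (EuclideanSpace ℝ (Fin n))
        (EuclideanSpace ℝ (Fin n) →L[ℝ] ℝ)) z).source ↔
      w.proj ∈ (chartAt (EuclideanSpace ℝ (Fin n)) z.proj).source := by
  simp only [FiberBundle.chartedSpace_chartAt, mfld_simps]
  exact ⟨fun h => h.1.1, fun h => ⟨⟨h, mem_univ _⟩, h⟩⟩

instance [T2Space Q] : T2Space (CotangentBundle n Q) := by
  have : T2Space (ModelProd (EuclideanSpace ℝ (Fin n)) (EuclideanSpace ℝ (Fin n) →L[ℝ] ℝ)) :=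
    inferInstanceAs (T2Space (_ × _))
  refine ⟨fun z w hzw => ?_⟩
  have hc : Continuous (fun z : CotangentBundle n Q => z.proj) := FiberBundle.continuous_proj _ _
  by_cases hp : z.proj = w.proj
  · let c := chartAt (ModelProd (EuclideanSpace ℝ (Fin n)) (EuclideanSpace ℝ (Fin n) →L[ℝ] ℝ)) z
    have hz : z ∈ c.source := mem_chart_source _ z
    have hw : w ∈ c.source :=
      mem_chart_source_cotangentBundle.2 (hp ▸ mem_chart_source _ z.proj)
    obtain ⟨U, U', hU, hU', hzU, hwU, hd⟩ := t2_separation (c.injOn.ne hz hw hzw)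
    exact ⟨_, _, c.isOpen_inter_preimage hU, c.isOpen_inter_preimage hU', ⟨hz, hzU⟩, ⟨hw, hwU⟩,
      (hd.preimage c).mono inter_subset_right inter_subset_right⟩
  · exact separated_by_continuous hc hp

instance [SecondCountableTopology Q] : SecondCountableTopology (CotangentBundle n Q) := by
  have : SecondCountableTopology
      (ModelProd (EuclideanSpace ℝ (Fin n)) (EuclideanSpace ℝ (Fin n) →L[ℝ] ℝ)) :=
    inferInstanceAs (SecondCountableTopology (_ × _))
  obtain ⟨s, hs, hcov⟩ := TopologicalSpace.countable_cover_nhds fun x : Q =>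
    chart_source_mem_nhds (EuclideanSpace ℝ (Fin n)) x
  refine ChartedSpace.secondCountable_of_countable_cover
    (ModelProd (EuclideanSpace ℝ (Fin n)) (EuclideanSpace ℝ (Fin n) →L[ℝ] ℝ))
    (s := (fun x : Q => (⟨x, 0⟩ : CotangentBundle n Q)) '' s) ?_ (hs.image _)
  rw [biUnion_image, eq_univ_iff_forall]
  intro z
  obtain ⟨x, hx, hzx⟩ := mem_iUnion₂.1 (hcov ▸ mem_univ z.proj)
  exact mem_iUnion₂.2 ⟨x, hx, mem_chart_source_cotangentBundle.2 hzx⟩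

end CotangentCoordinates
end

noncomputable section

set_option linter.unusedSectionVars false

/-! ### Time-independent impact systems -/

section ImpactSystems

variable {n : ℕ} {Q : Type*} [TopologicalSpace Q] [ChartedSpace (EuclideanSpace ℝ (Fin n)) Q]
  [IsManifold (𝓡 n) ∞ Q]

theorem contMDiff_cotangent_proj :
    ContMDiff (cotangentModel n) (𝓡 n) ∞ (fun z : CotangentBundle n Q => z.proj) :=
  contMDiff_proj _

/-- The symplectic form alone is nondegenerate, so the clock can be the constant zero. -/
theorem presymplecticSystem_of_hamiltonian {K : CotangentBundle n Q → ℝ}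
    (hK : ContMDiff (cotangentModel n) 𝓘(ℝ, ℝ) ∞ K)
    {X : (z : CotangentBundle n Q) → TangentSpace (cotangentModel n) z}
    (hX : IsHamiltonianVectorField K X) :
    PresymplecticSystem (EuclideanSpace ℝ (Fin n)) X symplecticForm K (fun _ => 0) 0 where
  potential z := ⟨_, _, isPotentialAt_symplecticForm rfl⟩
  smooth_K := hK
  smooth_T := contMDiff_const
  hamilton := hX
  clock z := by
    have h : differential (cotangentModel n) (fun _ : CotangentBundle n Q => (0 : ℝ)) z = 0 :=
      (hasMFDerivAt_const (c := (0 : ℝ)) (x := z)).mfderiv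
    rw [h]
    rfl
  nondegenerate z u hu _ := symplecticForm_nondegenerate hu

/-- The differential of a function of the position in canonical coordinates. -/
theorem fderiv_surf_chart {k : Q → ℝ} (hk : ContMDiff (𝓡 n) 𝓘(ℝ, ℝ) ∞ k) {x₀ x : Q}
    (hx : x ∈ (extChartAt (𝓡 n) x₀).source) (a : EuclideanSpace ℝ (Fin n)) :
    fderiv ℝ (fun y => k ((extChartAt (𝓡 n) x₀).symm y)) (extChartAt (𝓡 n) x₀ x) a =
      covector (𝓡 n) k x
        ((show EuclideanSpace ℝ (Fin n) →L[ℝ] EuclideanSpace ℝ (Fin n) from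
        mfderiv 𝓘(ℝ, EuclideanSpace ℝ (Fin n)) (𝓡 n) (extChartAt (𝓡 n) x₀).symm
          (extChartAt (𝓡 n) x₀ x)) a) := by
  refine (fderiv_chart_eq ((extChartAt (𝓡 n) x₀).map_source hx)
    ((hk _).mdifferentiableAt (by simp)) a).trans ?_
  have h : covector (𝓡 n) k ((extChartAt (𝓡 n) x₀).symm (extChartAt (𝓡 n) x₀ x)) =
      covector (𝓡 n) k x := by rw [(extChartAt (𝓡 n) x₀).left_inv hx]
  rw [← h]
  rfl

theorem fderiv_chart_ne_zero {k : Q → ℝ} (hk : ContMDiff (𝓡 n) 𝓘(ℝ, ℝ) ∞ k) {x : Q}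
    (h : differential (𝓡 n) k x ≠ 0) :
    fderiv ℝ (fun y => k ((extChartAt (𝓡 n) x).symm y)) (extChartAt (𝓡 n) x x) ≠ 0 := by
  intro h0
  refine h (ContinuousLinearMap.ext fun u => ?_)
  have h1 := fderiv_chart_mfderiv ((hk x).mdifferentiableAt (by simp)) u
  rw [h0] at h1
  exact h1.symm

theorem cotangentMomentum_add_smul {x₀ : Q} {z : CotangentBundle n Q}
    (hz : z.proj ∈ (extChartAt (𝓡 n) x₀).source) {k : Q → ℝ}
    (hk : ContMDiff (𝓡 n) 𝓘(ℝ, ℝ) ∞ k) (ε : ℝ) :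
    cotangentMomentum x₀ ⟨z.proj, (show TangentSpace (𝓡 n) z.proj →L[ℝ] ℝ from z.snd) +
      ε • differential (𝓡 n) k z.proj⟩ = cotangentMomentum x₀ z +
        ε • fderiv ℝ (fun y => k ((extChartAt (𝓡 n) x₀).symm y)) (cotangentPosition x₀ z) := by
  ext a
  rw [cotangentMomentum_apply (by exact hz), add_apply, cotangentMomentum_apply hz, smul_apply,
    cotangentPosition, fderiv_surf_chart hk hz]
  rfl

theorem ImpactSystem.presymplecticImpact (P : ImpactSystem n Q)
    {X : (z : CotangentBundle n Q) → TangentSpace (cotangentModel n) z}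
    {Δ : CotangentBundle n Q → CotangentBundle n Q} (hX : IsHamiltonianVectorField P.ham X)
    (hΔ : P.IsReset X Δ) :
    PresymplecticImpact (EuclideanSpace ℝ (Fin n)) X symplecticForm P.ham (fun _ => 0) 0
      (fun z => P.surf z.proj) Δ where
  system := presymplecticSystem_of_hamiltonian P.ham_smooth hX
  smooth_g := P.surf_smooth.comp contMDiff_cotangent_proj
  regular_g z hz := by
    refine differential_ne_zero_of_eventuallyEq (q := cotangentPosition z.proj)
      (k := fun y => P.surf ((extChartAt (𝓡 n) z.proj).symm y))
      ((contMDiffAt_cotangentPosition z).mdifferentiableAt (by simp))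
      (fun a => (exists_cotangent_coordinates z a 0).imp fun v hv => hv.1)
      ((contDiffAt_chart le_rfl (P.surf_smooth z.proj)).differentiableAt (by simp))
      (fderiv_chart_ne_zero P.surf_smooth (P.surf_regular _ hz)) ?_
    filter_upwards [(contMDiff_cotangent_proj.continuous.continuousAt).eventually
      (extChartAt_source_mem_nhds (I := 𝓡 n) z.proj)] with w hw
    rw [cotangentPosition, (extChartAt (𝓡 n) z.proj).left_inv hw]
  smooth_reset := hΔ.smooth
  disjoint := hΔ.disjoint
  reset_g z hz := by
    obtain ⟨ε, hε⟩ := hΔ.momentum z hz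
    rw [hε]
    exact hz.1
  reset_K z hz := hΔ.energy z hz
  reset_T _ _ := rfl
  specular := by
    refine resetPullbackEq_of_formVec fun z hz u v hu hv => ?_
    have hproj : (Δ z).proj = z.proj := by
      obtain ⟨ε, hε⟩ := hΔ.momentum z hz
      rw [hε]
    refine form_reset_eq_of_jump (q := cotangentPosition z.proj)
      (k := fun y => P.surf ((extChartAt (𝓡 n) z.proj).symm y)) hz hΔ.smooth
      (isPotentialAt_symplecticForm rfl) (isPotentialAt_symplecticForm hproj)
      ((contDiffAt_chart le_rfl (P.surf_smooth z.proj)).of_le (by norm_cast))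
      (fderiv_chart_ne_zero P.surf_smooth (P.surf_regular _ hz.1)) ?_ hu hv
    filter_upwards [(contMDiff_cotangent_proj.continuous.continuousAt).eventually
      (extChartAt_source_mem_nhds (I := 𝓡 n) z.proj)] with w hw hwS
    obtain ⟨ε, hε⟩ := hΔ.momentum w hwS
    refine ⟨?_, ?_, ε, ?_⟩
    · simp only [cotangentPosition]
      rw [(extChartAt (𝓡 n) z.proj).left_inv hw]
      exact hwS.1
    · rw [hε]; rfl
    · rw [hε]; exact cotangentMomentum_add_smul hw P.surf_smooth ε

end ImpactSystems
end

noncomputable section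

set_option linter.unusedSectionVars false

/-! ### The extended phase space -/

section ProdDeriv

variable {E : Type*} [NormedAddCommGroup E] [NormedSpace ℝ E]
  {H : Type*} [TopologicalSpace H] {I : ModelWithCorners ℝ E H}
  {M : Type*} [TopologicalSpace M] [ChartedSpace H M]
  {V W : Type*} [NormedAddCommGroup V] [NormedSpace ℝ V] [NormedAddCommGroup W] [NormedSpace ℝ W]

theorem vderiv_prodMk {f : M → V} {g : M → W} {z : M} (hf : MDifferentiableAt I 𝓘(ℝ, V) f z)
    (hg : MDifferentiableAt I 𝓘(ℝ, W) g z) (u : TangentSpace I z) :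
    vderiv I (fun w => (f w, g w)) z u = (vderiv I f z u, vderiv I g z u) :=
  Prod.ext (vderiv_clm_comp (ContinuousLinearMap.fst ℝ V W) (hf.prodMk_space hg) u).symm
    (vderiv_clm_comp (ContinuousLinearMap.snd ℝ V W) (hf.prodMk_space hg) u).symm

/-- The covector `-s dt + m` on `ℝ × V`. -/
def actionCovector : ℝ × (V →L[ℝ] ℝ) →L[ℝ] (ℝ × V →L[ℝ] ℝ) :=
  (ContinuousLinearMap.fst ℝ ℝ (V →L[ℝ] ℝ)).smulRight (-ContinuousLinearMap.fst ℝ ℝ V) +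
    ((ContinuousLinearMap.compL ℝ (ℝ × V) V ℝ).flip (ContinuousLinearMap.snd ℝ ℝ V)).comp
      (ContinuousLinearMap.snd ℝ ℝ (V →L[ℝ] ℝ))

theorem actionCovector_apply (a : ℝ × (V →L[ℝ] ℝ)) (b : ℝ × V) :
    actionCovector a b = a.2 b.2 - a.1 * b.1 := by
  simp [actionCovector]
  ring

theorem vderiv_actionCovector {K : M → ℝ} {m : M → V →L[ℝ] ℝ} {z : M}
    (hK : MDifferentiableAt I 𝓘(ℝ, ℝ) K z) (hm : MDifferentiableAt I 𝓘(ℝ, V →L[ℝ] ℝ) m z)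
    (u : TangentSpace I z) : vderiv I (fun w => actionCovector (K w, m w)) z u =
      actionCovector (vderiv I K z u, vderiv I m z u) := by
  rw [← vderiv_prodMk hK hm]
  exact vderiv_clm_comp actionCovector (hK.prodMk_space hm) u

theorem contMDiffAt_actionCovector {K : M → ℝ} {m : M → V →L[ℝ] ℝ} {z : M}
    (hK : ContMDiffAt I 𝓘(ℝ, ℝ) ∞ K z) (hm : ContMDiffAt I 𝓘(ℝ, V →L[ℝ] ℝ) ∞ m z) :
    ContMDiffAt I 𝓘(ℝ, ℝ × V →L[ℝ] ℝ) ∞ (fun w => actionCovector (K w, m w)) z :=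
  actionCovector.contDiff.contMDiff.contMDiffAt.comp z (hK.prodMk_space hm)

end ProdDeriv

/-! ### Canonical coordinates and the form ω_H on the extended phase space. -/

section Extended

variable {n : ℕ} {Q : Type*} [TopologicalSpace Q] [ChartedSpace (EuclideanSpace ℝ (Fin n)) Q]
  [IsManifold (𝓡 n) ∞ Q]

/-- The component along `T^*Q` of a tangent vector of `ℝ × T^*Q`. -/
def phasePart (w : ℝ × CotangentBundle n Q) :
    TangentSpace (extendedModel n) w →L[ℝ] TangentSpace (cotangentModel n) w.2 :=
  mfderiv (extendedModel n) (cotangentModel n) (fun w : ℝ × CotangentBundle n Q => w.2) w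

/-- The tangent vector of `ℝ × T^*Q` with given components. -/
def extendedVector (w : ℝ × CotangentBundle n Q) (s : ℝ)
    (v : TangentSpace (cotangentModel n) w.2) : TangentSpace (extendedModel n) w := (s, v)

theorem timeCovector_extendedVector (w : ℝ × CotangentBundle n Q) (s : ℝ)
    (v : TangentSpace (cotangentModel n) w.2) : timeCovector w (extendedVector w s v) = s := by
  rw [timeCovector, differential, mfderiv_fst]
  rfl

theorem phasePart_extendedVector (w : ℝ × CotangentBundle n Q) (s : ℝ)
    (v : TangentSpace (cotangentModel n) w.2) : phasePart w (extendedVector w s v) = v := by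
  rw [phasePart, mfderiv_snd]
  rfl

theorem extendedVector_eq (w : ℝ × CotangentBundle n Q) (u : TangentSpace (extendedModel n) w) :
    extendedVector w (timeCovector w u) (phasePart w u) = u := by
  rw [timeCovector, differential, mfderiv_fst, phasePart, mfderiv_snd]
  rfl

theorem contMDiff_time : ContMDiff (extendedModel n) 𝓘(ℝ, ℝ) ∞
    (fun w : ℝ × CotangentBundle n Q => w.1) := contMDiff_fst

theorem contMDiff_phase : ContMDiff (extendedModel n) (cotangentModel n) ∞
    (fun w : ℝ × CotangentBundle n Q => w.2) := contMDiff_snd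

/-- The coordinates `(t, x)`. -/
def extendedPosition (x₀ : Q) (w : ℝ × CotangentBundle n Q) : ℝ × EuclideanSpace ℝ (Fin n) :=
  (w.1, cotangentPosition x₀ w.2)

/-- The covector `p dx - H dt` in coordinates. -/
def extendedMomentum (K : ℝ × CotangentBundle n Q → ℝ) (x₀ : Q) (w : ℝ × CotangentBundle n Q) :
    ℝ × EuclideanSpace ℝ (Fin n) →L[ℝ] ℝ :=
  actionCovector (K w, cotangentMomentum x₀ w.2)

variable {K : ℝ × CotangentBundle n Q → ℝ}

theorem contMDiffAt_extendedPosition (w : ℝ × CotangentBundle n Q) :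
    ContMDiffAt (extendedModel n) 𝓘(ℝ, ℝ × EuclideanSpace ℝ (Fin n)) ∞
      (extendedPosition w.2.proj) w :=
  (contMDiff_time w).prodMk_space
    (ContMDiffAt.comp (g := cotangentPosition w.2.proj) w (contMDiffAt_cotangentPosition w.2)
      (contMDiff_phase w))

theorem contMDiffAt_extendedMomentum (hK : ContMDiff (extendedModel n) 𝓘(ℝ, ℝ) ∞ K)
    (w : ℝ × CotangentBundle n Q) :
    ContMDiffAt (extendedModel n) 𝓘(ℝ, ℝ × EuclideanSpace ℝ (Fin n) →L[ℝ] ℝ) ∞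
      (extendedMomentum K w.2.proj) w :=
  contMDiffAt_actionCovector (hK w)
    (ContMDiffAt.comp (g := cotangentMomentum w.2.proj) w (contMDiffAt_cotangentMomentum w.2)
      (contMDiff_phase w))

theorem vderiv_comp_phase {W : Type*} [NormedAddCommGroup W] [NormedSpace ℝ W]
    {f : CotangentBundle n Q → W} {w : ℝ × CotangentBundle n Q}
    (hf : MDifferentiableAt (cotangentModel n) 𝓘(ℝ, W) f w.2)
    (u : TangentSpace (extendedModel n) w) :
    vderiv (extendedModel n) (fun w : ℝ × CotangentBundle n Q => f w.2) w u =
      vderiv (cotangentModel n) f w.2 (phasePart w u) :=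
  vderiv_comp hf ((contMDiff_phase w).mdifferentiableAt (by simp)) u

theorem vderiv_extendedPosition {x₀ : Q} {w : ℝ × CotangentBundle n Q}
    (h : MDifferentiableAt (cotangentModel n) 𝓘(ℝ, EuclideanSpace ℝ (Fin n))
      (cotangentPosition x₀) w.2) (u : TangentSpace (extendedModel n) w) :
    vderiv (extendedModel n) (extendedPosition x₀) w u = (timeCovector w u,
      vderiv (cotangentModel n) (cotangentPosition x₀) w.2 (phasePart w u)) := by
  rw [← vderiv_comp_phase h]
  exact vderiv_prodMk ((contMDiff_time w).mdifferentiableAt (by simp))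
    (MDifferentiableAt.comp (g := cotangentPosition x₀) w h
      ((contMDiff_phase w).mdifferentiableAt (by simp))) u

theorem vderiv_extendedMomentum (hK : ContMDiff (extendedModel n) 𝓘(ℝ, ℝ) ∞ K)
    (w : ℝ × CotangentBundle n Q) (u : TangentSpace (extendedModel n) w) :
    vderiv (extendedModel n) (extendedMomentum K w.2.proj) w u =
      actionCovector (differential (extendedModel n) K w u,
        vderiv (cotangentModel n) (cotangentMomentum w.2.proj) w.2 (phasePart w u)) := by
  have h := (contMDiffAt_cotangentMomentum w.2).mdifferentiableAt (by simp)
  have hK' := (hK w).mdifferentiableAt (by simp)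
  have h' := MDifferentiableAt.comp (g := cotangentMomentum w.2.proj) w h
    ((contMDiff_phase w).mdifferentiableAt (by simp))
  have h1 := vderiv_actionCovector hK' h' u
  refine h1.trans ?_
  rw [← vderiv_comp_phase h]
  rfl

theorem actionForm_eq (w : ℝ × CotangentBundle n Q) :
    ∀ᶠ y in 𝓝 w, ∀ u : TangentSpace (extendedModel n) y, actionForm K y (fun _ => u) =
      extendedMomentum K w.2.proj y
        (vderiv (extendedModel n) (extendedPosition w.2.proj) y u) := by
  filter_upwards [continuousAt_snd.eventually (tautologicalCovector_eq w.2),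
    continuousAt_snd.eventually
      (eventually_mdifferentiableAt (contMDiffAt_cotangentPosition w.2))] with y h1 h2 u
  rw [vderiv_extendedPosition h2, extendedMomentum, actionCovector_apply]
  change tautologicalCovector y.2 (phasePart y u) - K y * timeCovector y u = _
  rw [h1]

/-- The action form is p dq for the position q = (t, x) and the covector with components (-H, p).
Time thus becomes one more position coordinate, and a moving surface in Q becomes a fixed one in ℝ ×
Q. -/
theorem isPotentialAt_extendedSymplecticForm (hK : ContMDiff (extendedModel n) 𝓘(ℝ, ℝ) ∞ K)
    {x₀ : Q} {w : ℝ × CotangentBundle n Q} (hw : w.2.proj = x₀) :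
    IsPotentialAt (extendedSymplecticForm K) (extendedPosition x₀) (extendedMomentum K x₀) w := by
  subst hw
  exact isPotentialAt_of_primitive (contMDiffAt_extendedPosition w)
    (contMDiffAt_extendedMomentum hK w) (actionForm_eq w)

/-- This is ω_H = ω + dH ∧ dt, evaluated on components along T^*Q and along time. -/
theorem extendedSymplecticForm_apply (hK : ContMDiff (extendedModel n) 𝓘(ℝ, ℝ) ∞ K)
    (w : ℝ × CotangentBundle n Q) (u v : TangentSpace (extendedModel n) w) :
    extendedSymplecticForm K w ![u, v] = symplecticForm w.2 ![phasePart w u, phasePart w v] -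
      differential (extendedModel n) K w v * timeCovector w u +
      differential (extendedModel n) K w u * timeCovector w v := by
  have h := (contMDiffAt_cotangentPosition w.2).mdifferentiableAt (by simp)
  have h1 := (isPotentialAt_extendedSymplecticForm hK rfl).form_eq.self_of_nhds u v
  have h2 := (isPotentialAt_symplecticForm rfl).form_eq.self_of_nhds
    (phasePart w u) (phasePart w v)
  have u1 := vderiv_extendedPosition h u
  have v1 := vderiv_extendedPosition h v
  have u2 := vderiv_extendedMomentum hK w u
  have v2 := vderiv_extendedMomentum hK w v
  rw [u1, v1, u2, v2, actionCovector_apply, actionCovector_apply] at h1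
  rw [h1, h2]
  ring

end Extended
end

noncomputable section

set_option linter.unusedSectionVars false

/-! ### Time-dependent impact systems -/

theorem clm_prod_decomposition {A : Type*} [NormedAddCommGroup A] [NormedSpace ℝ A]
    (L : ℝ × A →L[ℝ] ℝ) (s : ℝ) (x v : A) :
    L (s, v) = s * L (1, x) + L (0, v) - s * L (0, x) := by
  rw [← smul_eq_mul, ← smul_eq_mul, ← map_smul, ← map_smul, ← map_add, ← map_sub]
  simp

section TimeDependent

variable {n : ℕ} {Q : Type*} [TopologicalSpace Q] [ChartedSpace (EuclideanSpace ℝ (Fin n)) Q]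
  [IsManifold (𝓡 n) ∞ Q] {K : ℝ × CotangentBundle n Q → ℝ}

theorem suspendedField_eq
    (X : ℝ → (z : CotangentBundle n Q) → TangentSpace (cotangentModel n) z)
    (w : ℝ × CotangentBundle n Q) : suspendedField X w = extendedVector w 1 (X w.1 w.2) := rfl

theorem differential_extendedVector_zero (hK : ContMDiff (extendedModel n) 𝓘(ℝ, ℝ) ∞ K)
    (w : ℝ × CotangentBundle n Q) (v : TangentSpace (cotangentModel n) w.2) :
    differential (extendedModel n) K w (extendedVector w 0 v) =
      differential (cotangentModel n) (fun z => K (w.1, z)) w.2 v := by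
  have h1 : MDifferentiableAt (cotangentModel n) (extendedModel n)
      (fun z : CotangentBundle n Q => (w.1, z)) w.2 :=
    mdifferentiableAt_const.prodMk mdifferentiableAt_id
  have h2 := vderiv_comp (f := K) (G := fun z : CotangentBundle n Q => (w.1, z)) (z := w.2)
    ((hK _).mdifferentiableAt (by simp)) h1 v
  rw [differential_eq_vderiv, differential_eq_vderiv, h2]
  have h3 := congrArg (fun L : EuclideanSpace ℝ (Fin n) × (EuclideanSpace ℝ (Fin n) →L[ℝ] ℝ) →L[ℝ]
    ℝ × (EuclideanSpace ℝ (Fin n) × (EuclideanSpace ℝ (Fin n) →L[ℝ] ℝ)) => L v)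
    (mfderiv_prod_right (I := 𝓘(ℝ, ℝ)) (I' := cotangentModel n) (x₀ := w.1) (y₀ := w.2))
  exact (congrArg (vderiv (extendedModel n) K w) h3).symm

/-- Since dH_t(X_t) = 0, the differential of H is dt times its value on the suspended field, plus
dH_t on the phase component. The term ω(X_t, ·) = dH_t then cancels against dH ∧ dt. -/
theorem extended_hamilton (hK : ContMDiff (extendedModel n) 𝓘(ℝ, ℝ) ∞ K)
    {X : ℝ → (z : CotangentBundle n Q) → TangentSpace (cotangentModel n) z}
    (hX : ∀ t, IsHamiltonianVectorField (fun z => K (t, z)) (X t))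
    (w : ℝ × CotangentBundle n Q) (v : TangentSpace (extendedModel n) w) :
    extendedSymplecticForm K w ![suspendedField X w, v] = 0 := by
  have h0 : differential (cotangentModel n) (fun z => K (w.1, z)) w.2 (X w.1 w.2) = 0 := by
    rw [← hX]
    exact (symplecticForm w.2).map_eq_zero_of_eq _ (i := 0) (j := 1) rfl (by decide)
  have h1 : differential (extendedModel n) K w v =
      timeCovector w v * differential (extendedModel n) K w (suspendedField X w) +
        differential (cotangentModel n) (fun z => K (w.1, z)) w.2 (phasePart w v) := by
    have h2 := differential_extendedVector_zero hK w (X w.1 w.2)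
    have h3 := differential_extendedVector_zero hK w (phasePart w v)
    rw [h0] at h2
    have h4 := clm_prod_decomposition (differential (extendedModel n) K w) (timeCovector w v)
      (X w.1 w.2) (phasePart w v)
    have h5 := congrArg (differential (extendedModel n) K w) (extendedVector_eq w v)
    rw [← h3]
    refine (h5.symm.trans h4).trans ?_
    refine (congrArg (fun r => _ - timeCovector w v * r) h2).trans ?_
    rw [mul_zero, sub_zero]
    rfl
  rw [extendedSymplecticForm_apply hK, h1, suspendedField_eq, phasePart_extendedVector,
    timeCovector_extendedVector, hX]
  ring

/-- The form has a kernel, spanned by the field itself, so the Hamiltonian of the abstract system is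
zero. Time is the clock that restores nondegeneracy: on vectors with dt = 0, pairing with such
vectors gives ω. -/
theorem presymplecticSystem_suspended (hK : ContMDiff (extendedModel n) 𝓘(ℝ, ℝ) ∞ K)
    {X : ℝ → (z : CotangentBundle n Q) → TangentSpace (cotangentModel n) z}
    (hX : ∀ t, IsHamiltonianVectorField (fun z => K (t, z)) (X t)) :
    PresymplecticSystem (ℝ × EuclideanSpace ℝ (Fin n)) (suspendedField X)
      (extendedSymplecticForm K) (fun _ => 0) (fun w => w.1) 1 where
  potential w := ⟨_, _, isPotentialAt_extendedSymplecticForm hK rfl⟩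
  smooth_K := contMDiff_const
  smooth_T := contMDiff_time
  hamilton w v := by
    have h : differential (extendedModel n) (fun _ : ℝ × CotangentBundle n Q => (0 : ℝ)) w = 0 :=
      (hasMFDerivAt_const (c := (0 : ℝ)) (x := w)).mfderiv
    rw [h, extended_hamilton hK hX]
    rfl
  clock w := timeCovector_extendedVector w 1 _
  nondegenerate w u hu ht := by
    have ht' : timeCovector w u = 0 := ht
    have h1 : phasePart w u = 0 := by
      refine symplecticForm_nondegenerate fun v => ?_
      have h2 := hu (extendedVector w 0 v)
      rw [extendedSymplecticForm_apply hK, phasePart_extendedVector, timeCovector_extendedVector,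
        ht'] at h2
      simpa using h2
    rw [← extendedVector_eq w u, ht', h1]
    rfl

/-- The coordinate expression of a function on `ℝ × Q`. -/
def surfInChart (k : ℝ × Q → ℝ) (x₀ : Q) (y : ℝ × EuclideanSpace ℝ (Fin n)) : ℝ :=
  k (y.1, (extChartAt (𝓡 n) x₀).symm y.2)

theorem surfInChart_eq (k : ℝ × Q → ℝ) (b : ℝ × Q) :
    surfInChart (n := n) k b.2 =
      fun y => k ((extChartAt (𝓘(ℝ, ℝ).prod (𝓡 n)) b).symm y) := by
  funext y
  rw [extChartAt_prod]
  rfl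

theorem contDiffAt_surfInChart {k : ℝ × Q → ℝ}
    (hk : ContMDiff (𝓘(ℝ, ℝ).prod (𝓡 n)) 𝓘(ℝ, ℝ) ∞ k) (w : ℝ × CotangentBundle n Q) :
    ContDiffAt ℝ ∞ (surfInChart k w.2.proj) (extendedPosition w.2.proj w) := by
  have h := contDiffAt_chart le_rfl (hk (w.1, w.2.proj))
  rw [← surfInChart_eq, extChartAt_prod] at h
  exact h

theorem fderiv_surfInChart_ne_zero {k : ℝ × Q → ℝ}
    (hk : ContMDiff (𝓘(ℝ, ℝ).prod (𝓡 n)) 𝓘(ℝ, ℝ) ∞ k) {w : ℝ × CotangentBundle n Q}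
    (h : differential (𝓘(ℝ, ℝ).prod (𝓡 n)) k (w.1, w.2.proj) ≠ 0) :
    fderiv ℝ (surfInChart k w.2.proj) (extendedPosition w.2.proj w) ≠ 0 := by
  intro h0
  refine h (ContinuousLinearMap.ext fun u => ?_)
  have h1 := fderiv_chart_mfderiv ((hk (w.1, w.2.proj)).mdifferentiableAt (by simp)) u
  have h2 : extChartAt (𝓘(ℝ, ℝ).prod (𝓡 n)) (w.1, w.2.proj) (w.1, w.2.proj) =
      extendedPosition w.2.proj w := by
    rw [extChartAt_prod]; rfl
  rw [← surfInChart_eq, h2, h0] at h1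
  exact h1.symm

theorem fderiv_surfInChart {k : ℝ × Q → ℝ} {x₀ : Q} {y : ℝ × EuclideanSpace ℝ (Fin n)}
    (hk : DifferentiableAt ℝ (surfInChart k x₀) y) (b : ℝ × EuclideanSpace ℝ (Fin n)) :
    fderiv ℝ (surfInChart k x₀) y b =
      b.1 * deriv (fun s => k (s, (extChartAt (𝓡 n) x₀).symm y.2)) y.1 +
        fderiv ℝ (fun a => k (y.1, (extChartAt (𝓡 n) x₀).symm a)) y.2 b.2 := by
  have h1 : HasDerivAt (fun s : ℝ => (s, y.2)) ((1 : ℝ), (0 : EuclideanSpace ℝ (Fin n))) y.1 :=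
    (hasDerivAt_id y.1).prodMk (hasDerivAt_const y.1 y.2)
  have h2 := (hk.hasFDerivAt.comp_hasDerivAt (f := fun s : ℝ => (s, y.2)) y.1 h1).deriv
  have h3 := (hk.hasFDerivAt.comp (f := fun a => (y.1, a)) y.2
    (hasFDerivAt_prodMk_right y.1 y.2)).fderiv
  have h4 : deriv (fun s => k (s, (extChartAt (𝓡 n) x₀).symm y.2)) y.1 =
    fderiv ℝ (surfInChart k x₀) y (1, 0) := h2
  have h5 : fderiv ℝ (fun a => k (y.1, (extChartAt (𝓡 n) x₀).symm a)) y.2 =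
    (fderiv ℝ (surfInChart k x₀) y).comp (ContinuousLinearMap.inr ℝ ℝ _) := h3
  rw [h4, h5, ← smul_eq_mul, ← map_smul]
  simp [← map_add]

end TimeDependent
end

noncomputable section

set_option linter.unusedSectionVars false

/-! ### The corner conditions for a possibly moving surface. -/

section TimeDependentImpacts

variable {n : ℕ} {Q : Type*} [TopologicalSpace Q] [ChartedSpace (EuclideanSpace ℝ (Fin n)) Q]
  [IsManifold (𝓡 n) ∞ Q]

theorem vderiv_extendedPosition_surjective (w : ℝ × CotangentBundle n Q) :
    Function.Surjective (vderiv (extendedModel n) (extendedPosition w.2.proj) w) := by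
  intro a
  obtain ⟨v, hv, -⟩ := exists_cotangent_coordinates w.2 a.2 0
  refine ⟨extendedVector w a.1 v, ?_⟩
  rw [vderiv_extendedPosition
    ((contMDiffAt_cotangentPosition w.2).mdifferentiableAt (by simp)),
    timeCovector_extendedVector, phasePart_extendedVector, hv]

theorem surfInChart_extendedPosition (k : ℝ × Q → ℝ) {x₀ : Q} {w : ℝ × CotangentBundle n Q}
    (hx : w.2.proj ∈ (extChartAt (𝓡 n) x₀).source) :
    surfInChart k x₀ (extendedPosition x₀ w) = k (w.1, w.2.proj) :=
  congrArg (fun x => k (w.1, x)) ((extChartAt (𝓡 n) x₀).left_inv hx)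

/-- The jump of the covector `p dx - H dt` is a multiple of the differential of the surface. -/
theorem TimeDependentImpactSystem.IsReset.extendedMomentum_eq {P : TimeDependentImpactSystem n Q}
    {X : ℝ → (z : CotangentBundle n Q) → TangentSpace (cotangentModel n) z}
    {Δ : ℝ × CotangentBundle n Q → ℝ × CotangentBundle n Q} (hΔ : P.IsReset X Δ)
    {w : ℝ × CotangentBundle n Q} (hw : w ∈ P.guard X) {x₀ : Q}
    (hx : w.2.proj ∈ (extChartAt (𝓡 n) x₀).source)
    (hd : DifferentiableAt ℝ (surfInChart P.surf x₀) (extendedPosition x₀ w)) :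
    ∃ ε : ℝ, extendedMomentum P.ham x₀ (Δ w) = extendedMomentum P.ham x₀ w +
      ε • fderiv ℝ (surfInChart P.surf x₀) (extendedPosition x₀ w) := by
  obtain ⟨ε, h1, h2⟩ := hΔ.corner w hw
  have hsurf : ContMDiff (𝓡 n) 𝓘(ℝ, ℝ) ∞ (fun x => P.surf (w.1, x)) :=
    P.surf_smooth.comp (contMDiff_const.prodMk contMDiff_id)
  have h3 : cotangentMomentum x₀ (Δ w).2 = _ :=
    (congrArg (fun y => cotangentMomentum x₀ y.2) h1).trans
      (cotangentMomentum_add_smul hx hsurf ε)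
  refine ⟨ε, ContinuousLinearMap.ext fun b => ?_⟩
  have h4 : (extChartAt (𝓡 n) x₀).symm (extendedPosition x₀ w).2 = w.2.proj :=
    (extChartAt (𝓡 n) x₀).left_inv hx
  have h5 : (extendedPosition x₀ w).1 = w.1 := rfl
  have h6 : (extendedPosition x₀ w).2 = cotangentPosition x₀ w.2 := rfl
  rw [add_apply, smul_apply, fderiv_surfInChart hd, h4, h5, h6, extendedMomentum,
    extendedMomentum, actionCovector_apply, actionCovector_apply]
  simp only [h3, add_apply, smul_apply, smul_eq_mul]
  -- The energy jump is the time component of the covector jump; its sign matches the entry -H of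
  -- the covector.
  have h7 : P.ham (Δ w) = P.ham w - ε * deriv (fun s => P.surf (s, w.2.proj)) w.1 := by
    linarith
  rw [h7]
  ring

theorem TimeDependentImpactSystem.presymplecticImpact (P : TimeDependentImpactSystem n Q)
    {X : ℝ → (z : CotangentBundle n Q) → TangentSpace (cotangentModel n) z}
    {Δ : ℝ × CotangentBundle n Q → ℝ × CotangentBundle n Q}
    (hX : ∀ t, IsHamiltonianVectorField (fun z => P.ham (t, z)) (X t)) (hΔ : P.IsReset X Δ) :
    PresymplecticImpact (ℝ × EuclideanSpace ℝ (Fin n)) (suspendedField X)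
      (extendedSymplecticForm P.ham) (fun _ => 0) (fun w => w.1) 1
      (fun w => P.surf (w.1, w.2.proj)) Δ where
  system := presymplecticSystem_suspended P.ham_smooth hX
  smooth_g := P.surf_smooth.comp
    (contMDiff_time.prodMk (contMDiff_cotangent_proj.comp contMDiff_phase))
  regular_g w hw := by
    refine differential_ne_zero_of_eventuallyEq (q := extendedPosition w.2.proj)
      (k := surfInChart P.surf w.2.proj)
      ((contMDiffAt_extendedPosition w).mdifferentiableAt (by simp))
      (vderiv_extendedPosition_surjective w)
      ((contDiffAt_surfInChart P.surf_smooth w).differentiableAt (by simp))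
      (fderiv_surfInChart_ne_zero P.surf_smooth (P.surf_regular _ hw)) ?_
    filter_upwards [((contMDiff_cotangent_proj.comp
      contMDiff_phase).continuous.continuousAt (x := w)).eventually
      (extChartAt_source_mem_nhds (I := 𝓡 n) w.2.proj)] with y hy
    exact (surfInChart_extendedPosition P.surf hy).symm
  smooth_reset := hΔ.smooth
  disjoint := hΔ.disjoint
  reset_g w hw := by
    obtain ⟨ε, hε, -⟩ := hΔ.corner w hw
    rw [hε]
    exact hw.1
  reset_K _ _ := rfl
  reset_T w hw := by
    obtain ⟨ε, hε, -⟩ := hΔ.corner w hw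
    rw [hε]
  specular := by
    refine resetPullbackEq_of_formVec fun w hw u v hu hv => ?_
    have hproj : (Δ w).2.proj = w.2.proj := by
      obtain ⟨ε, hε, -⟩ := hΔ.corner w hw
      rw [hε]
    have hk : ContDiffAt ℝ 2 (surfInChart P.surf w.2.proj) (extendedPosition w.2.proj w) :=
      (contDiffAt_surfInChart P.surf_smooth w).of_le (by norm_cast)
    refine form_reset_eq_of_jump (q := extendedPosition w.2.proj)
      (k := surfInChart P.surf w.2.proj) hw hΔ.smooth
      (isPotentialAt_extendedSymplecticForm P.ham_smooth rfl)
      (isPotentialAt_extendedSymplecticForm P.ham_smooth hproj) hk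
      (fderiv_surfInChart_ne_zero P.surf_smooth (P.surf_regular _ hw.1)) ?_ hu hv
    filter_upwards [((contMDiff_cotangent_proj.comp
      contMDiff_phase).continuous.continuousAt (x := w)).eventually
      (extChartAt_source_mem_nhds (I := 𝓡 n) w.2.proj),
      (contMDiffAt_extendedPosition w).continuousAt.eventually (hk.eventually (by simp))]
      with y hy hyd hyS
    refine ⟨?_, ?_, hΔ.extendedMomentum_eq hyS hy (hyd.differentiableAt (by norm_num))⟩
    · exact (surfInChart_extendedPosition P.surf hy).trans hyS.1
    · obtain ⟨ε, hε, -⟩ := hΔ.corner y hyS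
      rw [hε]
      rfl

end TimeDependentImpacts
end

theorem mainTheorem9 {n : ℕ} {Q : Type*} [TopologicalSpace Q] [T2Space Q]
    [SecondCountableTopology Q] [ChartedSpace (EuclideanSpace ℝ (Fin n)) Q]
    [IsManifold (𝓡 n) ∞ Q] :
    (∀ (P : ImpactSystem n Q)
        (X : (z : CotangentBundle n Q) → TangentSpace (cotangentModel n) z)
        (Δ : CotangentBundle n Q → CotangentBundle n Q),
        IsHamiltonianVectorField P.ham X → P.IsReset X Δ →
        HybridPreserves (cotangentModel n) X (P.guard X) Δ symplecticForm ∧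
        HybridPreserves (cotangentModel n) X (P.guard X) Δ
          (fun z => wedgePow (symplecticForm z) n)) ∧
    (∀ (P : TimeDependentImpactSystem n Q)
        (X : ℝ → (z : CotangentBundle n Q) → TangentSpace (cotangentModel n) z)
        (Δ : ℝ × CotangentBundle n Q → ℝ × CotangentBundle n Q),
        (∀ t, IsHamiltonianVectorField (fun z => P.ham (t, z)) (X t)) → P.IsReset X Δ →
        HybridPreserves (extendedModel n) (suspendedField X) (P.guard X) Δ
          (extendedSymplecticForm P.ham) ∧
        HybridPreserves (extendedModel n) (suspendedField X) (P.guard X) Δ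
          (fun w => wedge (timeForm w) (wedgePow (extendedSymplecticForm P.ham w) n))) := by
  refine ⟨fun P X Δ hX hΔ => ?_, fun P X Δ hX hΔ => ?_⟩
  · have h := P.presymplecticImpact hX hΔ
    exact ⟨h.hybridPreserves (gramDetermined_self _ _),
      h.hybridPreserves (gramDetermined_wedgePow _ _ n)⟩
  · have h := P.presymplecticImpact hX hΔ
    exact ⟨h.hybridPreserves (gramDetermined_self _ _),
      h.hybridPreserves (gramDetermined_wedge_wedgePow _ _ (fun _ _ => rfl) n)⟩
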